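/- Let $R$ be a field and let $D$ be a cocommutative pointed Hopf algebra over $R$. Assume that the irreducible component $D^1$ of $D$ containing $1$ is of Birkhoff–Witt type, i.e. for every primitive element $\partial$ of $D$ there is an infinite divided power sequence $1=d_0,\ d_1=\partial,\ d_2,\dots$ in $D^1$ (meaning $\Delta(d_n)=\sum_{i=0}^n d_i\otimes d_{n-i}$ for all $n$). All $D$-module algebras are commutative $R$-algebras. A $D$-module algebra is called AS (artinian simple) if it is an artinian ring, is nonzero, and has no $D$-stable ideals other than $0$ and itself. For a $D$-module $V$ put $V^D=\{v\in V: dv=\varepsilon(d)v \text{ for all } d\in D\}$. Let $K\subset L$ be an inclusion of AS $D$-module algebras that is a Picard–Vessiot extension: $K^D=L^D=:k$, and there is a $D$-module subalgebra $K\subset A\subset L$ such that the total quotient ring of $A$ is $L$ and $H:=(A\otimes_K A)^D$ generates the left $A$-module $A\otimes_K A$. For any such $A$ the following hold: (1) The commutative $k$-algebra $H$ has a unique Hopf algebra structure over $k$ whose comultiplication and counit are induced by the maps $a\otimes b\mapsto a\otimes 1\otimes b$ and $a\otimes b\mapsto ab$ on $A\otimes_K A$, and whose antipode is induced by $a\otimes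 b\mapsto b\otimes a$. More precisely, the comultiplication satisfies $\varphi(\Delta_H(h))=(a\otimes b\mapsto a\otimes 1\otimes b)(h)$ for all $h\in H$, where $\varphi:H\otimes_k H\to A\otimes_K A\otimes_K A$ is given by $(a\otimes a')\otimes(b'\otimes b)\mapsto a\otimes a'b'\otimes b$. (2) With this Hopf algebra structure, the set of intermediate AS $D$-module algebras $K\subset M\subset L$ and the set of Hopf ideals $I$ of $H$ correspond bijectively by the mutually inverse maps $$M\longmapsto H\cap\operatorname{Ker}(L\otimes_K L\to L\otimes_M L),\qquad I\longmapsto\{x\in L : x\otimes 1-1\otimes x\in I\cdot(L\otimes_K L)\},$$ where $H\subset A\otimes_K A$ is mapped to $L\otimes_K L$ in the natural way. -/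

import Mathlib

open scoped TensorProduct

noncomputable section

/-! ### Coalgebra notions: pointedness, irreducible component, Birkhoff-Witt type -/

section Coalgebra

variable (R : Type*) {D : Type*} [Field R]

/-- A subspace `C` of a coalgebra `D` with `Δ(C) ⊆ C ⊗ C`. -/
def IsSubcoalgebra [AddCommGroup D] [Module R D] [Coalgebra R D] (C : Submodule R D) : Prop :=
  ∀ x ∈ C, Coalgebra.comul (R := R) x ∈ LinearMap.range (TensorProduct.map C.subtype C.subtype)

/-- A nonzero subcoalgebra without nonzero proper subcoalgebras. -/
def IsSimpleSubcoalgebra [AddCommGroup D] [Module R D] [Coalgebra R D]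
    (C : Submodule R D) : Prop :=
  IsSubcoalgebra R C ∧ C ≠ ⊥ ∧
    ∀ C' : Submodule R D, IsSubcoalgebra R C' → C' ≤ C → C' = ⊥ ∨ C' = C

variable (D) in
/-- A coalgebra is pointed if all its simple subcoalgebras are one-dimensional. -/
def IsPointedCoalgebra [AddCommGroup D] [Module R D] [Coalgebra R D] : Prop :=
  ∀ C : Submodule R D, IsSimpleSubcoalgebra R C → Module.finrank R C = 1

/-- A subcoalgebra is irreducible if any two nonzero subcoalgebras of it have nonzero
intersection. -/
def IsIrreducibleSubcoalgebra [AddCommGroup D] [Module R D] [Coalgebra R D]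
    (C : Submodule R D) : Prop :=
  IsSubcoalgebra R C ∧ ∀ C₁ C₂ : Submodule R D, IsSubcoalgebra R C₁ → IsSubcoalgebra R C₂ →
    C₁ ≤ C → C₂ ≤ C → C₁ ≠ ⊥ → C₂ ≠ ⊥ → C₁ ⊓ C₂ ≠ ⊥

variable (D) in
/-- The irreducible component `D¹` containing `1`: the join of all irreducible subcoalgebras
that contain `1`. -/
def irreducibleComponentOne [Ring D] [Bialgebra R D] : Submodule R D :=
  sSup {C | IsIrreducibleSubcoalgebra R C ∧ (1 : D) ∈ C}

/-- `Δ(x) = x ⊗ 1 + 1 ⊗ x`. -/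
def IsPrimitiveElement [Ring D] [Bialgebra R D] (x : D) : Prop :=
  Coalgebra.comul (R := R) x = x ⊗ₜ[R] 1 + 1 ⊗ₜ[R] x

/-- An infinite divided power sequence `1 = d₀, d₁, d₂, …`. -/
def IsDividedPowerSequence [Ring D] [Bialgebra R D] (d : ℕ → D) : Prop :=
  d 0 = 1 ∧ ∀ n, Coalgebra.comul (R := R) (d n) =
    ∑ i ∈ Finset.range (n + 1), d i ⊗ₜ[R] d (n - i)

variable (D) in
/-- `D¹` is of Birkhoff-Witt type: every primitive element `x` of `D` lies, as its term of
index `1`, in an infinite divided power sequence in `D¹`. -/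
def IsBirkhoffWittType [Ring D] [Bialgebra R D] : Prop :=
  ∀ x : D, IsPrimitiveElement R x →
    ∃ d : ℕ → D, IsDividedPowerSequence R d ∧ (∀ n, d n ∈ irreducibleComponentOne R D) ∧ d 1 = x

end Coalgebra

/-! ### Module algebras -/

/-- A structure of (commutative) `D`-module algebra on the `R`-algebra `A`: a `D`-module structure
`act` with `d 1 = ε(d) 1` and `d (a b) = ∑ (d₁ a) (d₂ b)`. -/
class ModuleAlgebra (R D A : Type*) [CommRing R] [Ring D] [Bialgebra R D]
    [CommRing A] [Algebra R A] where
  act : D →ₐ[R] Module.End R A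
  act_one : ∀ d, act d 1 = algebraMap R A (Coalgebra.counit d)
  act_mul : ∀ d a b, act d (a * b) = LinearMap.mul' R A
    (TensorProduct.map (act.toLinearMap.flip a) (act.toLinearMap.flip b) (Coalgebra.comul d))

/-- The algebra map `K → B` between `D`-module algebras is `D`-linear. -/
class IsEquivariant (R D K B : Type*) [CommRing R] [Ring D] [Bialgebra R D]
    [CommRing K] [Algebra R K] [ModuleAlgebra R D K]
    [CommRing B] [Algebra R B] [ModuleAlgebra R D B] [Algebra K B] : Prop where
  act_algebraMap : ∀ (d : D) (x : K),
    ModuleAlgebra.act (R := R) d (algebraMap K B x) =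
      algebraMap K B (ModuleAlgebra.act (R := R) d x)

namespace ModuleAlgebra

open Coalgebra WithConv

section Basic

variable (R : Type*) {D A : Type*} [CommRing R] [Ring D] [Bialgebra R D]
  [CommRing A] [Algebra R A] [ModuleAlgebra R D A]

lemma act_mul_repr (d : D) (a b : A) {ι : Type*} (repr : Coalgebra.Repr R d ι) :
    act (R := R) d (a * b) = ∑ i ∈ repr.index,
      act (R := R) (repr.left i) a * act (R := R) (repr.right i) b := by
  rw [act_mul, ← repr.eq]
  simp

end Basic

section Tensor

variable (R D K B C : Type*) [CommRing R] [Ring D] [Bialgebra R D] [IsCocomm R D]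
  [CommRing K] [Algebra R K] [ModuleAlgebra R D K]
  [CommRing B] [Algebra R B] [ModuleAlgebra R D B] [Algebra K B] [IsScalarTower R K B]
  [IsEquivariant R D K B]
  [CommRing C] [Algebra R C] [ModuleAlgebra R D C] [Algebra K C] [IsScalarTower R K C]
  [IsEquivariant R D K C]

/-- For an algebra map `j : B → T` from a `D`-module algebra, the algebra map
`b ↦ [d ↦ j (d b)]` to the convolution algebra of linear maps `D → T`. -/
def convHom {B T : Type*} [CommRing B] [Algebra R B] [ModuleAlgebra R D B]
    [CommRing T] [Algebra R T] (j : B →ₐ[R] T) : B →+* WithConv (D →ₗ[R] T) where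
  toFun b := toConv (j.toLinearMap ∘ₗ (act (R := R) (D := D) (A := B)).toLinearMap.flip b)
  map_one' := by
    apply WithConv.ext
    ext d
    simp [act_one, LinearMap.convOne_def]
  map_mul' a b := by
    apply WithConv.ext
    ext d
    simp only [LinearMap.convMul_def]
    simp [act_mul_repr R d a b (ℛ R d), ← (ℛ R d).eq]
  map_zero' := by
    apply WithConv.ext
    ext d
    simp
  map_add' a b := by
    apply WithConv.ext
    ext d
    simp

/-- Ring maps `f : B → E`, `g : C → E` that agree on `K` induce `b ⊗ c ↦ f b * g c`. -/
def tensorLift {K B C E : Type*} [CommRing K] [CommRing B] [CommRing C] [CommRing E] [Algebra K B]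
    [Algebra K C] (f : B →+* E) (g : C →+* E)
    (h : ∀ x, f (algebraMap K B x) = g (algebraMap K C x)) : B ⊗[K] C →+* E :=
  letI : Algebra K E := (f.comp (algebraMap K B)).toAlgebra
  let f' : B →ₐ[K] E := { f with commutes' := fun _ => rfl }
  let g' : C →ₐ[K] E := { g with commutes' := fun x => (h x).symm }
  (Algebra.TensorProduct.lift f' g' fun _ _ => Commute.all _ _).toRingHom

lemma tensorLift_tmul {K B C E : Type*} [CommRing K] [CommRing B] [CommRing C] [CommRing E]
    [Algebra K B] [Algebra K C] (f : B →+* E) (g : C →+* E)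
    (h : ∀ x, f (algebraMap K B x) = g (algebraMap K C x)) (b : B) (c : C) :
    tensorLift f g h (b ⊗ₜ c) = f b * g c := by
  simp [tensorLift]

/-- The algebra map `b ⊗ c ↦ [d ↦ ∑ d₁ b ⊗ d₂ c]`. -/
def tensorConvHom : B ⊗[K] C →+* WithConv (D →ₗ[R] B ⊗[K] C) :=
  tensorLift (convHom R D (Algebra.TensorProduct.includeLeft : B →ₐ[R] B ⊗[K] C))
    (convHom R D ((Algebra.TensorProduct.includeRight : C →ₐ[K] B ⊗[K] C).restrictScalars R))
    fun x => by
      apply WithConv.ext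
      ext d
      have : algebraMap K B (act (R := R) d x) ⊗ₜ[K] (1 : C) =
          (1 : B) ⊗ₜ[K] algebraMap K C (act (R := R) d x) :=
        ((Algebra.TensorProduct.includeRight : C →ₐ[K] B ⊗[K] C).commutes _).symm
      simpa [convHom, IsEquivariant.act_algebraMap] using this

lemma tensorConvHom_tmul (b : B) (c : C) (d : D) {ι : Type*} (repr : Coalgebra.Repr R d ι) :
    (tensorConvHom R D K B C (b ⊗ₜ c)).ofConv d = ∑ i ∈ repr.index,
      act (R := R) (repr.left i) b ⊗ₜ[K] act (R := R) (repr.right i) c := by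
  rw [tensorConvHom, tensorLift_tmul, LinearMap.convMul_def]
  simp [← repr.eq, convHom]

lemma tensorConvHom_smul (r : R) (t : B ⊗[K] C) :
    tensorConvHom R D K B C (r • t) = r • tensorConvHom R D K B C t := by
  induction t using TensorProduct.induction_on with
  | zero => simp
  | add x y hx hy => rw [smul_add, map_add, hx, hy, map_add, smul_add]
  | tmul b c =>
    apply WithConv.ext
    ext d
    rw [TensorProduct.smul_tmul', tensorConvHom_tmul R D K B C _ _ _ (ℛ R d),
      WithConv.ofConv_smul, LinearMap.smul_apply, tensorConvHom_tmul R D K B C _ _ _ (ℛ R d),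
      Finset.smul_sum]
    simp [TensorProduct.smul_tmul']

/-- The action `d (b ⊗ c) = ∑ d₁ b ⊗ d₂ c` as an `R`-linear map. -/
def tensorAct : D →ₗ[R] Module.End R (B ⊗[K] C) :=
  LinearMap.flip
    { toFun := fun t => (tensorConvHom R D K B C t).ofConv
      map_add' := fun x y => by rw [map_add]; rfl
      map_smul' := fun r t => by rw [tensorConvHom_smul]; rfl }

lemma tensorAct_eq (d : D) (t : B ⊗[K] C) :
    tensorAct R D K B C d t = (tensorConvHom R D K B C t).ofConv d := rfl

lemma tensorAct_tmul (b : B) (c : C) (d : D) {ι : Type*} (repr : Coalgebra.Repr R d ι) :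
    tensorAct R D K B C d (b ⊗ₜ c) = ∑ i ∈ repr.index,
      act (R := R) (repr.left i) b ⊗ₜ[K] act (R := R) (repr.right i) c :=
  tensorConvHom_tmul R D K B C b c d repr

/-- `x ⊗ y ↦ x b ⊗ y c`. -/
def tensorEval (b : B) (c : C) : D ⊗[R] D →ₗ[R] B ⊗[K] C :=
  TensorProduct.lift
    (LinearMap.mk₂ R (fun x y => act (R := R) x b ⊗ₜ[K] act (R := R) y c)
      (fun _ _ _ => by simp [TensorProduct.add_tmul])
      (fun _ _ _ => by simp [TensorProduct.smul_tmul'])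
      (fun _ _ _ => by simp [TensorProduct.tmul_add])
      (fun _ _ _ => by simp))

set_option linter.unusedSectionVars false in
lemma tensorEval_tmul (b : B) (c : C) (x y : D) :
    tensorEval R D K B C b c (x ⊗ₜ y) = act (R := R) x b ⊗ₜ[K] act (R := R) y c := rfl

lemma tensorAct_tmul' (b : B) (c : C) (d : D) :
    tensorAct R D K B C d (b ⊗ₜ c) = tensorEval R D K B C b c (comul d) := by
  rw [tensorAct_tmul R D K B C b c d (ℛ R d), ← (ℛ R d).eq]
  simp [tensorEval_tmul]

/-- The `D`-module algebra structure on `B ⊗_K C`. -/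
instance tensorProduct : ModuleAlgebra R D (B ⊗[K] C) where
  act := AlgHom.ofLinearMap (tensorAct R D K B C)
    (by
      apply LinearMap.ext
      intro t
      induction t using TensorProduct.induction_on with
      | zero => simp
      | add x y hx hy => rw [map_add, hx, hy, map_add]
      | tmul b c =>
        rw [tensorAct_tmul', Bialgebra.comul_one, Algebra.TensorProduct.one_def]
        simp [tensorEval_tmul])
    (fun d e => by
      apply LinearMap.ext
      intro t
      induction t using TensorProduct.induction_on with
      | zero => simp
      | add x y hx hy => rw [map_add, hx, hy, map_add]
      | tmul b c =>
        rw [tensorAct_tmul', Bialgebra.comul_mul, Module.End.mul_apply,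
          tensorAct_tmul R D K B C b c e (ℛ R e), map_sum]
        simp_rw [tensorAct_tmul']
        rw [← (ℛ R e).eq, ← (ℛ R d).eq]
        simp [tensorEval_tmul, Finset.sum_mul, Finset.mul_sum])
  act_one d := by
    change (tensorConvHom R D K B C 1).ofConv d = _
    rw [map_one, LinearMap.convOne_def]
    rfl
  act_mul d a b := by
    change (tensorConvHom R D K B C (a * b)).ofConv d = _
    rw [map_mul, LinearMap.convMul_def]
    rfl

instance : IsEquivariant R D K (B ⊗[K] C) where
  act_algebraMap d x := by
    change (tensorConvHom R D K B C (algebraMap K B x ⊗ₜ 1)).ofConv d =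
      algebraMap K B (act (R := R) d x) ⊗ₜ 1
    rw [tensorConvHom, tensorLift_tmul, map_one, mul_one]
    simp [convHom, IsEquivariant.act_algebraMap]

end Tensor

/-! ### Constants, simple and artinian simple module algebras -/

section Constants

variable (R D A : Type*) [CommRing R] [Ring D] [Bialgebra R D]
  [CommRing A] [Algebra R A] [ModuleAlgebra R D A]

/-- The constants `A^D = {a | d a = ε(d) a for all d ∈ D}`. -/
def constants : Subalgebra R A where
  carrier := {a | ∀ d : D, act (R := R) d a = counit (R := R) d • a}
  mul_mem' {a b} ha hb d := by
    rw [act_mul_repr R d a b (ℛ R d)]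
    simp_rw [ha _, hb _, smul_mul_assoc, mul_smul_comm, smul_smul]
    rw [← Finset.sum_smul]
    congr 1
    have := congrArg (counit (R := R)) (sum_counit_smul (ℛ R d))
    simpa using this
  add_mem' ha hb d := by rw [map_add, ha, hb, smul_add]
  algebraMap_mem' r d := by
    rw [Algebra.algebraMap_eq_smul_one, map_smul, act_one, Algebra.algebraMap_eq_smul_one,
      smul_comm]

/-- Simple module algebras: nonzero, without nontrivial `D`-stable ideals. -/
def IsSimple : Prop :=
  Nontrivial A ∧ ∀ I : Ideal A, (∀ (d : D), ∀ a ∈ I, act (R := R) d a ∈ I) → I = ⊥ ∨ I = ⊤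

/-- Artinian simple (AS) module algebras. -/
def IsAS : Prop := IsArtinianRing A ∧ IsSimple R D A

end Constants

end ModuleAlgebra

/-! ### Intermediate module algebras -/

section PicardVessiot

open ModuleAlgebra Coalgebra

variable (R D K L : Type*) [CommRing R] [Ring D] [Bialgebra R D]
  [CommRing K] [Algebra R K] [ModuleAlgebra R D K]
  [CommRing L] [Algebra R L] [ModuleAlgebra R D L] [Algebra K L] [IsScalarTower R K L]

/-- `D`-module subalgebras of `L` containing (the image of) `K`. -/
structure IntermediateModuleAlgebra extends Subalgebra K L where
  act_mem' : ∀ (d : D) (a : L), a ∈ carrier → act (R := R) d a ∈ carrier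

namespace IntermediateModuleAlgebra

variable {R D K L}

/-- The induced `D`-module algebra structure. -/
instance (A : IntermediateModuleAlgebra R D K L) : ModuleAlgebra R D A.toSubalgebra where
  act := AlgHom.ofLinearMap
    (LinearMap.mk₂ R
      (fun (d : D) (a : A.toSubalgebra) =>
        (⟨act (R := R) d (a : L), A.act_mem' d a a.2⟩ : A.toSubalgebra))
      (fun _ _ _ => by ext; simp) (fun _ _ _ => by ext; simp)
      (fun _ _ _ => by ext; simp) (fun _ _ _ => by ext; simp))
    (by ext; simp)
    (fun _ _ => by ext; simp)
  act_one d := by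
    ext
    exact act_one (R := R) (A := L) d
  act_mul d a b := by
    ext
    rw [← (ℛ R d).eq]
    simpa using act_mul_repr R d (a : L) (b : L) (ℛ R d)

instance [IsEquivariant R D K L] (A : IntermediateModuleAlgebra R D K L) :
    IsEquivariant R D K A.toSubalgebra where
  act_algebraMap d x := by
    ext
    exact IsEquivariant.act_algebraMap (R := R) (B := L) d x

end IntermediateModuleAlgebra

end PicardVessiot

/-! ### The Hopf algebra of `D`-invariants of `B ⊗_K B` -/

section HopfData

/-- A Hopf algebra structure on a commutative algebra `H` over `k`, given by algebra maps. -/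
structure HopfData (k H : Type*) [CommRing k] [CommRing H] [Algebra k H] where
  comul : H →ₐ[k] H ⊗[k] H
  counit : H →ₐ[k] k
  antipode : H →ₐ[k] H
  coassoc : (Algebra.TensorProduct.assoc k k k H H H).toAlgHom.comp
      ((Algebra.TensorProduct.map comul (AlgHom.id k H)).comp comul) =
    (Algebra.TensorProduct.map (AlgHom.id k H) comul).comp comul
  counit_comul : (Algebra.TensorProduct.map counit (AlgHom.id k H)).comp comul =
    (Algebra.TensorProduct.lid k H).symm
  comul_counit : (Algebra.TensorProduct.map (AlgHom.id k H) counit).comp comul =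
    (Algebra.TensorProduct.rid k k H).symm
  antipode_mul_id : (Algebra.TensorProduct.lift antipode (AlgHom.id k H)
      fun _ _ => Commute.all _ _).comp comul = (Algebra.ofId k H).comp counit
  id_mul_antipode : (Algebra.TensorProduct.lift (AlgHom.id k H) antipode
      fun _ _ => Commute.all _ _).comp comul = (Algebra.ofId k H).comp counit

/-- The corresponding Hopf algebra; its underlying algebra is the given one. -/
@[reducible]
def HopfData.hopfAlgebra {k H : Type*} [CommRing k] [CommRing H] [Algebra k H]
    (S : HopfData k H) : HopfAlgebra k H :=
  letI : Bialgebra k H :=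
    Bialgebra.ofAlgHom S.comul S.counit S.coassoc S.counit_comul S.comul_counit
  HopfAlgebra.ofAlgHom S.antipode S.antipode_mul_id S.id_mul_antipode

end HopfData

section Invariants

open ModuleAlgebra Coalgebra

variable (R D K B : Type*) [CommRing R] [Ring D] [Bialgebra R D] [IsCocomm R D]
  [CommRing K] [Algebra R K] [ModuleAlgebra R D K]
  [CommRing B] [Algebra R B] [ModuleAlgebra R D B] [Algebra K B] [IsScalarTower R K B]
  [IsEquivariant R D K B]

/-- `(B ⊗_K B)^D`, as a subalgebra of `B ⊗_K B` over `k = K^D`. -/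
def tensorConstants : Subalgebra (constants R D K) (B ⊗[K] B) where
  __ := (constants R D (B ⊗[K] B)).toSubsemiring
  algebraMap_mem' c d := by
    change act (R := R) d (algebraMap K (B ⊗[K] B) (c : K)) =
      counit (R := R) d • algebraMap K (B ⊗[K] B) (c : K)
    rw [IsEquivariant.act_algebraMap, c.2 d, Algebra.smul_def, map_mul,
      ← IsScalarTower.algebraMap_apply, Algebra.smul_def]

/-- The `k`-algebra `H = (B ⊗_K B)^D`. -/
def PVAlgebra : Type _ := tensorConstants R D K B

instance : CommRing (PVAlgebra R D K B) := inferInstanceAs (CommRing (tensorConstants R D K B))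

instance : Algebra (constants R D K) (PVAlgebra R D K B) :=
  inferInstanceAs (Algebra (constants R D K) (tensorConstants R D K B))

/-- The inclusion `H ⊆ B ⊗_K B`. -/
def PVAlgebra.incl : PVAlgebra R D K B →ₐ[constants R D K] B ⊗[K] B :=
  (tensorConstants R D K B).val

/-- The coproduct `a ⊗ b ↦ a ⊗ 1 ⊗ b` of the coring `B ⊗_K B`, with target
`(B ⊗_K B) ⊗_B (B ⊗_K B) = B ⊗_K B ⊗_K B`. -/
def coringComul : B ⊗[K] B →ₐ[K] B ⊗[K] (B ⊗[K] B) :=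
  Algebra.TensorProduct.map (AlgHom.id K B) Algebra.TensorProduct.includeRight

/-- The map `(a ⊗ a') ⊗ (b' ⊗ b) ↦ a ⊗ a' b' ⊗ b` from `H ⊗_k H` to `B ⊗_K B ⊗_K B`. -/
def pvMul₂ : PVAlgebra R D K B ⊗[constants R D K] PVAlgebra R D K B →ₐ[constants R D K]
    B ⊗[K] (B ⊗[K] B) :=
  let f : B ⊗[K] B →ₐ[K] B ⊗[K] (B ⊗[K] B) :=
    Algebra.TensorProduct.map (AlgHom.id K B) Algebra.TensorProduct.includeLeft
  let g : B ⊗[K] B →ₐ[K] B ⊗[K] (B ⊗[K] B) := Algebra.TensorProduct.includeRight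
  Algebra.TensorProduct.lift ((f.restrictScalars (constants R D K)).comp (PVAlgebra.incl R D K B))
    ((g.restrictScalars (constants R D K)).comp (PVAlgebra.incl R D K B))
    fun _ _ => Commute.all _ _

/-- A Hopf algebra structure on the `k`-algebra `H = (B ⊗_K B)^D` whose comultiplication and
counit are induced by the coring structure `a ⊗ b ↦ a ⊗ 1 ⊗ b`, `a ⊗ b ↦ a b` of `B ⊗_K B`
and whose antipode is induced by the twist `a ⊗ b ↦ b ⊗ a`. -/
structure PVHopfStructure extends HopfData (constants R D K) (PVAlgebra R D K B) where
  comul_spec : ∀ h, pvMul₂ R D K B (comul h) = coringComul K B (PVAlgebra.incl R D K B h)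
  counit_spec : ∀ h, algebraMap K B (counit h : K) =
    Algebra.TensorProduct.lmul' K (PVAlgebra.incl R D K B h)
  antipode_spec : ∀ h, PVAlgebra.incl R D K B (antipode h) =
    Algebra.TensorProduct.comm K B B (PVAlgebra.incl R D K B h)

end Invariants

/-! ### Picard-Vessiot extensions -/

section PicardVessiot

open ModuleAlgebra Coalgebra

variable {R D K L : Type*} [CommRing R] [Ring D] [Bialgebra R D] [IsCocomm R D]
  [CommRing K] [Algebra R K] [ModuleAlgebra R D K]
  [CommRing L] [Algebra R L] [ModuleAlgebra R D L] [Algebra K L] [IsScalarTower R K L]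
  [IsEquivariant R D K L] (A : IntermediateModuleAlgebra R D K L)

/-- `L/K` is a Picard-Vessiot extension of artinian simple `D`-module algebras with principal
algebra `A`: `K^D = L^D`, the total quotient ring of `A` is `L`, and `H = (A ⊗_K A)^D` generates
the left `A`-module `A ⊗_K A`. -/
structure IsPicardVessiot : Prop where
  base_isAS : IsAS R D K
  top_isAS : IsAS R D L
  constants_eq : (constants R D K).map (IsScalarTower.toAlgHom R K L) = constants R D L
  isFractionRing : IsFractionRing A.toSubalgebra L
  span_eq_top : Submodule.span A.toSubalgebra
    (tensorConstants R D K A.toSubalgebra : Set (A.toSubalgebra ⊗[K] A.toSubalgebra)) = ⊤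

/-- The composite `H ⊆ A ⊗_K A → L ⊗_K L`. -/
def pvToTensor : PVAlgebra R D K A.toSubalgebra →+* L ⊗[K] L :=
  (Algebra.TensorProduct.map A.val A.val).toRingHom.comp
    (PVAlgebra.incl R D K A.toSubalgebra).toRingHom

/-- `H ∩ Ker(L ⊗_K L → L ⊗_M L)`. -/
def pvIdeal (M : IntermediateModuleAlgebra R D K L) : Ideal (PVAlgebra R D K A.toSubalgebra) :=
  (RingHom.ker (Algebra.TensorProduct.mapOfCompatibleSMul M.toSubalgebra K K L L)).comap
    (pvToTensor A)

/-- `{x ∈ L | x ⊗ 1 - 1 ⊗ x ∈ I · (L ⊗_K L)}`. -/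
def pvFixed (I : Ideal (PVAlgebra R D K A.toSubalgebra)) : Set L :=
  {x | x ⊗ₜ[K] (1 : L) - (1 : L) ⊗ₜ[K] x ∈ I.map (pvToTensor A)}

end PicardVessiot

end

/-!
Write `k` for the constants of `K` and `H` for those of `A ⊗_K A`.

*Semisimplicity.* The algebra `D` is generated by its group-like elements and the terms of divided
power sequences. The dual algebra of `D` acts on every element through an artinian quotient, which
decomposes `D` into pieces supported at single group-like elements, as `D` is pointed; translation
reduces to the piece at `1`, which is spanned by ordered monomials in divided power sequences that
lift a basis of the primitive elements (`DividedPower.annihilated_pow_le_span`). Group-like elements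
act by endomorphisms, and a divided power sequence acts as a homomorphism to power series, so the
nilradical of a module algebra is stable. Hence artinian simple module algebras are reduced
(`ModuleAlgebra.IsSimple.isReduced`), thus semisimple, and all modules over them are projective.

*Constants.* Over a simple module algebra `B`, constants that are independent over the constants of
`B` remain independent over `B`. Applied to a `B`-algebra that is generated over `B` by a space of
constants, also modulo a stable ideal, this shows that the space contains all constants and that
every stable ideal is generated by constants (`injective_liftBaseChange`,
`exists_eq_of_mem_constants`, `mem_span_of_stable`). In particular `L ⊗_k H = L ⊗_K A`. It follows
that `A` is simple (`isSimple_of_span_eq_top`): for a nonzero stable ideal `I` of `A`, the stable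
ideal `L ⊗ I` contains an element of `H` that is not killed by the counit.

*The Hopf algebra.* The natural maps from `H ⊗ H` and `H ⊗ H ⊗ H` to the tensor powers of `A` over
`K` are injective, and the image of `H ⊗ H` is the space of all constants. So the structure maps of
the coring `A ⊗_K A` and the twist restrict to `H` in a unique way, and the axioms of a Hopf algebra
are identities between maps of tensor powers of `A` (`nonempty_pvHopfStructure`,
`subsingleton_pvHopfStructure`).

*From `M` to ideals and back.* The kernel of `L ⊗_K L → L ⊗_M L` is stable, hence is generated by
its contraction `I` to `H` (`ker_mapOfCompatibleSMul_le`). With `H ⧸ I` a space of constants of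
`L ⊗_M L`, the square of `H ⧸ I` embeds into `L ⊗_M L ⊗_M L`, so `I` is a Hopf ideal
(`isHopfIdeal_pvIdeal`). As `M` is semisimple, `M → L` splits, so `x ⊗ 1 - 1 ⊗ x` lies in the kernel
only if `x ∈ M` (`sub_mem_ker_mapOfCompatibleSMul`).

*From `I` to algebras and back.* Let `I` be a Hopf ideal, `𝔞 = I · (L ⊗_K L)` and `M` the algebra of
all `x` with `x ⊗ 1 - 1 ⊗ x ∈ 𝔞`. It contains the unique quasi-inverses of its elements, so it is
artinian simple (`isAS_fixedAlgebra`). The kernel of `L ⊗_K L → L ⊗_M L` is contained in `𝔞` by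
definition of `M`. For the converse, `𝔞` is contained in the ideal of the diagonal, symmetric and a
coideal, so the dual of `(L ⊗_K L) ⧸ 𝔞` is a ring of endomorphisms of `L` that contains `L`. Since
`L` is a semisimple ring and `𝔞` is symmetric, `L` is a semisimple module over this ring, with
endomorphism ring contained in `M`, and the Jacobson density theorem shows that `𝔞` vanishes in
`L ⊗_M L` (`Ideal.IsEquivalenceRelation.le_ker_mapOfCompatibleSMul`). Finally, the contraction of
`𝔞` to `H` is `I`: denominators can be removed because `A` is simple, and `L ⊗_K A = L ⊗_k H` is
faithfully flat over `H` (`comap_map_pvToTensor`).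
-/

set_option linter.unusedSectionVars false

open scoped TensorProduct

noncomputable section

/-! ### The dual algebra of a pointed cocommutative coalgebra -/

namespace DualAlgebra
open Coalgebra WithConv TensorProduct

section Slices

variable {R M N : Type*} [Field R] [AddCommGroup M] [Module R M] [AddCommGroup N] [Module R N]

/-- The slice `m ⊗ n ↦ h n • m`. -/
def sliceRight (h : N →ₗ[R] R) : M ⊗[R] N →ₗ[R] M :=
  (TensorProduct.rid R M).toLinearMap ∘ₗ h.lTensor M

@[simp] lemma sliceRight_tmul (h : N →ₗ[R] R) (m : M) (n : N) :
    sliceRight h (m ⊗ₜ[R] n) = h n • m := by simp [sliceRight]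

/-- The slice `m ⊗ n ↦ h m • n`. -/
def sliceLeft (h : M →ₗ[R] R) : M ⊗[R] N →ₗ[R] N :=
  (TensorProduct.lid R N).toLinearMap ∘ₗ h.rTensor N

@[simp] lemma sliceLeft_tmul (h : M →ₗ[R] R) (m : M) (n : N) :
    sliceLeft h (m ⊗ₜ[R] n) = h m • n := by simp [sliceLeft]

lemma sliceLeft_eq_sliceRight_comm (h : M →ₗ[R] R) (t : M ⊗[R] N) :
    sliceLeft h t = sliceRight h (TensorProduct.comm R M N t) := by
  induction t using TensorProduct.induction_on with
  | zero => simp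
  | add x y hx hy => simp only [map_add, hx, hy]
  | tmul m n => simp

/-- Slices separate tensors over a field. -/
lemma eq_zero_of_sliceRight {t : M ⊗[R] N} (ht : ∀ h : N →ₗ[R] R, sliceRight h t = 0) : t = 0 := by
  classical
  let b := Module.Basis.ofVectorSpace R N
  apply (TensorProduct.equivFinsuppOfBasisRight (M := M) b).injective
  rw [map_zero]
  ext i
  have key : ∀ s : M ⊗[R] N,
      TensorProduct.equivFinsuppOfBasisRight b s i = sliceRight (b.coord i) s := by
    intro s
    induction s using TensorProduct.induction_on with
    | zero => simp
    | add x y hx hy => simp only [map_add, Finsupp.add_apply, hx, hy]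
    | tmul m n => simp
  rw [key, ht, Finsupp.zero_apply]

lemma eq_zero_of_sliceLeft {t : M ⊗[R] N} (ht : ∀ h : M →ₗ[R] R, sliceLeft h t = 0) : t = 0 := by
  apply (TensorProduct.comm R M N).injective
  rw [map_zero]
  exact eq_zero_of_sliceRight fun h => by rw [← sliceLeft_eq_sliceRight_comm, ht]

lemma sliceRight_map {M' N' : Type*} [AddCommGroup M'] [Module R M'] [AddCommGroup N']
    [Module R N'] (u : M →ₗ[R] M') (v : N →ₗ[R] N') (h : N' →ₗ[R] R) (t : M ⊗[R] N) :
    sliceRight h (TensorProduct.map u v t) = u (sliceRight (h ∘ₗ v) t) := by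
  induction t using TensorProduct.induction_on with
  | zero => simp
  | add x y hx hy => simp only [map_add, hx, hy]
  | tmul m n => simp

lemma sliceLeft_map {M' N' : Type*} [AddCommGroup M'] [Module R M'] [AddCommGroup N']
    [Module R N'] (u : M →ₗ[R] M') (v : N →ₗ[R] N') (h : M' →ₗ[R] R) (t : M ⊗[R] N) :
    sliceLeft h (TensorProduct.map u v t) = v (sliceLeft (h ∘ₗ u) t) := by
  induction t using TensorProduct.induction_on with
  | zero => simp
  | add x y hx hy => simp only [map_add, hx, hy]
  | tmul m n => simp

/-- A tensor all of whose slices along functionals vanishing on `W` are zero is fixed by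
`q ⊗ q`, for any linear projection `q` onto `W`. -/
lemma map_eq_self_of_slices {W : Submodule R M} {t : M ⊗[R] M}
    (hr : ∀ h : M →ₗ[R] R, (∀ w ∈ W, h w = 0) → sliceRight h t = 0)
    (hl : ∀ h : M →ₗ[R] R, (∀ w ∈ W, h w = 0) → sliceLeft h t = 0)
    (q : M →ₗ[R] M) (hq : ∀ w ∈ W, q w = w) : TensorProduct.map q q t = t := by
  have h1 : TensorProduct.map LinearMap.id (LinearMap.id - q) t = 0 := by
    apply eq_zero_of_sliceRight
    intro h
    rw [sliceRight_map, hr, map_zero]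
    intro w hw
    simp [hq w hw]
  have h2 : TensorProduct.map (LinearMap.id - q) q t = 0 := by
    apply eq_zero_of_sliceLeft
    intro h
    rw [sliceLeft_map, hl, map_zero]
    intro w hw
    simp [hq w hw]
  have h1' : TensorProduct.map LinearMap.id q t = t := by
    have : TensorProduct.map LinearMap.id (LinearMap.id - q) t =
        TensorProduct.map LinearMap.id LinearMap.id t - TensorProduct.map LinearMap.id q t := by
      rw [eq_sub_iff_add_eq, ← LinearMap.add_apply, ← TensorProduct.map_add_right, sub_add_cancel]
    rw [this, TensorProduct.map_id, LinearMap.id_apply, sub_eq_zero] at h1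
    exact h1.symm
  have h2' : TensorProduct.map (LinearMap.id - q) q t =
      TensorProduct.map LinearMap.id q t - TensorProduct.map q q t := by
    rw [eq_sub_iff_add_eq, ← LinearMap.add_apply, ← TensorProduct.map_add_left, sub_add_cancel]
  rw [h2', h1', sub_eq_zero] at h2
  exact h2.symm

lemma mem_range_map_subtype_of_slices {W : Submodule R M} {t : M ⊗[R] M}
    (hr : ∀ h : M →ₗ[R] R, (∀ w ∈ W, h w = 0) → sliceRight h t = 0)
    (hl : ∀ h : M →ₗ[R] R, (∀ w ∈ W, h w = 0) → sliceLeft h t = 0) :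
    t ∈ LinearMap.range (TensorProduct.map W.subtype W.subtype) := by
  obtain ⟨p, hp⟩ := LinearMap.exists_leftInverse_of_injective W.subtype
    (LinearMap.ker_eq_bot.2 W.injective_subtype)
  refine ⟨TensorProduct.map p p t, ?_⟩
  rw [← LinearMap.comp_apply, ← TensorProduct.map_comp]
  refine map_eq_self_of_slices hr hl _ fun w hw => ?_
  have := LinearMap.congr_fun hp ⟨w, hw⟩
  simpa using congrArg Subtype.val this

lemma exists_functional_of_notMem {W : Submodule R M} {x : M} (hx : x ∉ W) :
    ∃ h : M →ₗ[R] R, (∀ w ∈ W, h w = 0) ∧ h x ≠ 0 := by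
  by_contra! H
  exact hx ((Subspace.forall_mem_dualAnnihilator_apply_eq_zero_iff W x).1 fun φ hφ =>
    H φ ((Submodule.mem_dualAnnihilator φ).1 hφ))

end Slices

variable {R D : Type*} [Field R] [AddCommGroup D] [Module R D]

variable (R) in
lemma eq_of_forall_dual {x y : D} (h : ∀ f : WithConv (D →ₗ[R] R), f x = f y) : x = y := by
  rw [← sub_eq_zero, ← Module.forall_dual_apply_eq_zero_iff R]
  intro f
  have := h (toConv f)
  simpa [sub_eq_zero] using this

variable [Coalgebra R D]

/-- The action `x ↦ ∑ f(x₂) x₁` of the dual algebra on the coalgebra. -/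
def hit (f : WithConv (D →ₗ[R] R)) : D →ₗ[R] D := sliceRight f.ofConv ∘ₗ comul

lemma hit_apply (f : WithConv (D →ₗ[R] R)) (x : D) :
    hit f x = sliceRight f.ofConv (comul (R := R) x) := rfl

lemma apply_hit (g f : WithConv (D →ₗ[R] R)) (x : D) : g (hit f x) = (g * f) x := by
  rw [LinearMap.convMul_apply, hit_apply]
  induction comul (R := R) x using TensorProduct.induction_on with
  | zero => simp
  | add x y hx hy => simp only [map_add, hx, hy]
  | tmul m n => simp [mul_comm]

lemma hit_mul (f g : WithConv (D →ₗ[R] R)) (x : D) : hit (f * g) x = hit f (hit g x) :=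
  eq_of_forall_dual R fun h => by simp only [apply_hit, mul_assoc]

lemma hit_one (x : D) : hit (1 : WithConv (D →ₗ[R] R)) x = x :=
  eq_of_forall_dual R fun h => by simp only [apply_hit, mul_one]

lemma hit_add (f g : WithConv (D →ₗ[R] R)) (x : D) : hit (f + g) x = hit f x + hit g x :=
  eq_of_forall_dual R fun h => by
    rw [map_add]; simp only [apply_hit, mul_add]; rfl

/-- Elements of a subcoalgebra are moved inside it by the dual algebra. -/
lemma hit_mem_of_isSubcoalgebra {C : Submodule R D} (hC : IsSubcoalgebra R C)
    (f : WithConv (D →ₗ[R] R)) {x : D} (hx : x ∈ C) : hit f x ∈ C := by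
  obtain ⟨t, ht⟩ := hC x hx
  rw [hit_apply, ← ht]
  clear ht
  induction t using TensorProduct.induction_on with
  | zero => simp
  | add x y hx hy => rw [map_add, map_add]; exact C.add_mem hx hy
  | tmul m n => simpa using C.smul_mem _ m.2

/-- `f ↦ f ⇀ x` as a linear map. -/
def hitLinear (x : D) : WithConv (D →ₗ[R] R) →ₗ[R] D where
  toFun f := hit f x
  map_add' f g := hit_add f g x
  map_smul' c f := by
    apply eq_of_forall_dual R
    intro g
    rw [map_smul, apply_hit, RingHom.id_apply, apply_hit, mul_smul_comm]; rfl

/-- The orbit of an element under the dual algebra is finite dimensional. -/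
lemma finite_range_hitLinear (x : D) :
    Module.Finite R (LinearMap.range (hitLinear (R := R) x)) := by
  let r := ℛ R x
  have hle : LinearMap.range (hitLinear (R := R) x) ≤
      Submodule.span R (r.left '' (r.index : Set _)) := by
    rintro _ ⟨f, rfl⟩
    change sliceRight f.ofConv (comul (R := R) x) ∈ _
    rw [← r.eq, map_sum]
    refine Submodule.sum_mem _ fun i hi => ?_
    rw [sliceRight_tmul]
    exact Submodule.smul_mem _ _ (Submodule.subset_span ⟨i, hi, rfl⟩)
  have : Module.Finite R (Submodule.span R (r.left '' (r.index : Set _))) :=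
    Module.Finite.span_of_finite R (r.index.finite_toSet.image _)
  exact Submodule.finiteDimensional_of_le hle

variable [IsCocomm R D]

/-- The subspace of the coalgebra annihilated by an ideal of its dual algebra. -/
def annihilated (I : Ideal (WithConv (D →ₗ[R] R))) : Submodule R D where
  carrier := {x | ∀ f ∈ I, f x = 0}
  add_mem' ha hb f hf := by rw [map_add, ha f hf, hb f hf, add_zero]
  zero_mem' f _ := map_zero _
  smul_mem' c x hx f hf := by rw [map_smul, hx f hf, smul_zero]

/-- The functionals vanishing on a subcoalgebra form an ideal. -/
def vanishingIdeal {C : Submodule R D} (hC : IsSubcoalgebra R C) :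
    Ideal (WithConv (D →ₗ[R] R)) where
  carrier := {f | ∀ x ∈ C, f x = 0}
  add_mem' ha hb x hx := by
    exact (congrArg₂ (· + ·) (ha x hx) (hb x hx)).trans (add_zero _)
  zero_mem' x _ := rfl
  smul_mem' g f hf x hx := by
    change (g * f) x = 0
    rw [mul_comm, ← apply_hit]
    exact hf _ (hit_mem_of_isSubcoalgebra hC g hx)

lemma isSubcoalgebra_annihilated (I : Ideal (WithConv (D →ₗ[R] R))) :
    IsSubcoalgebra R (annihilated I) := by
  intro x hx
  -- All elements `hit g x` lie in `annihilated I`. A functional `h` that vanishes there therefore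
  -- satisfies `g (hit h x) = h (hit g x) = 0` for all `g`, so the slice of `Δ(x)` by `h` is zero.
  have key : ∀ f ∈ I, ∀ g : WithConv (D →ₗ[R] R), f (hit g x) = 0 := fun f hf g => by
    rw [apply_hit]; exact hx _ (I.mul_mem_right g hf)
  have hmem : ∀ g : WithConv (D →ₗ[R] R), hit g x ∈ annihilated I := fun g f hf => key f hf g
  have hr : ∀ h : D →ₗ[R] R, (∀ w ∈ annihilated I, h w = 0) →
      sliceRight h (comul (R := R) x) = 0 := fun h hh =>
    eq_of_forall_dual R fun g => by
      change g (hit (toConv h) x) = _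
      rw [apply_hit, mul_comm, ← apply_hit, map_zero]
      exact hh _ (hmem g)
  exact mem_range_map_subtype_of_slices hr fun h hh => by
    rw [sliceLeft_eq_sliceRight_comm, comm_comul]; exact hr h hh

/-- The ideal of functionals that annihilate `x` under the action on the coalgebra. -/
def annIdeal (R : Type*) {D : Type*} [Field R] [AddCommGroup D] [Module R D] [Coalgebra R D]
    [IsCocomm R D] (x : D) : Ideal (WithConv (D →ₗ[R] R)) where
  carrier := {f | hit f x = 0}
  add_mem' ha hb := by
    exact (hit_add _ _ x).trans ((congrArg₂ (· + ·) ha hb).trans (add_zero _))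
  zero_mem' := by
    change sliceRight 0 _ = 0
    simp [sliceRight]
  smul_mem' g f hf := by
    change hit f x = 0 at hf
    change hit (g * f) x = 0
    rw [hit_mul, hf, map_zero]

lemma mem_annIdeal {x : D} {f : WithConv (D →ₗ[R] R)} : f ∈ annIdeal R x ↔ hit f x = 0 := Iff.rfl

instance (x : D) : IsArtinianRing (WithConv (D →ₗ[R] R) ⧸ annIdeal R x) := by
  have := finite_range_hitLinear (R := R) x
  have hfin : Module.Finite R (WithConv (D →ₗ[R] R) ⧸ annIdeal R x) := by
    let φ : (WithConv (D →ₗ[R] R) ⧸ annIdeal R x) →ₗ[R]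
        LinearMap.range (hitLinear (R := R) x) :=
      ((annIdeal R x).restrictScalars R).liftQ (hitLinear (R := R) x).rangeRestrict
        (fun f hf => by ext; exact hf)
    apply Module.Finite.of_injective φ
    rw [← LinearMap.ker_eq_bot, LinearMap.ker_eq_bot']
    intro m hm
    obtain ⟨f, rfl⟩ := Ideal.Quotient.mk_surjective m
    rw [Ideal.Quotient.eq_zero_iff_mem]
    exact congrArg Subtype.val hm
  exact IsArtinianRing.of_finite R _

/-- The ideal of functionals vanishing at a group-like element. -/
def evalIdeal {g : D} (hg : IsGroupLikeElem R g) : Ideal (WithConv (D →ₗ[R] R)) where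
  carrier := {f | f g = 0}
  add_mem' ha hb := by
    exact (congrArg₂ (· + ·) ha hb).trans (add_zero _)
  zero_mem' := rfl
  smul_mem' f h hh := by
    change h g = 0 at hh
    change (f * h) g = 0
    simp [LinearMap.convMul_apply, hg.comul_eq_tmul_self, hh]

lemma mem_evalIdeal {g : D} (hg : IsGroupLikeElem R g) {f : WithConv (D →ₗ[R] R)} :
    f ∈ evalIdeal hg ↔ f g = 0 := Iff.rfl

/-- Over a pointed coalgebra, a maximal ideal of the dual algebra that contains the annihilator
of an element is the vanishing ideal of a group-like element: the subcoalgebra it annihilates is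
simple. -/
lemma exists_eq_evalIdeal (hp : IsPointedCoalgebra R D) {x : D}
    (I : Ideal (WithConv (D →ₗ[R] R))) (hI : I.IsMaximal) (hx : annIdeal R x ≤ I) :
    ∃ (g : D) (hg : IsGroupLikeElem R g), I = evalIdeal hg := by
  have hne : annihilated I ≠ ⊥ := by
    intro hbot
    apply hI.ne_top
    -- The restrictions of `I` to the finite-dimensional orbit `C` of `x` are all functionals on
    -- `C`, so some `f ∈ I` restricts to the counit there, and then `1 - f` annihilates `x`.
    let C := LinearMap.range (hitLinear (R := R) x)
    have : Module.Finite R C := finite_range_hitLinear x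
    let res : WithConv (D →ₗ[R] R) →ₗ[R] Module.Dual R C :=
      { toFun := fun f => f.ofConv ∘ₗ C.subtype
        map_add' := fun _ _ => rfl
        map_smul' := fun _ _ => rfl }
    let Φ : Subspace R (Module.Dual R C) := (I.restrictScalars R).map res
    have hΦ : Φ = ⊤ := by
      have h0 : Φ.dualCoannihilator = ⊥ := by
        rw [eq_bot_iff]
        intro c hc
        have : (c : D) ∈ annihilated I := fun f hf =>
          (Submodule.mem_dualCoannihilator c).1 hc (res f) ⟨f, hf, rfl⟩
        rw [hbot] at this
        simpa using this
      have hfin : FiniteDimensional R (Module.Dual R C) := inferInstance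
      have hΦf : FiniteDimensional R Φ := FiniteDimensional.finiteDimensional_submodule Φ
      rw [← Subspace.dualCoannihilator_dualAnnihilator_eq (W := Φ), h0,
        Submodule.dualAnnihilator_bot]
    rw [Ideal.eq_top_iff_one]
    have h1 : res 1 ∈ Φ := by rw [hΦ]; trivial
    obtain ⟨f, hf, hf1⟩ := h1
    have : 1 - f ∈ annIdeal R x := by
      rw [mem_annIdeal]
      apply eq_of_forall_dual R
      intro g
      rw [apply_hit, mul_comm, ← apply_hit, map_zero]
      have := LinearMap.congr_fun hf1 ⟨hit g x, g, rfl⟩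
      change f (hit g x) = (1 : WithConv (D →ₗ[R] R)) (hit g x) at this
      change (1 : WithConv (D →ₗ[R] R)) (hit g x) - f (hit g x) = 0
      rw [this, sub_self]
    simpa using I.add_mem (hx this) hf
  have hsub := isSubcoalgebra_annihilated I
  have hsimple : IsSimpleSubcoalgebra R (annihilated I) := by
    refine ⟨hsub, hne, fun C' hC' hle => ?_⟩
    by_cases h : C' = ⊥
    · exact Or.inl h
    right
    refine le_antisymm hle fun y hy => ?_
    by_contra hyC
    obtain ⟨f, hf, hfy⟩ := exists_functional_of_notMem hyC
    have hIV : I ≤ vanishingIdeal hC' := fun f hf x hx => hle hx f hf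
    have hV : vanishingIdeal hC' ≠ ⊤ := by
      intro htop
      apply h
      rw [eq_bot_iff]
      intro z hz
      have hz0 : ∀ f : WithConv (D →ₗ[R] R), f z = f 0 := fun f => by
        have : f ∈ vanishingIdeal hC' := by rw [htop]; trivial
        rw [map_zero]; exact this z hz
      exact eq_of_forall_dual R hz0
    have := hI.eq_of_le hV hIV
    have hfI : toConv f ∈ I := by rw [this]; exact hf
    exact hfy (hy _ hfI)
  -- The subcoalgebra is a line; a multiple of its generator is group-like.
  have h1 := hp _ hsimple
  obtain ⟨c, hc0, hc⟩ := finrank_eq_one_iff'.1 h1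
  obtain ⟨t, ht⟩ := hsub c c.2
  have ht' : ∃ r : R, comul (R := R) (c : D) = r • ((c : D) ⊗ₜ[R] (c : D)) := by
    rw [← ht]
    clear ht
    induction t using TensorProduct.induction_on with
    | zero => exact ⟨0, by simp⟩
    | add x y hx hy =>
      obtain ⟨r, hr⟩ := hx
      obtain ⟨s, hs⟩ := hy
      exact ⟨r + s, by rw [map_add, hr, hs, add_smul]⟩
    | tmul m n =>
      obtain ⟨r, hr⟩ := hc m
      obtain ⟨s, hs⟩ := hc n
      refine ⟨r * s, ?_⟩
      rw [← hr, ← hs]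
      simp [TensorProduct.smul_tmul', mul_smul, TensorProduct.tmul_smul, smul_comm r s]
  obtain ⟨r, hr⟩ := ht'
  have hcD : (c : D) ≠ 0 := fun h => hc0 (Subtype.ext h)
  have hε : r * counit (R := R) (c : D) = 1 := by
    have := rTensor_counit_comul (R := R) (c : D)
    rw [hr, map_smul, LinearMap.rTensor_tmul] at this
    have := congrArg (TensorProduct.lid R D) this
    simp only [map_smul, TensorProduct.lid_tmul, one_smul, smul_smul] at this
    have h2 : (r * counit (R := R) (c : D) - 1) • (c : D) = 0 := by
      rw [sub_smul, this, one_smul, sub_self]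
    rcases smul_eq_zero.1 h2 with h | h
    · exact sub_eq_zero.1 h
    · exact absurd h hcD
  have hg : IsGroupLikeElem R (r • (c : D)) :=
    ⟨by rw [map_smul, smul_eq_mul, hε], by
      rw [map_smul, hr]
      simp [TensorProduct.smul_tmul', TensorProduct.tmul_smul]⟩
  refine ⟨_, hg, hI.eq_of_le ?_ ?_⟩
  · intro htop
    have : (1 : WithConv (D →ₗ[R] R)) ∈ evalIdeal hg := by rw [htop]; trivial
    rw [mem_evalIdeal, LinearMap.convOne_apply, hg.counit_eq_one, map_one] at this
    exact one_ne_zero this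
  · intro f hf
    rw [mem_evalIdeal, map_smul, c.2 f hf, smul_zero]

/-- A commutative artinian ring decomposes along powers of its maximal ideals. -/
lemma exists_sum_eq_one_of_isArtinianRing (E : Type*) [CommRing E] [IsArtinianRing E]
    [Nontrivial E] : ∃ (t : Finset (Ideal E)) (n : ℕ) (e : Ideal E → E),
      (∀ i ∈ t, i.IsMaximal) ∧ ∑ i ∈ t, e i = 1 ∧ ∀ i ∈ t, ∀ f ∈ i ^ n, f * e i = 0 := by
  classical
  obtain ⟨n, hn⟩ := IsArtinianRing.isNilpotent_jacobson_bot (R := E)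
  have hfin := IsArtinianRing.setOfPred_isMaximal_finite E
  let t : Finset (Ideal E) := hfin.toFinset
  have ht : ∀ J : Ideal E, J ∈ t ↔ J.IsMaximal := fun J => by simp [t]
  have htn : t.Nonempty := by
    obtain ⟨J, hJ⟩ := Ideal.exists_maximal E
    exact ⟨J, (ht J).2 hJ⟩
  have hcop : (t : Set (Ideal E)).Pairwise fun i j => i ^ n ⊔ j ^ n = ⊤ := by
    intro i hi j hj hij
    have hi' := (ht i).1 hi
    have hj' := (ht j).1 hj
    exact Ideal.pow_sup_pow_eq_top (hi'.coprime_of_ne hj' hij)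
  have hsup := (Ideal.iSup_iInf_eq_top_iff_pairwise htn (fun J : Ideal E => J ^ n)).2 hcop
  have hprod : ∀ e : E, (∀ J ∈ t, e ∈ J ^ n) → e = 0 := by
    intro e he
    have h1 : e ∈ t.inf fun J => J ^ n := by
      rw [Submodule.mem_finsetInf]; exact he
    have h2 : (t.inf fun J => J ^ n) = ∏ J ∈ t, J ^ n := by
      rw [Ideal.prod_eq_iInf_of_pairwise_isCoprime, Finset.inf_eq_iInf]
      intro i hi j hj hij
      exact Ideal.isCoprime_iff_sup_eq.2 (hcop hi hj hij)
    rw [h2, Finset.prod_pow] at h1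
    have h3 : ∏ J ∈ t, J ≤ Ideal.jacobson ⊥ := by
      refine le_trans Ideal.prod_le_inf ?_
      intro z hz
      rw [Ideal.jacobson, Ideal.mem_sInf]
      intro J hJ
      exact Submodule.mem_finsetInf.1 hz J ((ht J).2 hJ.2)
    have h4 := Ideal.pow_right_mono h3 n h1
    rw [hn] at h4
    simpa using h4
  have h1 : (1 : E) ∈ ⨆ i ∈ t, ⨅ (j) (_ : j ∈ t) (_ : j ≠ i), j ^ n := by rw [hsup]; trivial
  rw [Submodule.mem_iSup_finset_iff_exists_sum] at h1
  obtain ⟨μ, hμ⟩ := h1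
  refine ⟨t, n, fun i => (μ i : E), fun i hi => (ht i).1 hi, hμ, fun i hi f hf => hprod _ ?_⟩
  intro J hJ
  by_cases hJi : J = i
  · subst hJi
    exact Ideal.mul_mem_right _ _ hf
  · apply Ideal.mul_mem_left
    have := (μ i).2
    simp only [Submodule.mem_iInf] at this
    exact this J hJ hJi

/-- A pointed cocommutative coalgebra is spanned by elements annihilated by a power of the
vanishing ideal of some group-like element. -/
lemma mem_span_annihilated_pow (hp : IsPointedCoalgebra R D) (x : D) :
    x ∈ Submodule.span R {y : D | ∃ (g : D) (hg : IsGroupLikeElem R g) (n : ℕ),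
      y ∈ annihilated (evalIdeal hg ^ n)} := by
  rcases subsingleton_or_nontrivial (WithConv (D →ₗ[R] R) ⧸ annIdeal R x) with hE | hE
  · have h1 : (1 : WithConv (D →ₗ[R] R)) ∈ annIdeal R x :=
      Ideal.Quotient.eq_zero_iff_mem.1 (Subsingleton.elim _ _)
    rw [mem_annIdeal, hit_one] at h1
    rw [h1]; exact Submodule.zero_mem _
  obtain ⟨t, n, μ, ht, hμ, hprod⟩ :=
    exists_sum_eq_one_of_isArtinianRing (WithConv (D →ₗ[R] R) ⧸ annIdeal R x)
  let π := Ideal.Quotient.mk (annIdeal R x)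
  have hπ : Function.Surjective π := Ideal.Quotient.mk_surjective
  choose e he using fun i => hπ (μ i)
  have hx : x = ∑ i ∈ t, hit (e i) x := by
    have h2 : (1 : WithConv (D →ₗ[R] R)) - ∑ i ∈ t, e i ∈ annIdeal R x := by
      apply Ideal.Quotient.eq_zero_iff_mem.1
      change π _ = 0
      rw [map_sub, map_one, map_sum, ← hμ, sub_eq_zero]
      exact Finset.sum_congr rfl fun i _ => (he i).symm
    have h3 : hitLinear x ((1 : WithConv (D →ₗ[R] R)) - ∑ i ∈ t, e i) = 0 := h2
    rw [map_sub, map_sum, sub_eq_zero] at h3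
    exact (hit_one x).symm.trans h3
  rw [hx]
  refine Submodule.sum_mem _ fun i hi => Submodule.subset_span ?_
  have hmax : (i.comap π).IsMaximal :=
    have := ht i hi
    Ideal.comap_isMaximal_of_surjective π hπ
  have hle : annIdeal R x ≤ i.comap π := fun f hf => by
    rw [Ideal.mem_comap, Ideal.Quotient.eq_zero_iff_mem.2 hf]; exact i.zero_mem
  obtain ⟨g, hg, hgi⟩ := exists_eq_evalIdeal hp _ hmax hle
  refine ⟨g, hg, n, fun f hf => ?_⟩
  rw [← hgi] at hf
  have hf' : π f ∈ i ^ n := Ideal.le_comap_pow π n hf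
  have : f * e i ∈ annIdeal R x := by
    apply Ideal.Quotient.eq_zero_iff_mem.1
    change π _ = 0
    rw [map_mul, he]
    exact hprod i hi _ hf'
  rw [mem_annIdeal, hit_mul] at this
  have h5 := congrArg (1 : WithConv (D →ₗ[R] R)).ofConv this
  rwa [map_zero, apply_hit, one_mul] at h5

end DualAlgebra

/-! ### Monomials in divided power sequences -/

namespace DividedPower
open Coalgebra WithConv TensorProduct

section Monomials

variable {R D : Type*} [Field R] [Ring D] [Bialgebra R D] {I : Type*}

/-- The product of the terms `d i (α i)` of divided power sequences along a list of indices. -/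
def listMonomial (d : I → ℕ → D) (l : List I) (α : I →₀ ℕ) : D :=
  (l.map fun i => d i (α i)).prod

lemma listMonomial_cons (d : I → ℕ → D) (i : I) (l : List I) (α : I →₀ ℕ) :
    listMonomial d (i :: l) α = d i (α i) * listMonomial d l α := by
  simp [listMonomial]

lemma listMonomial_congr (d : I → ℕ → D) (l : List I) {α β : I →₀ ℕ}
    (h : ∀ i ∈ l, α i = β i) : listMonomial d l α = listMonomial d l β := by
  unfold listMonomial
  congr 1
  exact List.map_congr_left fun i hi => by rw [h i hi]

/-- Factors of exponent zero may be dropped, as they are `1`. -/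
lemma listMonomial_filter {d : I → ℕ → D} (h0 : ∀ i, d i 0 = 1) (l : List I) (α : I →₀ ℕ)
    (p : I → Bool) (hp : ∀ i, p i = false → α i = 0) :
    listMonomial d (l.filter p) α = listMonomial d l α := by
  induction l with
  | nil => rfl
  | cons i l ih =>
    rw [List.filter_cons]
    split_ifs with hi
    · rw [listMonomial_cons, listMonomial_cons, ih]
    · rw [ih, listMonomial_cons, hp i (by simpa using hi), h0, one_mul]

/-- The coproduct is multiplicative and the indices are distinct, so the exponents of the list are
split independently of each other. -/
lemma comul_listMonomial [DecidableEq I] {d : I → ℕ → D} (hd : ∀ i, IsDividedPowerSequence R (d i))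
    (l : List I) (hl : l.Nodup) (α : I →₀ ℕ) (hα : ∀ i, α i ≠ 0 → i ∈ l) :
    comul (R := R) (listMonomial d l α) = ∑ p ∈ Finset.HasAntidiagonal.antidiagonal α,
      listMonomial d l p.1 ⊗ₜ[R] listMonomial d l p.2 := by
  induction l generalizing α with
  | nil =>
    have : α = 0 := by
      ext i
      by_contra h
      simpa using hα i h
    subst this
    simp [listMonomial, Bialgebra.comul_one, Algebra.TensorProduct.one_def]
  | cons i l ih =>
    have hil : i ∉ l := (List.nodup_cons.1 hl).1
    have hne : ∀ {j}, j ∈ l → j ≠ i := fun hj h => hil (h ▸ hj)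
    have h1 : listMonomial d l α = listMonomial d l (α.erase i) :=
      listMonomial_congr d l fun j hj => (Finsupp.erase_ne (hne hj)).symm
    have h2 : ∀ j, α.erase i j ≠ 0 → j ∈ l := by
      intro j hj
      have hji : j ≠ i := by rintro rfl; simp at hj
      rw [Finsupp.erase_ne hji] at hj
      exact (List.mem_cons.1 (hα j hj)).resolve_left hji
    rw [listMonomial_cons, Bialgebra.comul_mul, h1, ih (List.nodup_cons.1 hl).2 _ h2,
      (hd i).2, ← Finset.Nat.sum_antidiagonal_eq_sum_range_succ (fun a b => d i a ⊗ₜ[R] d i b),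
      Finset.sum_mul_sum, ← Finset.sum_product']
    refine Finset.sum_bij'
      (fun m _ => (Finsupp.single i m.1.1 + m.2.1, Finsupp.single i m.1.2 + m.2.2))
      (fun p _ => ((p.1 i, p.2 i), (p.1.erase i, p.2.erase i))) ?_ ?_ ?_ ?_ ?_
    · rintro ⟨⟨a, b⟩, ⟨β, γ⟩⟩ hm
      simp only [Finset.mem_product, Finset.HasAntidiagonal.mem_antidiagonal] at hm ⊢
      rw [add_add_add_comm, ← Finsupp.single_add, hm.1, hm.2, Finsupp.single_add_erase]
    · rintro ⟨β, γ⟩ hm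
      simp only [Finset.mem_product, Finset.HasAntidiagonal.mem_antidiagonal] at hm ⊢
      rw [← hm]
      exact ⟨rfl, (Finsupp.erase_add i β γ).symm⟩
    · rintro ⟨⟨a, b⟩, ⟨β, γ⟩⟩ hm
      simp only [Finset.mem_product, Finset.HasAntidiagonal.mem_antidiagonal] at hm
      have h3 : β i + γ i = 0 := by rw [← Finsupp.add_apply, hm.2]; simp
      have hβ : β i = 0 := by omega
      have hγ : γ i = 0 := by omega
      simp [Finsupp.erase_add, hβ, hγ, Finsupp.erase_of_notMem_support]
    · rintro ⟨β, γ⟩ hm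
      simp [Finsupp.single_add_erase]
    · rintro ⟨⟨a, b⟩, ⟨β, γ⟩⟩ hm
      simp only [Finset.mem_product, Finset.HasAntidiagonal.mem_antidiagonal] at hm
      have h3 : β i + γ i = 0 := by rw [← Finsupp.add_apply, hm.2]; simp
      have hβ : β i = 0 := by omega
      have hγ : γ i = 0 := by omega
      rw [Algebra.TensorProduct.tmul_mul_tmul, listMonomial_cons, listMonomial_cons]
      simp only [Finsupp.add_apply, Finsupp.single_eq_same, hβ, hγ, add_zero]
      congr 2
      · exact listMonomial_congr d l fun j hj => by simp [Finsupp.single_eq_of_ne (hne hj)]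
      · exact listMonomial_congr d l fun j hj => by simp [Finsupp.single_eq_of_ne (hne hj)]

variable [LinearOrder I]

/-- The monomial of exponent `α` in divided power sequences, with the factors ordered by index. -/
def monomial (d : I → ℕ → D) (α : I →₀ ℕ) : D := listMonomial d (α.support.sort (· ≤ ·)) α

lemma monomial_eq_listMonomial {d : I → ℕ → D} (h0 : ∀ i, d i 0 = 1) {α : I →₀ ℕ} {s : Finset I}
    (hs : α.support ⊆ s) : monomial d α = listMonomial d (s.sort (· ≤ ·)) α := by
  rw [← listMonomial_filter h0 _ α (fun i => decide (i ∈ α.support))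
    (fun i hi => by simpa using hi), monomial]
  congr 1
  refine List.Perm.eq_of_pairwise' (Finset.pairwise_sort _ _)
    ((Finset.pairwise_sort s _).filter _) ?_
  rw [List.perm_ext_iff_of_nodup (Finset.sort_nodup _ _) ((Finset.sort_nodup _ _).filter _)]
  intro i
  simp only [Finset.mem_sort, List.mem_filter, decide_eq_true_eq]
  exact ⟨fun h => ⟨hs h, h⟩, fun h => h.2⟩

lemma comul_monomial {d : I → ℕ → D} (hd : ∀ i, IsDividedPowerSequence R (d i)) (α : I →₀ ℕ) :
    comul (R := R) (monomial d α) = ∑ p ∈ Finset.HasAntidiagonal.antidiagonal α,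
      monomial d p.1 ⊗ₜ[R] monomial d p.2 := by
  have h0 : ∀ i, d i 0 = 1 := fun i => (hd i).1
  rw [monomial, comul_listMonomial hd _ (Finset.sort_nodup _ _) α
    (fun i hi => by simpa using hi)]
  refine Finset.sum_congr rfl fun p hp => ?_
  rw [Finset.HasAntidiagonal.mem_antidiagonal] at hp
  have hle : ∀ i, p.1 i + p.2 i = α i := fun i => by rw [← hp]; rfl
  rw [monomial_eq_listMonomial h0 (s := α.support), monomial_eq_listMonomial h0 (s := α.support)]
  all_goals
    intro i hi
    rw [Finsupp.mem_support_iff] at hi ⊢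
    have := hle i
    omega

lemma monomial_zero (d : I → ℕ → D) : monomial d 0 = 1 := by
  simp [monomial, listMonomial]

lemma monomial_single {d : I → ℕ → D} (h0 : ∀ i, d i 0 = 1) (i : I) (n : ℕ) :
    monomial d (Finsupp.single i n) = d i n := by
  rw [monomial_eq_listMonomial h0 (s := {i}) Finsupp.support_single_subset]
  simp [listMonomial]

lemma monomial_mem {d : I → ℕ → D} {S : Submonoid D} (h : ∀ i n, d i n ∈ S) (α : I →₀ ℕ) :
    monomial d α ∈ S := by
  apply Submonoid.list_prod_mem
  intro x hx
  obtain ⟨i, -, rfl⟩ := List.mem_map.1 hx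
  exact h i _

end Monomials

end DividedPower

/-! ### The component of the unit is spanned by divided power monomials -/

namespace DividedPower
open Coalgebra WithConv TensorProduct DualAlgebra

section Series

variable {R D : Type*} [Field R] [Ring D] [Bialgebra R D] {I : Type*} [DecidableEq I]

/-- The power series of the values of a functional on a family indexed by exponents. -/
def series (d : (I →₀ ℕ) → D) (f : WithConv (D →ₗ[R] R)) : MvPowerSeries I R := fun α => f (d α)

lemma coeff_series (d : (I →₀ ℕ) → D) (f : WithConv (D →ₗ[R] R)) (α : I →₀ ℕ) :
    MvPowerSeries.coeff α (series d f) = f (d α) := rfl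

variable {d : (I →₀ ℕ) → D} (hd0 : d 0 = 1)
  (hd : ∀ α, comul (R := R) (d α) = ∑ p ∈ Finset.HasAntidiagonal.antidiagonal α,
    d p.1 ⊗ₜ[R] d p.2)

include hd in
lemma series_mul (f g : WithConv (D →ₗ[R] R)) : series d (f * g) = series d f * series d g := by
  ext α
  rw [MvPowerSeries.coeff_mul, coeff_series, LinearMap.convMul_apply, hd]
  simp [coeff_series]

include hd0 hd in
/-- The series of the counit is an idempotent with constant coefficient `1`, hence is `1`. -/
lemma series_one : series d (1 : WithConv (D →ₗ[R] R)) = 1 := by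
  have h1 : series d (1 : WithConv (D →ₗ[R] R)) * series d 1 = series d 1 * 1 := by
    rw [← series_mul hd, mul_one, mul_one]
  have hu : IsUnit (series d (1 : WithConv (D →ₗ[R] R))) := by
    rw [MvPowerSeries.isUnit_iff_constantCoeff, ← MvPowerSeries.coeff_zero_eq_constantCoeff_apply,
      coeff_series, hd0, LinearMap.convOne_apply]
    simp
  exact hu.mul_left_cancel h1

include hd0 hd in
/-- Functionals dual to the members of degree one of the family have products that are dual to the
members of higher degree, up to terms of larger degree. -/
lemma exists_triangular (θ : I → WithConv (D →ₗ[R] R)) (hθ0 : ∀ i, θ i 1 = 0)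
    (hθ : ∀ i j, θ i (d (Finsupp.single j 1)) = if i = j then 1 else 0) (n : ℕ) (α : I →₀ ℕ)
    (hα : α.degree = n) : ∃ f : WithConv (D →ₗ[R] R), ∀ γ : I →₀ ℕ, γ.degree ≤ n →
      f (d γ) = if γ = α then 1 else 0 := by
  induction n generalizing α with
  | zero =>
    refine ⟨1, fun γ _ => ?_⟩
    rw [Finsupp.degree_eq_zero_iff] at hα
    rw [← coeff_series, series_one hd0 hd, MvPowerSeries.coeff_one, hα]
  | succ n ih =>
    have hne : α ≠ 0 := by rintro rfl; simp at hα
    obtain ⟨i, hi⟩ := Finsupp.ne_iff.1 hne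
    obtain ⟨β, rfl⟩ : ∃ β, α = Finsupp.single i 1 + β :=
      ⟨α - Finsupp.single i 1, (add_tsub_cancel_of_le (by
        rw [Finsupp.single_le_iff]; exact Nat.one_le_iff_ne_zero.2 hi)).symm⟩
    have hβ : β.degree = n := by
      rw [map_add, Finsupp.degree_single] at hα; omega
    obtain ⟨f, hf⟩ := ih β hβ
    refine ⟨θ i * f, fun γ hγ => ?_⟩
    rw [← coeff_series, series_mul hd, MvPowerSeries.coeff_mul]
    simp only [coeff_series]
    have hterm : ∀ p ∈ Finset.HasAntidiagonal.antidiagonal γ, (θ i) (d p.1) * f (d p.2) =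
        if p = (Finsupp.single i 1, β) then 1 else 0 := by
      rintro ⟨p, q⟩ hp
      rw [Finset.HasAntidiagonal.mem_antidiagonal] at hp
      change p + q = γ at hp
      change (θ i) (d p) * f (d q) = _
      by_cases hp0 : p = 0
      · rw [hp0, hd0, hθ0, zero_mul, if_neg]
        intro h
        have := congrArg Finsupp.degree (Prod.ext_iff.1 h).1
        simp at this
      have hpd : 1 ≤ p.degree :=
        Nat.one_le_iff_ne_zero.2 fun h => hp0 ((Finsupp.degree_eq_zero_iff p).1 h)
      have hpq : p.degree + q.degree ≤ n + 1 := by rw [← map_add, hp]; exact hγ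
      rw [hf q (by omega)]
      by_cases hq : q = β
      · subst hq
        have hp1 : p.degree = 1 := by omega
        obtain ⟨j, rfl⟩ : ∃ j, p = Finsupp.single j 1 := by
          obtain ⟨j, hj⟩ := Finsupp.ne_iff.1 hp0
          obtain ⟨p', rfl⟩ : ∃ β, p = Finsupp.single j 1 + β :=
            ⟨p - Finsupp.single j 1, (add_tsub_cancel_of_le (by
              rw [Finsupp.single_le_iff]; exact Nat.one_le_iff_ne_zero.2 hj)).symm⟩
          rw [map_add, Finsupp.degree_single] at hp1
          have : p'.degree = 0 := by omega
          rw [Finsupp.degree_eq_zero_iff] at this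
          exact ⟨j, by rw [this, add_zero]⟩
        rw [hθ, if_pos rfl, mul_one]
        by_cases hij : i = j
        · subst hij; simp
        · rw [if_neg hij, if_neg]
          intro h
          have h1 := (Prod.ext_iff.1 h).1
          have := DFunLike.congr_fun h1 i
          rw [Finsupp.single_eq_same, Finsupp.single_eq_of_ne hij] at this
          exact zero_ne_one this
      · rw [if_neg hq, mul_zero, if_neg]
        exact fun h => hq (Prod.ext_iff.1 h).2
    rw [Finset.sum_congr rfl hterm, Finset.sum_ite_eq']
    simp only [Finset.HasAntidiagonal.mem_antidiagonal, eq_comm]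

include hd0 hd in
/-- A divided power family is linearly independent as soon as its members of degree one are: a
functional dual to an exponent of maximal degree in a relation isolates its coefficient. -/
lemma linearIndependent_of_degree_one (θ : I → WithConv (D →ₗ[R] R)) (hθ0 : ∀ i, θ i 1 = 0)
    (hθ : ∀ i j, θ i (d (Finsupp.single j 1)) = if i = j then 1 else 0) :
    LinearIndependent R d := by
  rw [linearIndependent_iff]
  intro l hl
  by_contra hne
  obtain ⟨α, hα, hmax⟩ := Finset.exists_max_image l.support Finsupp.degree
    (Finsupp.support_nonempty_iff.2 hne)
  obtain ⟨f, hf⟩ := exists_triangular hd0 hd θ hθ0 hθ _ α rfl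
  have h1 := congrArg f.ofConv hl
  rw [map_zero, Finsupp.linearCombination_apply, Finsupp.sum, map_sum] at h1
  have h2 : ∀ γ ∈ l.support, f.ofConv (l γ • d γ) = if γ = α then l γ else 0 := by
    intro γ hγ
    rw [map_smul, hf γ (hmax γ hγ), smul_eq_mul, mul_ite, mul_one, mul_zero]
  rw [Finset.sum_congr rfl h2, Finset.sum_ite_eq', if_pos hα] at h1
  exact (Finsupp.mem_support_iff.1 hα) h1

end Series

/-- A symmetric function of two nonzero exponents that is a cocycle depends only on the sum. -/
lemma eq_of_add_eq_add {I : Type*} {T : Type*} (c : (I →₀ ℕ) → (I →₀ ℕ) → T)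
    (hsymm : ∀ β γ, c β γ = c γ β)
    (hc : ∀ β γ δ, β ≠ 0 → γ ≠ 0 → δ ≠ 0 → c (β + γ) δ = c β (γ + δ))
    {β γ β' γ' : I →₀ ℕ} (hβ : β ≠ 0) (hγ : γ ≠ 0) (hβ' : β' ≠ 0) (hγ' : γ' ≠ 0)
    (h : β + γ = β' + γ') : c β γ = c β' γ' := by
  have key : ∀ (β γ : I →₀ ℕ), γ ≠ 0 → ∀ i, β i ≠ 0 →
      c β γ = c (Finsupp.single i 1) (β + γ - Finsupp.single i 1) := by
    intro β γ hγ i hi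
    obtain ⟨β', rfl⟩ : ∃ β', β = Finsupp.single i 1 + β' :=
      ⟨β - Finsupp.single i 1, (add_tsub_cancel_of_le (by
        rw [Finsupp.single_le_iff]; exact Nat.one_le_iff_ne_zero.2 hi)).symm⟩
    rw [add_assoc, add_tsub_cancel_left]
    by_cases hβ' : β' = 0
    · rw [hβ', add_zero, zero_add]
    · exact hc _ _ _ (by simp) hβ' hγ
  have key2 : ∀ (β γ : I →₀ ℕ), β ≠ 0 → γ ≠ 0 → ∀ i, (β + γ) i ≠ 0 →
      c β γ = c (Finsupp.single i 1) (β + γ - Finsupp.single i 1) := by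
    intro β γ hβ hγ i hi
    by_cases h : β i = 0
    · rw [hsymm, add_comm β γ]
      refine key γ β hβ i ?_
      rw [Finsupp.add_apply, h, zero_add] at hi
      exact hi
    · exact key β γ hγ i h
  obtain ⟨i, hi⟩ := Finsupp.ne_iff.1 hβ
  have h1 : (β + γ) i ≠ 0 := by
    simp only [Finsupp.add_apply, Finsupp.coe_zero, Pi.zero_apply] at hi ⊢
    omega
  rw [key2 β γ hβ hγ i h1, key2 β' γ' hβ' hγ' i (h ▸ h1), h]

section Spanning

variable {R D : Type*} [Field R] [Ring D] [Bialgebra R D]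

/-- The defect of primitivity `Δ(x) - x ⊗ 1 - 1 ⊗ x + ε(x) 1 ⊗ 1`. -/
def defect : D →ₗ[R] D ⊗[R] D :=
  comul - (TensorProduct.mk R D D).flip 1 - TensorProduct.mk R D D 1 +
    (counit (R := R)).smulRight ((1 : D) ⊗ₜ[R] (1 : D))

lemma defect_apply (x : D) : defect (R := R) x =
    comul (R := R) x - x ⊗ₜ[R] 1 - 1 ⊗ₜ[R] x + counit (R := R) x • ((1 : D) ⊗ₜ[R] (1 : D)) := rfl

/-- The functional `f - f(1) ε`, which vanishes at `1`. -/
def reduced (f : WithConv (D →ₗ[R] R)) : WithConv (D →ₗ[R] R) :=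
  f - f (1 : D) • (1 : WithConv (D →ₗ[R] R))

lemma reduced_apply (f : WithConv (D →ₗ[R] R)) (x : D) :
    reduced f x = f x - f (1 : D) * counit (R := R) x := by
  change f x - f (1 : D) • (1 : WithConv (D →ₗ[R] R)) x = _
  rw [LinearMap.convOne_apply]; rfl

lemma reduced_one (f : WithConv (D →ₗ[R] R)) : reduced f (1 : D) = 0 := by
  simp [reduced_apply]

lemma reduced_eq_self {f : WithConv (D →ₗ[R] R)} (h : f (1 : D) = 0) : reduced f = f := by
  rw [reduced, h, zero_smul, sub_zero]

/-- Evaluating two functionals on the defect amounts to evaluating the product of their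
reductions. -/
lemma apply_sliceRight_defect (f g : WithConv (D →ₗ[R] R)) (x : D) :
    f (sliceRight g.ofConv (defect (R := R) x)) = (reduced f * reduced g) x := by
  have h1 : ∀ a b : R, ∀ F G : WithConv (D →ₗ[R] R),
      (F - a • (1 : WithConv (D →ₗ[R] R))) * (G - b • (1 : WithConv (D →ₗ[R] R))) =
        F * G - a • G - b • F + (a * b) • (1 : WithConv (D →ₗ[R] R)) := by
    intro a b F G
    simp only [mul_sub, sub_mul, mul_smul_comm, smul_mul_assoc, mul_one, one_mul]
    module
  have h2 : f (sliceRight g.ofConv (comul (R := R) x)) = (f * g) x := apply_hit f g x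
  rw [reduced, reduced, h1, defect_apply]
  simp only [map_add, map_sub, map_smul, sliceRight_tmul, h2]
  change _ = (f * g) x - f (1 : D) • g x - g (1 : D) • f x +
    (f (1 : D) * g (1 : D)) • (1 : WithConv (D →ₗ[R] R)) x
  rw [LinearMap.convOne_apply]
  simp only [smul_eq_mul, Algebra.algebraMap_self, RingHom.id_apply]
  ring

/-- The subspace of primitive elements. -/
def primitives (R D : Type*) [Field R] [Ring D] [Bialgebra R D] : Submodule R D where
  carrier := {x | IsPrimitiveElement R x}
  add_mem' {a b} ha hb := by
    change comul _ = _ at ha hb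
    change comul _ = _
    rw [map_add, ha, hb, TensorProduct.add_tmul, TensorProduct.tmul_add]
    abel
  zero_mem' := by simp [IsPrimitiveElement]
  smul_mem' c x hx := by
    change comul _ = _ at hx
    change comul _ = _
    rw [map_smul, hx, smul_add, TensorProduct.smul_tmul', TensorProduct.tmul_smul]

lemma counit_eq_zero_of_isPrimitiveElement {x : D} (hx : IsPrimitiveElement R x) :
    counit (R := R) x = 0 := by
  have h := rTensor_counit_comul (R := R) x
  rw [hx, map_add, LinearMap.rTensor_tmul, LinearMap.rTensor_tmul, Bialgebra.counit_one] at h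
  have h2 := congrArg (fun t => counit (R := R) (TensorProduct.lid R D t)) h
  simpa using h2

lemma isPrimitiveElement_of_defect_eq_zero {x : D} (h : defect (R := R) x = 0) :
    IsPrimitiveElement R (x - counit (R := R) x • (1 : D)) := by
  rw [defect_apply] at h
  have h1 : comul (R := R) x =
      x ⊗ₜ[R] 1 + 1 ⊗ₜ[R] x - counit (R := R) x • ((1 : D) ⊗ₜ[R] (1 : D)) := by
    rw [← sub_eq_zero, ← h]; abel
  rw [IsPrimitiveElement, map_sub, map_smul, h1, Bialgebra.comul_one,
    Algebra.TensorProduct.one_def, TensorProduct.sub_tmul, TensorProduct.tmul_sub,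
    TensorProduct.tmul_smul, ← TensorProduct.smul_tmul']
  abel

variable [IsCocomm R D] {I : Type*} [DecidableEq I] {d : (I →₀ ℕ) → D} (hd0 : d 0 = 1)
  (hd : ∀ α, comul (R := R) (d α) = ∑ p ∈ Finset.HasAntidiagonal.antidiagonal α,
    d p.1 ⊗ₜ[R] d p.2)

include hd0 hd in
/-- If the members of degree one of a divided power family form a basis of the primitive elements,
then the family spans all elements annihilated by a power of the vanishing ideal of `1`. The cocycle
given by the defect of such an element depends only on the sum of the two exponents, hence is the
defect of a combination of the family, and what remains is primitive. -/
lemma annihilated_pow_le_span (v : Module.Basis I R (primitives R D))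
    (hv : ∀ i, d (Finsupp.single i 1) = v i) (n : ℕ) :
    annihilated (evalIdeal (IsGroupLikeElem.one (R := R) (A := D)) ^ n) ≤
      Submodule.span R (Set.range d) := by
  classical
  set m := evalIdeal (IsGroupLikeElem.one (R := R) (A := D)) with hm
  set W := Submodule.span R (Set.range d) with hW
  have hdW : ∀ α, d α ∈ W := fun α => Submodule.subset_span ⟨α, rfl⟩
  have hlin : LinearIndependent R d := by
    have hθ : ∀ i, ∃ θ : WithConv (D →ₗ[R] R), θ (1 : D) = 0 ∧
        ∀ j, θ (v j : D) = if i = j then 1 else 0 := by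
      intro i
      obtain ⟨f, hf⟩ := LinearMap.exists_extend (v.coord i)
      refine ⟨reduced (toConv f), reduced_one _, fun j => ?_⟩
      rw [reduced_apply, counit_eq_zero_of_isPrimitiveElement (v j).2, mul_zero, sub_zero]
      have := LinearMap.congr_fun hf (v j)
      simp only [LinearMap.comp_apply, Submodule.subtype_apply] at this
      change f (v j) = _
      rw [this, Module.Basis.coord_apply, Module.Basis.repr_self, Finsupp.single_apply]
      simp only [eq_comm]
    choose θ hθ0 hθ1 using hθ
    exact linearIndependent_of_degree_one hd0 hd θ hθ0 fun i j => by rw [hv, hθ1]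
  obtain ⟨q, hq⟩ := LinearMap.exists_leftInverse_of_injective (Finsupp.linearCombination R d)
    (linearIndependent_iff_ker.1 hlin)
  set Θ := Finsupp.linearCombination R d with hΘ
  have hqΘ : ∀ l, q (Θ l) = l := fun l => LinearMap.congr_fun hq l
  have hΘW : ∀ l, Θ l ∈ W := fun l => by
    rw [hW, ← Finsupp.range_linearCombination]; exact ⟨l, rfl⟩
  have hQ : ∀ w ∈ W, (Θ ∘ₗ q) w = w := fun w hw => by
    rw [hW, ← Finsupp.range_linearCombination] at hw
    obtain ⟨l, rfl⟩ := hw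
    rw [LinearMap.comp_apply, ← hΘ, hqΘ]
  -- `θ α` is the coordinate functional of `d α`, extended to all of `D`.
  let θ : (I →₀ ℕ) → WithConv (D →ₗ[R] R) := fun α => toConv (Finsupp.lapply α ∘ₗ q)
  have hθ : ∀ α β, θ α (d β) = if β = α then 1 else 0 := by
    intro α β
    change q (d β) α = _
    have : d β = Θ (Finsupp.single β 1) := by simp [hΘ]
    rw [this, hqΘ, Finsupp.single_apply]
  have hθs : ∀ α, series d (θ α) = MvPowerSeries.monomial α 1 := by
    intro α
    ext β
    rw [coeff_series, hθ, MvPowerSeries.coeff_monomial]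
  have hθ1 : ∀ α, α ≠ 0 → θ α (1 : D) = 0 := by
    intro α hα
    rw [← hd0, hθ, if_neg (Ne.symm hα)]
  -- A functional vanishes on `W` if and only if its power series is zero.
  have hvan : ∀ f : WithConv (D →ₗ[R] R), series d f = 0 → ∀ w ∈ W, f w = 0 := by
    intro f hf w hw
    induction hw using Submodule.span_induction with
    | mem x hx =>
      obtain ⟨α, rfl⟩ := hx
      rw [← coeff_series, hf]; simp
    | zero => exact map_zero _
    | add x y _ _ hx hy => rw [map_add, hx, hy, add_zero]
    | smul a x _ hx => rw [map_smul, hx, smul_zero]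
  have hvan' : ∀ f : WithConv (D →ₗ[R] R), (∀ w ∈ W, f w = 0) → series d f = 0 := by
    intro f hf
    ext α
    rw [coeff_series, hf _ (hdW α)]; simp
  have hred0 : series d (reduced (θ 0)) = 0 := by
    ext α
    rw [coeff_series, reduced_apply, hθ, ← hd0, hθ, if_pos rfl, one_mul]
    have : counit (R := R) (d α) = if α = 0 then 1 else 0 := by
      rw [← MvPowerSeries.coeff_one, ← series_one hd0 hd, coeff_series, LinearMap.convOne_apply]
      simp
    rw [this, sub_self, map_zero]
  -- The coordinates of `(q ⊗ q)(t)` are the slices of `t` by the coordinate functionals.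
  have htensor : ∀ (β γ : I →₀ ℕ) (t : D ⊗[R] D),
      finsuppTensorFinsupp' R (I →₀ ℕ) (I →₀ ℕ) (TensorProduct.map q q t) (β, γ) =
        θ β (sliceRight (θ γ).ofConv t) := by
    intro β γ t
    induction t using TensorProduct.induction_on with
    | zero => simp
    | add x y hx hy => simp only [map_add, Finsupp.add_apply, hx, hy]
    | tmul x y =>
      rw [TensorProduct.map_tmul, finsuppTensorFinsupp'_apply_apply, sliceRight_tmul, map_smul,
        smul_eq_mul, mul_comm]
      rfl
  -- If `z` satisfies this condition, then the slices of its defect by functionals vanishing on `W`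
  -- are zero, so that its defect lies in `W ⊗ W`.
  have hfix : ∀ z : D, (∀ f g : WithConv (D →ₗ[R] R), (∀ w ∈ W, f w = 0) → g (1 : D) = 0 →
      (g * f) z = 0) → TensorProduct.map (Θ ∘ₗ q) (Θ ∘ₗ q) (defect (R := R) z) = defect z := by
    intro z hz
    have hr : ∀ h : D →ₗ[R] R, (∀ w ∈ W, h w = 0) → sliceRight h (defect (R := R) z) = 0 := by
      intro h hh
      apply eq_of_forall_dual R
      intro g
      have h1 : h (1 : D) = 0 := by rw [← hd0]; exact hh _ (hdW 0)
      have h2 := apply_sliceRight_defect g (toConv h) z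
      rw [reduced_eq_self (f := toConv h) h1, hz (toConv h) (reduced g) hh (reduced_one g)] at h2
      rw [map_zero]
      exact h2
    refine map_eq_self_of_slices hr (fun h hh => ?_) _ hQ
    have hc : TensorProduct.comm R D D (defect (R := R) z) = defect z := by
      rw [defect_apply]
      simp only [map_add, map_sub, map_smul, comm_comul, TensorProduct.comm_tmul]
      abel
    rw [sliceLeft_eq_sliceRight_comm, hc, hr h hh]
  induction n with
  | zero =>
    intro y hy
    have : y = 0 := eq_of_forall_dual R fun f => by rw [map_zero]; exact hy f (by simp)
    rw [this]; exact W.zero_mem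
  | succ n ih =>
    intro y hy
    -- By induction `hit g y ∈ W` for all `g` in the vanishing ideal of `1`.
    have hy' : ∀ f g : WithConv (D →ₗ[R] R), (∀ w ∈ W, f w = 0) → g (1 : D) = 0 →
        (g * f) y = 0 := by
      intro f g hf hg
      rw [mul_comm, ← apply_hit]
      refine hf _ (ih fun h hh => ?_)
      rw [apply_hit]
      exact hy _ (by
        have := Ideal.mul_mem_mul hh (show g ∈ m from hg)
        exact (pow_succ m n).symm ▸ this)
    -- The coefficients of the defect of `y` form a symmetric cocycle.
    let c : (I →₀ ℕ) → (I →₀ ℕ) → R := fun β γ => (θ β * θ γ) y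
    have hcsymm : ∀ β γ, c β γ = c γ β := fun β γ => by
      change (θ β * θ γ) y = (θ γ * θ β) y; rw [mul_comm]
    have haux : ∀ β γ δ, δ ≠ 0 → (θ δ * θ (β + γ)) y = (θ δ * (θ β * θ γ)) y := by
      intro β γ δ hδ
      have h1 : ∀ w ∈ W, (θ (β + γ) - θ β * θ γ) w = 0 := by
        apply hvan
        ext α
        change (θ (β + γ)) (d α) - (θ β * θ γ) (d α) = 0
        rw [← coeff_series, ← coeff_series, series_mul hd, hθs, hθs, hθs,
          MvPowerSeries.monomial_mul_monomial, one_mul, sub_self]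
      have h2 := hy' _ _ h1 (hθ1 δ hδ)
      rw [mul_sub] at h2
      exact sub_eq_zero.1 h2
    have hc : ∀ β γ δ, β ≠ 0 → γ ≠ 0 → δ ≠ 0 → c (β + γ) δ = c β (γ + δ) := by
      intro β γ δ hβ hγ hδ
      change (θ (β + γ) * θ δ) y = (θ β * θ (γ + δ)) y
      rw [mul_comm, haux β γ δ hδ, haux γ δ β hβ, ← mul_assoc (θ β), mul_comm (θ δ)]
    let F := finsuppTensorFinsupp' R (I →₀ ℕ) (I →₀ ℕ) (TensorProduct.map q q (defect (R := R) y))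
    have hF : ∀ β γ, β ≠ 0 → γ ≠ 0 → F (β, γ) = c β γ := by
      intro β γ hβ hγ
      change finsuppTensorFinsupp' R (I →₀ ℕ) (I →₀ ℕ) _ (β, γ) = _
      rw [htensor, apply_sliceRight_defect, reduced_eq_self (hθ1 β hβ), reduced_eq_self (hθ1 γ hγ)]
    -- The element `∑ C α • d α` of `W` has the same defect as `y`, where `C (β + γ) = c β γ`. The
    -- sum is finite because `F`, the coordinate vector of the defect of `y`, has finite support.
    -- The values of `C` at `0` and at exponents of degree one are irrelevant, and are set to `0`.
    let C : (I →₀ ℕ) →₀ R := Finsupp.onFinset (F.support.image fun p => p.1 + p.2)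
      (fun α => if h : ∃ p : (I →₀ ℕ) × (I →₀ ℕ), p.1 ≠ 0 ∧ p.2 ≠ 0 ∧ p.1 + p.2 = α then
        F h.choose else 0) (by
        intro α hα
        split_ifs at hα with h
        · exact Finset.mem_image.2 ⟨_, Finsupp.mem_support_iff.2 hα, h.choose_spec.2.2⟩
        · exact absurd rfl hα)
    have hC : ∀ β γ, β ≠ 0 → γ ≠ 0 → C (β + γ) = c β γ := by
      intro β γ hβ hγ
      have h : ∃ p : (I →₀ ℕ) × (I →₀ ℕ), p.1 ≠ 0 ∧ p.2 ≠ 0 ∧ p.1 + p.2 = β + γ :=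
        ⟨(β, γ), hβ, hγ, rfl⟩
      rw [Finsupp.onFinset_apply]
      rw [dif_pos h]
      have hs := h.choose_spec
      have h3 : F h.choose = c h.choose.1 h.choose.2 := hF _ _ hs.1 hs.2.1
      rw [h3]
      exact eq_of_add_eq_add c hcsymm hc hs.1 hs.2.1 hβ hγ hs.2.2
    have hΘC : ∀ f : WithConv (D →ₗ[R] R), f (Θ C) = C.sum fun α a => a * f (d α) := by
      intro f
      rw [hΘ, Finsupp.linearCombination_apply, Finsupp.sum, map_sum]
      exact Finset.sum_congr rfl fun α _ => by rw [map_smul, smul_eq_mul]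
    have hz : ∀ f g : WithConv (D →ₗ[R] R), (∀ w ∈ W, f w = 0) → g (1 : D) = 0 →
        (g * f) (y - Θ C) = 0 := by
      intro f g hf hg
      rw [map_sub, hy' f g hf hg, zero_sub, neg_eq_zero]
      refine hvan _ ?_ _ (hΘW C)
      rw [series_mul hd, hvan' f hf, mul_zero]
    have hdef : defect (R := R) (y - Θ C) = 0 := by
      rw [← hfix _ hz, TensorProduct.map_comp, LinearMap.comp_apply]
      have : TensorProduct.map q q (defect (R := R) (y - Θ C)) = 0 := by
        apply (finsuppTensorFinsupp' R (I →₀ ℕ) (I →₀ ℕ)).injective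
        rw [map_zero]
        ext ⟨β, γ⟩
        rw [htensor, apply_sliceRight_defect, Finsupp.zero_apply]
        by_cases hβ : β = 0
        · rw [hβ, mul_comm]
          exact hz _ _ (hvan _ hred0) (reduced_one _)
        by_cases hγ : γ = 0
        · rw [hγ]
          exact hz _ _ (hvan _ hred0) (reduced_one _)
        rw [reduced_eq_self (hθ1 β hβ), reduced_eq_self (hθ1 γ hγ), map_sub, hΘC]
        have : ∀ α, (θ β * θ γ) (d α) = if α = β + γ then 1 else 0 := by
          intro α
          rw [← coeff_series, series_mul hd, hθs, hθs, MvPowerSeries.monomial_mul_monomial,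
            one_mul, MvPowerSeries.coeff_monomial]
        simp only [this, mul_ite, mul_one, mul_zero]
        rw [Finsupp.sum_ite_eq']
        have h4 := hC β γ hβ hγ
        split_ifs with h5
        · rw [h4]; exact sub_self _
        · rw [Finsupp.notMem_support_iff] at h5
          rw [sub_zero, ← h5, h4]
      rw [this, map_zero]
    have hprim := isPrimitiveElement_of_defect_eq_zero hdef
    have hPW : primitives R D ≤ W := by
      intro p hp
      have h1 := v.linearCombination_repr ⟨p, hp⟩
      have h2 := congrArg (primitives R D).subtype h1
      rw [Finsupp.linearCombination_apply, Finsupp.sum, map_sum] at h2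
      change _ = p at h2
      rw [← h2]
      refine W.sum_mem fun i _ => ?_
      rw [map_smul]
      refine W.smul_mem _ ?_
      rw [Submodule.subtype_apply, ← hv]
      exact hdW _
    have h6 : y = (y - Θ C - counit (R := R) (y - Θ C) • (1 : D)) +
        counit (R := R) (y - Θ C) • d 0 + Θ C := by
      rw [hd0]; abel
    rw [h6]
    exact W.add_mem (W.add_mem (hPW hprim) (W.smul_mem _ (hdW 0))) (hΘW C)

end Spanning
end DividedPower

/-! ### Simple module algebras are reduced -/

namespace ModuleAlgebra
open Coalgebra WithConv TensorProduct DualAlgebra DividedPower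

section Reduced

variable {R D : Type*} [Field R] [Ring D] [HopfAlgebra R D] [IsCocomm R D]

/-- A subalgebra of a pointed cocommutative Hopf algebra of Birkhoff-Witt type that contains all
group-like elements and all terms of divided power sequences is everything. -/
lemma eq_top_of_isGroupLikeElem_of_isDividedPowerSequence (hp : IsPointedCoalgebra R D)
    (hBW : IsBirkhoffWittType R D) (S : Subalgebra R D)
    (hg : ∀ g, IsGroupLikeElem R g → g ∈ S)
    (hd : ∀ d, IsDividedPowerSequence R d → ∀ n, d n ∈ S) : S = ⊤ := by
  classical
  -- The part of `D` supported at `1` is spanned by divided power monomials.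
  have h1 : ∀ n, annihilated (evalIdeal (IsGroupLikeElem.one (R := R) (A := D)) ^ n) ≤
      Subalgebra.toSubmodule S := by
    intro n
    let v := Module.Basis.ofVectorSpace R (primitives R D)
    choose d hd1 _ hd2 using fun i => hBW (v i : D) (v i).2
    let _ : LinearOrder (Module.Basis.ofVectorSpaceIndex R (primitives R D)) :=
      IsWellOrder.linearOrder WellOrderingRel
    refine (annihilated_pow_le_span (d := monomial d) (monomial_zero d)
      (fun α => by convert comul_monomial hd1 α) v
      (fun i => by rw [monomial_single fun j => (hd1 j).1, hd2]) n).trans ?_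
    rw [Submodule.span_le]
    rintro _ ⟨α, rfl⟩
    exact monomial_mem (S := S.toSubsemiring.toSubmonoid) (fun i n => hd _ (hd1 i) n) α
  rw [eq_top_iff]
  intro x _
  have hx := mem_span_annihilated_pow hp x
  rw [← Subalgebra.mem_toSubmodule]
  refine Submodule.span_le.2 ?_ hx
  rintro y ⟨g, hgl, n, hy⟩
  -- Translate by `g⁻¹` to the component of `1`.
  let g' := HopfAlgebra.antipode R g
  have hg' : IsGroupLikeElem R g' := hgl.antipode
  have hg'g : g' * g = 1 := hgl.antipode_mul_cancel
  have hgg' : g * g' = 1 := hgl.mul_antipode_cancel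
  let τ : WithConv (D →ₗ[R] R) →+* WithConv (D →ₗ[R] R) :=
    { toFun := fun f => toConv (f.ofConv ∘ₗ LinearMap.mulLeft R g')
      map_one' := by
        ext z
        simp [LinearMap.convOne_def, hg'.counit_eq_one]
      map_mul' := fun f h => by
        ext z
        change (f * h) (g' * z) = (toConv (f.ofConv ∘ₗ LinearMap.mulLeft R g') *
          toConv (h.ofConv ∘ₗ LinearMap.mulLeft R g')) z
        rw [LinearMap.convMul_apply, LinearMap.convMul_apply, Bialgebra.comul_mul,
          hg'.comul_eq_tmul_self]
        induction comul (R := R) z using TensorProduct.induction_on with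
        | zero => simp
        | add x y hx hy => simp only [mul_add, map_add, hx, hy]
        | tmul m n => simp
      map_zero' := rfl
      map_add' := fun _ _ => rfl }
  have hle : evalIdeal (IsGroupLikeElem.one (R := R) (A := D)) ≤ (evalIdeal hgl).comap τ := by
    intro f hf
    change f (g' * g) = 0
    rw [hg'g]; exact hf
  have h2 : g' * y ∈ annihilated (evalIdeal (IsGroupLikeElem.one (R := R) (A := D)) ^ n) := by
    intro f hf
    have h3 : τ f ∈ evalIdeal hgl ^ n :=
      Ideal.le_comap_pow τ n (Ideal.pow_right_mono hle n hf)
    exact hy _ h3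
  have h4 : y = g * (g' * y) := by rw [← mul_assoc, hgg', one_mul]
  rw [h4]
  exact S.mul_mem (hg g hgl) (h1 n h2)

variable (L : Type*) [CommRing L] [Algebra R L] [ModuleAlgebra R D L]

/-- The subalgebra of the elements of `D` whose action preserves an ideal. -/
def idealStabilizer (D : Type*) [Ring D] [HopfAlgebra R D] [ModuleAlgebra R D L] (I : Ideal L) :
    Subalgebra R D where
  carrier := {d | ∀ a ∈ I, act (R := R) d a ∈ I}
  mul_mem' hx hy a ha := by rw [map_mul]; exact hx _ (hy a ha)
  add_mem' hx hy a ha := by rw [map_add]; exact I.add_mem (hx a ha) (hy a ha)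
  algebraMap_mem' r a ha := by
    rw [AlgHom.commutes, Module.algebraMap_end_apply, Algebra.smul_def]
    exact I.mul_mem_left _ ha

/-- The nilradical of a module algebra is stable: a divided power sequence induces a homomorphism to
formal power series, and power series over a domain have no nilpotents. -/
lemma act_mem_nilradical (hp : IsPointedCoalgebra R D) (hBW : IsBirkhoffWittType R D) (d : D)
    (a : L) (ha : a ∈ nilradical L) : act (R := R) d a ∈ nilradical L := by
  have htop : idealStabilizer (R := R) L D (nilradical L) = ⊤ := by
    refine eq_top_of_isGroupLikeElem_of_isDividedPowerSequence hp hBW _ ?_ ?_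
    · intro g hg a ha
      have h1 : act (R := R) g (1 : L) = 1 := by
        rw [act_one, hg.counit_eq_one, map_one]
      have hmul : ∀ a b : L, act (R := R) g (a * b) = act (R := R) g a * act (R := R) g b := by
        intro a b
        rw [act_mul, hg.comul_eq_tmul_self]; simp
      have hpow : ∀ n : ℕ, act (R := R) g (a ^ n) = act (R := R) g a ^ n := by
        intro n
        induction n with
        | zero => simpa using h1
        | succ n ih => rw [pow_succ, hmul, ih, pow_succ]
      obtain ⟨n, hn⟩ := mem_nilradical.1 ha
      exact mem_nilradical.2 ⟨n, by rw [← hpow, hn, map_zero]⟩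
    · -- For each prime `P`, the series `∑ (d n • a) X ^ n` over `L ⧸ P` of a nilpotent `a` is zero.
      intro d hd n a ha
      rw [nilradical_eq_sInf, Ideal.mem_sInf]
      intro P hP
      have : P.IsPrime := hP
      let φ : L →+* PowerSeries (L ⧸ P) :=
        { toFun := fun a => PowerSeries.mk fun n => Ideal.Quotient.mk P (act (R := R) (d n) a)
          map_one' := by
            ext n
            -- The power series `∑ ε(d n) X ^ n` is a nonzero idempotent, hence is `1`.
            have h2 : ∀ n, counit (R := R) (d n) = if n = 0 then 1 else 0 := by
              have h3 : (PowerSeries.mk fun n => counit (R := R) (d n)) = 1 := by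
                have h4 : (PowerSeries.mk fun n => counit (R := R) (d n)) *
                    (PowerSeries.mk fun n => counit (R := R) (d n)) =
                    (PowerSeries.mk fun n => counit (R := R) (d n)) * 1 := by
                  ext n
                  rw [PowerSeries.coeff_mul, mul_one, PowerSeries.coeff_mk]
                  have h5 := rTensor_counit_comul (R := R) (d n)
                  rw [hd.2, ← Finset.Nat.sum_antidiagonal_eq_sum_range_succ
                    (fun a b => d a ⊗ₜ[R] d b)] at h5
                  have h6 := congrArg (fun t => counit (R := R) (TensorProduct.lid R D t)) h5
                  simpa using h6
                refine mul_left_cancel₀ (fun h0 => ?_) h4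
                have := congrArg (PowerSeries.coeff 0) h0
                simp [hd.1] at this
              intro n
              rw [← PowerSeries.coeff_mk n (fun n => counit (R := R) (d n)), h3,
                PowerSeries.coeff_one]
            rw [PowerSeries.coeff_mk, act_one, h2, PowerSeries.coeff_one]
            split_ifs <;> simp
          map_mul' := fun a b => by
            ext n
            rw [PowerSeries.coeff_mul, PowerSeries.coeff_mk, act_mul, hd.2,
              ← Finset.Nat.sum_antidiagonal_eq_sum_range_succ (fun a b => d a ⊗ₜ[R] d b)]
            simp
          map_zero' := by ext n; simp
          map_add' := fun a b => by ext n; simp }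
      have h0 : φ a = 0 := by
        obtain ⟨m, hm⟩ := mem_nilradical.1 ha
        have : φ a ^ m = 0 := by rw [← map_pow, hm, map_zero]
        exact eq_zero_of_pow_eq_zero this
      have h1 : PowerSeries.coeff n
          (PowerSeries.mk fun n => Ideal.Quotient.mk P (act (R := R) (d n) a)) =
          PowerSeries.coeff n 0 := congrArg (PowerSeries.coeff n) h0
      rw [PowerSeries.coeff_mk, map_zero] at h1
      exact Ideal.Quotient.eq_zero_iff_mem.1 h1
  have : d ∈ idealStabilizer (R := R) L D (nilradical L) := by rw [htop]; trivial
  exact this a ha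

variable {L} in
/-- Simple module algebras over a pointed cocommutative Hopf algebra of Birkhoff-Witt type are
reduced. -/
lemma IsSimple.isReduced (hp : IsPointedCoalgebra R D) (hBW : IsBirkhoffWittType R D)
    (hL : IsSimple R D L) : IsReduced L := by
  have := hL.1
  rcases hL.2 (nilradical L) (act_mem_nilradical L hp hBW) with h | h
  · exact nilradical_eq_bot_iff.1 h
  · exfalso
    have : (1 : L) ∈ nilradical L := by rw [h]; trivial
    exact not_isNilpotent_one (mem_nilradical.1 this)

end Reduced

end ModuleAlgebra

/-! ### Linear independence of constants -/

namespace ModuleAlgebra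
open Coalgebra TensorProduct

section Independence

variable {R D B T k Y Q : Type*} [CommRing R] [Ring D] [Bialgebra R D]
  [CommRing B] [Algebra R B] [ModuleAlgebra R D B]
  [CommRing T] [Algebra R T] [ModuleAlgebra R D T]

lemma act_of_mem_constants {t : T} (ht : t ∈ constants R D T) (d : D) :
    act (R := R) d t = counit (R := R) d • t := ht d

/-- The action is linear over the constants. -/
lemma act_mul_of_mem_constants {v : T} (hv : v ∈ constants R D T) (d : D) (a : T) :
    act (R := R) d (a * v) = act (R := R) d a * v := by
  rw [act_mul_repr R d a v (ℛ R d)]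
  simp_rw [act_of_mem_constants hv, mul_smul_comm, ← smul_mul_assoc]
  rw [← Finset.sum_mul]
  congr 1
  have h := congrArg (fun t => act (R := R) (TensorProduct.rid R D t) a)
    (lTensor_counit_comul (R := R) d)
  rw [← (ℛ R d).eq] at h
  simp only [map_sum, LinearMap.lTensor_tmul, TensorProduct.rid_tmul, map_smul,
    LinearMap.sum_apply, LinearMap.smul_apply, one_smul] at h
  exact h

variable [Algebra B T] [IsEquivariant R D B T]

/-- Constants that are linearly independent over the constants of a simple module algebra `B`,
modulo the kernel of `π`, are linearly independent over `B` modulo the kernel of `π`. In the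
inductive step, the coefficients of the new element in all relations form a stable ideal. If it is
not zero, then there is a relation in which this coefficient is `1`; applying `d - ε(d)` to it gives
a shorter relation, which is trivial, so all coefficients are constant. -/
lemma linearIndependent_of_mem_constants [AddCommGroup Q] [Module B Q] (hB : IsSimple R D B)
    (π : T →ₗ[B] Q) (hπ : ∀ (d : D) (t : T), π t = 0 → π (act (R := R) d t) = 0) {ι : Type*}
    (v : ι → T) (hv : ∀ i, v i ∈ constants R D T)
    (h : ∀ (s : Finset ι) (c : ι → B), (∀ i, c i ∈ constants R D B) →
      ∑ i ∈ s, c i • π (v i) = 0 → ∀ i ∈ s, c i = 0) :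
    LinearIndependent B fun i => π (v i) := by
  classical
  have hact : ∀ (s : Finset ι) (b : ι → B) (d : D), ∑ i ∈ s, b i • π (v i) = 0 →
      ∑ i ∈ s, act (R := R) d (b i) • π (v i) = 0 := by
    intro s b d hs
    have h1 : π (∑ i ∈ s, b i • v i) = 0 := by rw [map_sum, ← hs]; simp
    have h2 := hπ d _ h1
    rw [map_sum, map_sum] at h2
    rw [← h2]
    refine Finset.sum_congr rfl fun i _ => ?_
    rw [Algebra.smul_def, act_mul_of_mem_constants (hv i), IsEquivariant.act_algebraMap,
      ← Algebra.smul_def, map_smul]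
  have hnt := hB.1
  have main : ∀ (s : Finset ι) (b : ι → B), ∑ i ∈ s, b i • π (v i) = 0 → ∀ i ∈ s, b i = 0 := by
    intro s
    induction s using Finset.induction_on with
    | empty => simp
    | insert j s hj ih =>
      intro b hb
      let I : Ideal B :=
        { carrier := {x | ∃ b : ι → B, b j = x ∧ ∑ i ∈ insert j s, b i • π (v i) = 0}
          add_mem' := by
            rintro _ _ ⟨b, rfl, hb⟩ ⟨b', rfl, hb'⟩
            refine ⟨b + b', rfl, ?_⟩
            simp only [Pi.add_apply, add_smul, Finset.sum_add_distrib, hb, hb', add_zero]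
          zero_mem' := ⟨0, rfl, by simp⟩
          smul_mem' := by
            rintro c _ ⟨b, rfl, hb⟩
            refine ⟨c • b, rfl, ?_⟩
            simp only [Pi.smul_apply, smul_assoc, ← Finset.smul_sum, hb, smul_zero] }
      have hI : ∀ (d : D), ∀ a ∈ I, act (R := R) d a ∈ I := by
        rintro d _ ⟨b, rfl, hb⟩
        exact ⟨fun i => act (R := R) d (b i), rfl, hact _ _ d hb⟩
      rcases hB.2 I hI with hbot | htop
      · have hbj : b j = 0 := by
          have : b j ∈ I := ⟨b, rfl, hb⟩
          rwa [hbot, Ideal.mem_bot] at this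
        rw [Finset.sum_insert hj, hbj, zero_smul, zero_add] at hb
        intro i hi
        rcases Finset.mem_insert.1 hi with rfl | hi
        · exact hbj
        · exact ih b hb i hi
      · exfalso
        obtain ⟨b', hb'j, hb'⟩ : (1 : B) ∈ I := by rw [htop]; trivial
        have hconst : ∀ i ∈ insert j s, b' i ∈ constants R D B := by
          intro i hi d
          have h3 : ∑ i ∈ insert j s, (act (R := R) d (b' i) - counit (R := R) d • b' i) •
              π (v i) = 0 := by
            have h4 : ∑ i ∈ insert j s, (counit (R := R) d • b' i) • π (v i) = 0 := by
              have := congrArg (fun x => algebraMap R B (counit (R := R) d) • x) hb'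
              simpa [Finset.smul_sum, smul_smul, Algebra.smul_def] using this
            simp only [sub_smul, Finset.sum_sub_distrib, hact _ _ d hb', h4, sub_zero]
          have h5 : act (R := R) d (b' j) - counit (R := R) d • b' j = 0 := by
            rw [hb'j, act_one, Algebra.smul_def, mul_one, sub_self]
          rw [Finset.sum_insert hj, h5, zero_smul, zero_add] at h3
          rcases Finset.mem_insert.1 hi with rfl | hi
          · exact sub_eq_zero.1 h5
          · exact sub_eq_zero.1 (ih _ h3 i hi)
        have h6 := h (insert j s) (fun i => if i ∈ insert j s then b' i else 0)
          (fun i => by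
            split_ifs with hi
            · exact hconst i hi
            · exact (constants R D B).zero_mem)
          (by
            rw [← hb']
            exact Finset.sum_congr rfl fun i hi => by rw [if_pos hi])
          j (Finset.mem_insert_self _ _)
        rw [if_pos (Finset.mem_insert_self _ _), hb'j] at h6
        exact one_ne_zero h6
  rw [linearIndependent_iff']
  exact main

variable [CommRing k] [Algebra k B] [AddCommGroup Y] [Module k Y]

section Quotient
variable [AddCommGroup Q] [Module B Q] [Module k Q] [IsScalarTower k B Q]

lemma linearIndependent_comp_basis (hB : IsSimple R D B)
    (hk : ∀ b ∈ constants R D B, ∃ c, algebraMap k B c = b)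
    (π : T →ₗ[B] Q) (hπ : ∀ (d : D) (t : T), π t = 0 → π (act (R := R) d t) = 0)
    (j : Y →ₗ[k] Q) (hj : Function.Injective j)
    (hc : ∀ y, ∃ t ∈ constants R D T, π t = j y) {ι : Type*} (y : Module.Basis ι k Y) :
    LinearIndependent B fun i => j (y i) := by
  choose v hv hvj using fun i => hc (y i)
  have h := linearIndependent_of_mem_constants hB π hπ v hv (fun s c hcc hs => by
    choose a ha using fun i => hk (c i) (hcc i)
    have h1 : j (∑ i ∈ s, a i • y i) = 0 := by
      rw [map_sum, ← hs]
      refine Finset.sum_congr rfl fun i _ => ?_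
      rw [map_smul, ← hvj, ← ha, algebraMap_smul]
    rw [← map_zero j] at h1
    have h2 := linearIndependent_iff'.1 y.linearIndependent s a (hj h1)
    intro i hi
    rw [← ha, h2 i hi, map_zero])
  simpa only [hvj] using h

/-- The extension of scalars to `B` of a space `Y` of constants of a quotient of `T` embeds into
that quotient. -/
lemma injective_liftBaseChange [Module.Free k Y] (hB : IsSimple R D B)
    (hk : ∀ b ∈ constants R D B, ∃ c, algebraMap k B c = b)
    (π : T →ₗ[B] Q) (hπ : ∀ (d : D) (t : T), π t = 0 → π (act (R := R) d t) = 0)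
    (j : Y →ₗ[k] Q) (hj : Function.Injective j)
    (hc : ∀ y, ∃ t ∈ constants R D T, π t = j y) :
    Function.Injective (j.liftBaseChange B) := by
  let y := Module.Free.chooseBasis k Y
  have hlin := linearIndependent_comp_basis hB hk π hπ j hj hc y
  rw [← LinearMap.ker_eq_bot, LinearMap.ker_eq_bot']
  intro z hz
  let yB := y.baseChange B
  have h1 : Finsupp.linearCombination B (fun i => j (y i)) (yB.repr z) = 0 := by
    rw [← hz]
    conv_rhs => rw [← yB.linearCombination_repr z]
    rw [Finsupp.linearCombination_apply, Finsupp.linearCombination_apply, map_finsuppSum]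
    refine Finsupp.sum_congr fun i _ => ?_
    rw [map_smul, Module.Basis.baseChange_apply, LinearMap.liftBaseChange_tmul, one_smul]
  have h2 := linearIndependent_iff.1 hlin _ h1
  exact yB.repr.injective (by rw [h2, map_zero])

end Quotient

variable [Module k T] [IsScalarTower k B T]

/-- If a space of constants generates `T` over a simple module algebra `B` without new constants,
then it is the space of all constants of `T`. -/
lemma exists_eq_of_mem_constants [Module.Free k Y] (hB : IsSimple R D B)
    (hk : ∀ b ∈ constants R D B, ∃ c, algebraMap k B c = b)
    (j : Y →ₗ[k] T) (hj : Function.Injective j) (hc : ∀ y, j y ∈ constants R D T)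
    (hs : Function.Surjective (j.liftBaseChange B)) {t : T} (ht : t ∈ constants R D T) :
    ∃ y, j y = t := by
  let y := Module.Free.chooseBasis k Y
  have hlin := linearIndependent_comp_basis hB hk LinearMap.id (fun d t (ht : t = 0) => by
    rw [ht, map_zero, map_zero]) j hj (fun y => ⟨_, hc y, rfl⟩) y
  obtain ⟨z, rfl⟩ := hs t
  let yB := y.baseChange B
  have h1 : j.liftBaseChange B z = (yB.repr z).sum fun i b => b • j (y i) := by
    conv_lhs => rw [← yB.linearCombination_repr z]
    rw [Finsupp.linearCombination_apply, map_finsuppSum]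
    refine Finsupp.sum_congr fun i _ => ?_
    rw [map_smul, Module.Basis.baseChange_apply, LinearMap.liftBaseChange_tmul, one_smul]
  have h2 : ∀ i ∈ (yB.repr z).support, yB.repr z i ∈ constants R D B := by
    intro i hi d
    have h3 := act_of_mem_constants ht d
    rw [h1, Finsupp.sum, map_sum, Finset.smul_sum, ← sub_eq_zero, ← Finset.sum_sub_distrib] at h3
    have h4 : ∑ i ∈ (yB.repr z).support, (act (R := R) d (yB.repr z i) -
        counit (R := R) d • yB.repr z i) • j (y i) = 0 := by
      rw [← h3]
      refine Finset.sum_congr rfl fun i _ => ?_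
      rw [sub_smul, Algebra.smul_def (yB.repr z i), act_mul_of_mem_constants (hc _),
        IsEquivariant.act_algebraMap, ← Algebra.smul_def]
      congr 1
      have h5 : algebraMap B T (algebraMap R B (counit (R := R) d)) =
          algebraMap R T (counit (R := R) d) := by
        rw [← act_one (R := R) (A := B) d, ← IsEquivariant.act_algebraMap, map_one, act_one]
      rw [Algebra.smul_def, Algebra.smul_def (counit (R := R) d), Algebra.smul_def, map_mul, h5,
        mul_assoc]
    exact sub_eq_zero.1 (linearIndependent_iff'.1 hlin _ _ h4 i hi)
  have h3 : ∀ i, ∃ c : k, i ∈ (yB.repr z).support → algebraMap k B c = yB.repr z i := by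
    intro i
    by_cases hi : i ∈ (yB.repr z).support
    · obtain ⟨c, hc⟩ := hk _ (h2 i hi)
      exact ⟨c, fun _ => hc⟩
    · exact ⟨0, fun h => absurd h hi⟩
  choose c hc using h3
  refine ⟨∑ i ∈ (yB.repr z).support, c i • y i, ?_⟩
  rw [h1, Finsupp.sum, map_sum]
  refine Finset.sum_congr rfl fun i hi => ?_
  rw [map_smul, ← hc i hi, algebraMap_smul]

/-- If a space of constants generates `T` over a simple module algebra `B`, then every stable ideal
of `T` is generated by the constants it contains: `B ⊗ (Y ⧸ Z)` embeds into `T ⧸ J`, where `Z` is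
the space of the elements of `Y` that lie in `J`. -/
lemma mem_span_of_stable (hB : IsSimple R D B)
    (hk : ∀ b ∈ constants R D B, ∃ c, algebraMap k B c = b)
    (hfree : ∀ (Z : Submodule k Y), Module.Free k (Y ⧸ Z))
    (j : Y →ₗ[k] T) (hc : ∀ y, j y ∈ constants R D T)
    (hs : Function.Surjective (j.liftBaseChange B)) (J : Ideal T)
    (hJ : ∀ (d : D), ∀ t ∈ J, act (R := R) d t ∈ J) {t : T} (ht : t ∈ J) :
    t ∈ Submodule.span B {x | ∃ y, j y = x ∧ x ∈ J} := by
  let π : T →ₗ[B] T ⧸ J.restrictScalars B := (J.restrictScalars B).mkQ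
  have hπ0 : ∀ t, π t = 0 ↔ t ∈ J := fun t => Submodule.Quotient.mk_eq_zero _
  let πj : Y →ₗ[k] T ⧸ J.restrictScalars B := (π.restrictScalars k) ∘ₗ j
  let Z := LinearMap.ker πj
  have := hfree Z
  let j' : (Y ⧸ Z) →ₗ[k] T ⧸ J.restrictScalars B := Z.liftQ πj le_rfl
  have hinj : Function.Injective (j'.liftBaseChange B) := by
    refine injective_liftBaseChange hB hk π (fun d t ht => (hπ0 _).2 (hJ d t ((hπ0 t).1 ht))) j'
      ?_ ?_
    · rw [← LinearMap.ker_eq_bot]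
      exact Submodule.ker_liftQ_eq_bot' _ _ rfl
    · intro y
      obtain ⟨y, rfl⟩ := Submodule.mkQ_surjective _ y
      exact ⟨j y, hc y, rfl⟩
  obtain ⟨z, rfl⟩ := hs t
  have hcomp : ∀ z, j'.liftBaseChange B (Z.mkQ.baseChange B z) = π (j.liftBaseChange B z) := by
    intro z
    induction z using TensorProduct.induction_on with
    | zero => simp
    | add x y hx hy => simp only [map_add, hx, hy]
    | tmul b y =>
      rw [LinearMap.baseChange_tmul, LinearMap.liftBaseChange_tmul, LinearMap.liftBaseChange_tmul,
        map_smul]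
      rfl
  have hz : Z.mkQ.baseChange B z = 0 := by
    apply hinj
    rw [map_zero, hcomp, hπ0]
    exact ht
  have hex : Function.Exact (Z.subtype.lTensor B) (Z.mkQ.lTensor B) :=
    lTensor_exact B (LinearMap.exact_subtype_mkQ Z) Z.mkQ_surjective
  obtain ⟨w, rfl⟩ := (hex z).1 hz
  clear hz ht
  induction w using TensorProduct.induction_on with
  | zero => simp
  | add x y hx hy => simp only [map_add]; exact Submodule.add_mem _ hx hy
  | tmul b y =>
    rw [LinearMap.lTensor_tmul, LinearMap.liftBaseChange_tmul]
    refine Submodule.smul_mem _ _ (Submodule.subset_span ⟨_, rfl, ?_⟩)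
    exact (hπ0 _).1 y.2

end Independence

end ModuleAlgebra

/-! ### Equivariant maps -/

namespace ModuleAlgebra
open Coalgebra TensorProduct

section Equivariance

/-- Compatibility of a map between module algebras with the actions. -/
def IsEquivariantMap (R D : Type*) {B C : Type*} [CommRing R] [Ring D] [Bialgebra R D]
    [CommRing B] [Algebra R B] [ModuleAlgebra R D B]
    [CommRing C] [Algebra R C] [ModuleAlgebra R D C] (f : B → C) : Prop :=
  ∀ (d : D) (b : B), f (act (R := R) d b) = act (R := R) d (f b)

variable {R D K B C E F : Type*} [CommRing R] [Ring D] [Bialgebra R D]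
  [CommRing K] [Algebra R K] [ModuleAlgebra R D K]
  [CommRing B] [Algebra R B] [ModuleAlgebra R D B] [Algebra K B] [IsScalarTower R K B]
  [IsEquivariant R D K B]
  [CommRing C] [Algebra R C] [ModuleAlgebra R D C] [Algebra K C] [IsScalarTower R K C]
  [IsEquivariant R D K C]
  [CommRing E] [Algebra R E] [ModuleAlgebra R D E] [Algebra K E] [IsScalarTower R K E]
  [IsEquivariant R D K E]
  [CommRing F] [Algebra R F] [ModuleAlgebra R D F] [Algebra K F] [IsScalarTower R K F]
  [IsEquivariant R D K F]

lemma IsEquivariantMap.mem_constants {f : B →ₐ[K] C} (hf : IsEquivariantMap R D f) {b : B}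
    (hb : b ∈ constants R D B) : f b ∈ constants R D C := fun d => by
  rw [← hf d b, hb d]
  exact map_smul (f.restrictScalars R) _ _

lemma sum_counit_smul_act (d : D) (a : B) {ι : Type*} (r : Coalgebra.Repr R d ι) :
    ∑ i ∈ r.index, counit (R := R) (r.left i) • act (R := R) (r.right i) a =
      act (R := R) d a := by
  have h := congrArg (fun t => act (R := R) t a) (sum_counit_smul r)
  simpa using h

variable [IsCocomm R D]

lemma act_tmul (b : B) (c : C) (d : D) {ι : Type*} (r : Coalgebra.Repr R d ι) :
    act (R := R) d (b ⊗ₜ[K] c) = ∑ i ∈ r.index,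
      act (R := R) (r.left i) b ⊗ₜ[K] act (R := R) (r.right i) c :=
  tensorAct_tmul R D K B C b c d r

lemma act_one_tmul (c : C) (d : D) :
    act (R := R) d ((1 : B) ⊗ₜ[K] c) = 1 ⊗ₜ[K] act (R := R) d c := by
  rw [act_tmul _ _ _ (ℛ R d), ← sum_counit_smul_act d c (ℛ R d), TensorProduct.tmul_sum]
  refine Finset.sum_congr rfl fun i _ => ?_
  rw [act_one, Algebra.algebraMap_eq_smul_one, TensorProduct.smul_tmul]

/-- The twist is equivariant because the coalgebra is cocommutative. -/
lemma act_comm (t : B ⊗[K] C) (d : D) :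
    act (R := R) d (Algebra.TensorProduct.comm K B C t) =
      Algebra.TensorProduct.comm K B C (act (R := R) d t) := by
  induction t using TensorProduct.induction_on with
  | zero => simp
  | add x y hx hy => simp only [map_add, hx, hy]
  | tmul b c =>
    change act (R := R) d (c ⊗ₜ[K] b) = _
    have h1 : act (R := R) d (c ⊗ₜ[K] b) = tensorEval R D K C B c b (comul d) :=
      tensorAct_tmul' R D K C B c b d
    rw [h1, act_tmul _ _ _ (ℛ R d), ← comm_comul, ← (ℛ R d).eq]
    simp [tensorEval_tmul]

lemma act_tmul_one (b : B) (d : D) :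
    act (R := R) d (b ⊗ₜ[K] (1 : C)) = act (R := R) d b ⊗ₜ[K] 1 := by
  have h := act_comm (R := R) ((1 : C) ⊗ₜ[K] b) d
  rw [act_one_tmul] at h
  exact h

instance : IsEquivariant R D B (B ⊗[K] C) where
  act_algebraMap d b := act_tmul_one b d

lemma isEquivariantMap_comm : IsEquivariantMap R D (Algebra.TensorProduct.comm K B C) :=
  fun d t => (act_comm t d).symm

lemma isEquivariantMap_includeRight :
    IsEquivariantMap R D (Algebra.TensorProduct.includeRight : C →ₐ[K] B ⊗[K] C) :=
  fun d c => (act_one_tmul c d).symm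

lemma isEquivariantMap_includeLeft :
    IsEquivariantMap R D (Algebra.TensorProduct.includeLeft : B →ₐ[K] B ⊗[K] C) :=
  fun d b => (act_tmul_one b d).symm

/-- Additive maps out of a tensor product can be checked for equivariance on pure tensors. -/
lemma isEquivariantMap_of_tmul {G : Type*} [CommRing G] [Algebra R G] [ModuleAlgebra R D G]
    (f : B ⊗[K] C →+ G)
    (h : ∀ (b : B) (c : C) (d : D), f (act (R := R) d (b ⊗ₜ c)) = act (R := R) d (f (b ⊗ₜ c))) :
    IsEquivariantMap R D f := fun d t => by
  induction t using TensorProduct.induction_on with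
  | zero => simp
  | add x y hx hy => simp only [map_add, hx, hy]
  | tmul b c => exact h b c d

lemma isEquivariantMap_lmul' :
    IsEquivariantMap R D (Algebra.TensorProduct.lmul' K : B ⊗[K] B →ₐ[K] B) :=
  isEquivariantMap_of_tmul (R := R) (D := D)
    (Algebra.TensorProduct.lmul' K : B ⊗[K] B →ₐ[K] B).toRingHom.toAddMonoidHom
    fun b c d => by
      have h1 := act_tmul (K := K) b c d (ℛ R d)
      have h2 := act_mul_repr R d b c (ℛ R d)
      rw [h1]
      simp [h2]

lemma isEquivariantMap_map {f : B →ₐ[K] E} {g : C →ₐ[K] F} (hf : IsEquivariantMap R D f)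
    (hg : IsEquivariantMap R D g) :
    IsEquivariantMap R D (Algebra.TensorProduct.map f g : B ⊗[K] C →ₐ[K] E ⊗[K] F) :=
  isEquivariantMap_of_tmul (R := R) (D := D)
    (Algebra.TensorProduct.map f g : B ⊗[K] C →ₐ[K] E ⊗[K] F).toRingHom.toAddMonoidHom
    fun b c d => by
      have h1 := act_tmul (K := K) b c d (ℛ R d)
      have h2 := act_tmul (K := K) (f b) (g c) d (ℛ R d)
      rw [h1]
      simp [h2, ← hf _ _, ← hg _ _]

end Equivariance

section Intermediate

variable {R D K L : Type*} [CommRing R] [Ring D] [Bialgebra R D]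
  [CommRing K] [Algebra R K] [ModuleAlgebra R D K]
  [CommRing L] [Algebra R L] [ModuleAlgebra R D L] [Algebra K L] [IsScalarTower R K L]

lemma isEquivariantMap_val (A : IntermediateModuleAlgebra R D K L) :
    IsEquivariantMap R D A.val := fun _ _ => rfl

instance (M : IntermediateModuleAlgebra R D K L) : IsEquivariant R D M.toSubalgebra L where
  act_algebraMap _ _ := rfl

lemma isEquivariantMap_mapOfCompatibleSMul [IsCocomm R D] [IsEquivariant R D K L]
    (M : IntermediateModuleAlgebra R D K L) :
    IsEquivariantMap R D (Algebra.TensorProduct.mapOfCompatibleSMul M.toSubalgebra K K L L) :=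
  isEquivariantMap_of_tmul (R := R) (D := D)
    (Algebra.TensorProduct.mapOfCompatibleSMul M.toSubalgebra K K L L).toRingHom.toAddMonoidHom
    fun b c d => by
      have h1 := act_tmul (K := K) b c d (ℛ R d)
      have h2 := act_tmul (K := M.toSubalgebra) b c d (ℛ R d)
      rw [h1]
      simp [h2]

end Intermediate

end ModuleAlgebra

/-! ### The principal algebra is simple -/

namespace ModuleAlgebra
open Coalgebra TensorProduct

section General

variable {R D T : Type*} [CommRing R] [Ring D] [Bialgebra R D]
  [CommRing T] [Algebra R T] [ModuleAlgebra R D T]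

lemma act_mul_mem {I : Ideal T} {x : T} (hx : ∀ d : D, act (R := R) d x ∈ I) (d : D) (a : T) :
    act (R := R) d (a * x) ∈ I := by
  rw [act_mul_repr R d a x (ℛ R d)]
  exact I.sum_mem fun i _ => I.mul_mem_left _ (hx _)

/-- An ideal generated by a stable set is stable. -/
lemma act_mem_span {s : Set T} (hs : ∀ (d : D), ∀ x ∈ s, act (R := R) d x ∈ Ideal.span s) (d : D)
    {x : T} (hx : x ∈ Ideal.span s) : act (R := R) d x ∈ Ideal.span s := by
  induction hx using Submodule.span_induction generalizing d with
  | mem x hx => exact hs d x hx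
  | zero => simp
  | add x y _ _ hx hy => rw [map_add]; exact Ideal.add_mem _ (hx d) (hy d)
  | smul a x _ hx => exact act_mul_mem hx d a

/-- An ideal generated by constants is stable. -/
lemma act_mem_span_of_constants {s : Set T} (hs : s ⊆ constants R D T) (d : D)
    {x : T} (hx : x ∈ Ideal.span s) : act (R := R) d x ∈ Ideal.span s :=
  act_mem_span (fun d x hx => by
    rw [act_of_mem_constants (hs hx), Algebra.smul_def]
    exact Ideal.mul_mem_left _ _ (Ideal.subset_span hx)) d hx

/-- The constants of a simple module algebra form a field: a nonzero constant generates a stable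
ideal, and its inverse is constant. -/
lemma IsSimple.isField_constants (hT : IsSimple R D T) : IsField (constants R D T) := by
  have := hT.1
  refine ⟨⟨0, 1, zero_ne_one⟩, mul_comm, fun {a} ha => ?_⟩
  have ha' : (a : T) ≠ 0 := fun h => ha (Subtype.ext h)
  rcases hT.2 (Ideal.span {(a : T)}) (fun d x hx =>
    act_mem_span_of_constants (by rintro _ rfl; exact a.2) d hx) with h | h
  · exact absurd (Ideal.span_singleton_eq_bot.1 h) ha'
  · obtain ⟨b, hb⟩ := (Ideal.span_singleton_eq_top.1 h).exists_left_inv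
    have hb' : b ∈ constants R D T := fun d => by
      have h1 : act (R := R) d b * a = (counit (R := R) d • b) * a := by
        rw [← act_mul_of_mem_constants a.2, smul_mul_assoc, hb, act_one, Algebra.smul_def, mul_one]
      have h2 := congrArg (· * b) h1
      simpa [mul_assoc, mul_comm (a : T) b, hb] using h2
    exact ⟨⟨b, hb'⟩, Subtype.ext (by rw [mul_comm]; exact hb)⟩

lemma _root_.IsField.free {k : Type*} [CommRing k] (hk : IsField k) (Y : Type*) [AddCommGroup Y]
    [Module k Y] : Module.Free k Y := by
  let _ := hk.toField
  infer_instance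

end General

section PrincipalAlgebra

variable {R D K A L : Type*} [CommRing R] [Ring D] [Bialgebra R D] [IsCocomm R D]
  [CommRing K] [Algebra R K] [ModuleAlgebra R D K]
  [CommRing A] [Algebra R A] [ModuleAlgebra R D A] [Algebra K A] [IsScalarTower R K A]
  [IsEquivariant R D K A]
  [CommRing L] [Algebra R L] [ModuleAlgebra R D L] [Algebra K L] [IsScalarTower R K L]
  [IsEquivariant R D K L]

lemma PVAlgebra_incl_injective : Function.Injective (PVAlgebra.incl R D K A) :=
  Subtype.val_injective

lemma PVAlgebra_incl_mem_constants (h : PVAlgebra R D K A) :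
    PVAlgebra.incl R D K A h ∈ constants R D (A ⊗[K] A) := h.2

lemma exists_incl_eq {t : A ⊗[K] A} (ht : t ∈ constants R D (A ⊗[K] A)) :
    ∃ h, PVAlgebra.incl R D K A h = t := ⟨⟨t, ht⟩, rfl⟩

variable (A L) in
/-- The map `H ⊆ A ⊗_K A → L ⊗_K A`. -/
def inclLeft (f : A →ₐ[K] L) : PVAlgebra R D K A →ₐ[constants R D K] L ⊗[K] A :=
  ((Algebra.TensorProduct.map f (AlgHom.id K A)).restrictScalars (constants R D K)).comp
    (PVAlgebra.incl R D K A)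

lemma inclLeft_apply (f : A →ₐ[K] L) (h : PVAlgebra R D K A) :
    inclLeft A L f h = Algebra.TensorProduct.map f (AlgHom.id K A) (PVAlgebra.incl R D K A h) :=
  rfl

lemma inclLeft_mem_constants {f : A →ₐ[K] L} (hf : IsEquivariantMap R D f)
    (h : PVAlgebra R D K A) : inclLeft A L f h ∈ constants R D (L ⊗[K] A) :=
  IsEquivariantMap.mem_constants (isEquivariantMap_map hf fun _ _ => rfl)
    (PVAlgebra_incl_mem_constants h)

/-- If `H` generates `A ⊗_K A` over `A`, then it generates `L ⊗_K A` over `L`. -/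
lemma surjective_liftBaseChange_inclLeft (f : A →ₐ[K] L)
    (hspan : Submodule.span A (tensorConstants R D K A : Set (A ⊗[K] A)) = ⊤) :
    Function.Surjective ((inclLeft (R := R) (D := D) A L f).toLinearMap.liftBaseChange L) := by
  rw [← LinearMap.range_eq_top, LinearMap.range_liftBaseChange, eq_top_iff]
  set S := Submodule.span L (LinearMap.range (inclLeft (R := R) (D := D) A L f).toLinearMap :
    Set (L ⊗[K] A)) with hS
  have h1 : ∀ t : A ⊗[K] A, Algebra.TensorProduct.map f (AlgHom.id K A) t ∈ S := by
    intro t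
    have ht : t ∈ Submodule.span A (tensorConstants R D K A : Set (A ⊗[K] A)) := by
      rw [hspan]; trivial
    induction ht using Submodule.span_induction with
    | mem x hx => exact Submodule.subset_span ⟨⟨x, hx⟩, rfl⟩
    | zero => simp
    | add x y _ _ hx hy => rw [map_add]; exact S.add_mem hx hy
    | smul a x _ hx =>
      have : Algebra.TensorProduct.map f (AlgHom.id K A) (a • x) =
          f a • Algebra.TensorProduct.map f (AlgHom.id K A) x := by
        rw [Algebra.smul_def, map_mul, Algebra.smul_def]
        simp [Algebra.TensorProduct.algebraMap_apply]
      rw [this]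
      exact S.smul_mem _ hx
  intro t _
  induction t using TensorProduct.induction_on with
  | zero => simp
  | add x y hx hy => exact S.add_mem (hx trivial) (hy trivial)
  | tmul l a =>
    have := S.smul_mem l (h1 (1 ⊗ₜ a))
    simpa [TensorProduct.smul_tmul'] using this

lemma ker_map_mkₐ {B : Type*} [CommRing B] [Algebra K B] (I : Ideal A) :
    RingHom.ker (Algebra.TensorProduct.map (AlgHom.id K B) (Ideal.Quotient.mkₐ K I)) =
      I.map (Algebra.TensorProduct.includeRight : A →ₐ[K] B ⊗[K] A) := by
  rw [Algebra.TensorProduct.lTensor_ker _ (Ideal.Quotient.mkₐ_surjective K I)]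
  congr 1
  exact Ideal.Quotient.mkₐ_ker K I

/-- The principal algebra is simple. A nonzero stable ideal `I` extends to the unit ideal of `L`, so
the stable ideal `L ⊗ I` of `L ⊗ A`, which is generated by elements of `H`, contains an `h ∈ H` with
`ε(h) ≠ 0`; by flatness over `K`, this `h` lies in `A ⊗ I`, whence `ε(h) ∈ I`. -/
lemma isSimple_of_span_eq_top (hK : ∀ I : Ideal A, Module.Flat K (A ⧸ I))
    (hL : IsSimple R D L) (hkf : IsField (constants R D K)) [Nontrivial A]
    (hkL : ∀ b ∈ constants R D L, ∃ c : constants R D K, algebraMap _ L c = b)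
    (f : A →ₐ[K] L) (hf : IsEquivariantMap R D f) (hinj : Function.Injective f)
    (hspan : Submodule.span A (tensorConstants R D K A : Set (A ⊗[K] A)) = ⊤) :
    IsSimple R D A := by
  refine ⟨inferInstance, fun I hI => ?_⟩
  by_cases hbot : I = ⊥
  · exact Or.inl hbot
  right
  let J : Ideal (L ⊗[K] A) :=
    I.map (Algebra.TensorProduct.includeRight : A →ₐ[K] L ⊗[K] A)
  have hJ : ∀ (d : D), ∀ t ∈ J, act (R := R) d t ∈ J := by
    intro d t ht
    refine act_mem_span ?_ d ht
    rintro d _ ⟨a, ha, rfl⟩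
    have := isEquivariantMap_includeRight (R := R) (K := K) (B := L) d a
    erw [← this]
    exact Ideal.subset_span ⟨_, hI d a ha, rfl⟩
  -- `μ (l ⊗ a) = l * f a`, so on elements of `H` the map `μ` is the counit followed by `f`.
  let μ : L ⊗[K] A →ₐ[L] L := Algebra.TensorProduct.lift (Algebra.ofId L L) f
    fun _ _ => Commute.all _ _
  have hμ : ∀ l a, μ (l ⊗ₜ a) = l * f a := fun l a => by simp [μ]
  have hμh : ∀ h : PVAlgebra R D K A, μ (inclLeft A L f h) =
      f (Algebra.TensorProduct.lmul' K (PVAlgebra.incl R D K A h)) := by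
    intro h
    rw [inclLeft_apply]
    induction PVAlgebra.incl R D K A h using TensorProduct.induction_on with
    | zero => simp
    | add x y hx hy => simp only [map_add, hx, hy]
    | tmul a b => simp [hμ]
  -- Otherwise `μ` vanishes on `J`, which contains `1 ⊗ a` with `f a ≠ 0`.
  have hex : ∃ h : PVAlgebra R D K A, inclLeft A L f h ∈ J ∧ μ (inclLeft A L f h) ≠ 0 := by
    by_contra! hcon
    obtain ⟨a, ha, ha0⟩ := Submodule.exists_mem_ne_zero_of_ne_bot hbot
    have h1 : (1 : L) ⊗ₜ[K] a ∈ J := Ideal.subset_span ⟨a, ha, rfl⟩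
    have h2 := mem_span_of_stable hL hkL (fun Z => hkf.free _)
      (inclLeft (R := R) (D := D) A L f).toLinearMap (inclLeft_mem_constants hf)
      (surjective_liftBaseChange_inclLeft f hspan) J hJ h1
    have h3 : Submodule.span L {x | ∃ y, (inclLeft (R := R) (D := D) A L f).toLinearMap y = x ∧
        x ∈ J} ≤ LinearMap.ker μ.toLinearMap := by
      rw [Submodule.span_le]
      rintro _ ⟨h, rfl, hh⟩
      exact hcon h hh
    have h4 : μ (1 ⊗ₜ a) = 0 := h3 h2
    rw [hμ, one_mul] at h4
    exact ha0 (hinj (by rw [h4, map_zero]))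
  obtain ⟨h, hhJ, hh⟩ := hex
  rw [hμh] at hh
  set e := Algebra.TensorProduct.lmul' K (PVAlgebra.incl R D K A h) with he
  have heL : f e ∈ constants R D L :=
    IsEquivariantMap.mem_constants hf (IsEquivariantMap.mem_constants isEquivariantMap_lmul'
      (PVAlgebra_incl_mem_constants h))
  obtain ⟨c, hc⟩ := hkL _ heL
  have hc0 : c ≠ 0 := by rintro rfl; exact hh (by rw [← hc, map_zero])
  obtain ⟨c', hcc'⟩ := hkf.mul_inv_cancel hc0
  have hce : e = algebraMap (constants R D K) A c := hinj (by
    rw [← hc, IsScalarTower.algebraMap_apply (constants R D K) K A,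
      AlgHom.commutes, ← IsScalarTower.algebraMap_apply])
  have heI : e ∈ I := by
    let q : A →ₐ[K] A ⧸ I := Ideal.Quotient.mkₐ K I
    have h1 : PVAlgebra.incl R D K A h ∈
        I.map (Algebra.TensorProduct.includeRight : A →ₐ[K] A ⊗[K] A) := by
      rw [← ker_map_mkₐ, RingHom.mem_ker]
      have := hK I
      apply Module.Flat.rTensor_preserves_injective_linearMap (M := A ⧸ I) f.toLinearMap hinj
      rw [map_zero]
      have h2 : Algebra.TensorProduct.map (AlgHom.id K L) q (inclLeft A L f h) = 0 := by
        rw [← RingHom.mem_ker, ker_map_mkₐ]; exact hhJ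
      rw [← h2, inclLeft_apply]
      induction PVAlgebra.incl R D K A h using TensorProduct.induction_on with
      | zero => simp
      | add x y hx hy => simp only [map_add, hx, hy]
      | tmul a b => simp [q]
    have h2 : I.map (Algebra.TensorProduct.includeRight : A →ₐ[K] A ⊗[K] A) ≤
        I.comap (Algebra.TensorProduct.lmul' K : A ⊗[K] A →ₐ[K] A) := by
      rw [Ideal.map_le_iff_le_comap]
      intro a ha
      simpa [Ideal.mem_comap] using ha
    exact h2 h1
  rw [Ideal.eq_top_iff_one]
  have : (1 : A) = algebraMap (constants R D K) A c' * e := by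
    rw [hce, ← map_mul, mul_comm, hcc', map_one]
  rw [this]
  exact I.mul_mem_left _ heI

end PrincipalAlgebra
end ModuleAlgebra

/-! ### Tensor powers of the principal algebra -/

section TensorInjective
open TensorProduct

/-- If `B ⊗_k Y → X` and `Z → B ⊗_M B` are injective, then so is `Z ⊗_k Y → B ⊗_M X`: it factors
as `Z ⊗_k Y → (B ⊗_M B) ⊗_k Y = B ⊗_M (B ⊗_k Y) → B ⊗_M X`. -/
lemma Algebra.TensorProduct.injective_lift_of_flat {k M B X Y Z : Type*} [CommRing k] [CommRing M]
    [CommRing B] [CommRing X] [CommRing Y] [CommRing Z] [Algebra k M] [Algebra k B] [Algebra M B]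
    [IsScalarTower k M B] [Algebra k X] [Algebra M X] [Algebra B X] [IsScalarTower k B X]
    [IsScalarTower M B X] [IsScalarTower k M X] [Algebra k Y] [Algebra k Z] [Module.Flat k Y]
    [Module.Flat M B] (i : Z →ₐ[k] B ⊗[M] B) (hi : Function.Injective i) (j : Y →ₐ[k] X)
    (hj : Function.Injective (j.toLinearMap.liftBaseChange B)) :
    Function.Injective (Algebra.TensorProduct.lift
      (((Algebra.TensorProduct.map (AlgHom.id M B)
        (IsScalarTower.toAlgHom M B X)).restrictScalars k).comp i)
      (((Algebra.TensorProduct.includeRight : X →ₐ[M] B ⊗[M] X).restrictScalars k).comp j)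
      fun _ _ => Commute.all _ _) := by
  let f1 : Z ⊗[k] Y →ₗ[k] (B ⊗[M] B) ⊗[k] Y := i.toLinearMap.rTensor Y
  have hf1 : Function.Injective f1 :=
    Module.Flat.rTensor_preserves_injective_linearMap i.toLinearMap hi
  let f2 : (B ⊗[M] B) ⊗[k] Y ≃ₗ[M] B ⊗[M] (B ⊗[k] Y) :=
    TensorProduct.AlgebraTensorModule.assoc k M M B B Y
  let l : B ⊗[k] Y →ₗ[M] X := (j.toLinearMap.liftBaseChange B).restrictScalars M
  have hf3 : Function.Injective (l.lTensor B) :=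
    Module.Flat.lTensor_preserves_injective_linearMap l hj
  have key : ∀ (t : B ⊗[M] B) (y : Y), l.lTensor B (f2 (t ⊗ₜ y)) =
      Algebra.TensorProduct.map (AlgHom.id M B) (IsScalarTower.toAlgHom M B X) t *
        (1 ⊗ₜ[M] j y) := by
    intro t y
    induction t using TensorProduct.induction_on with
    | zero => simp
    | add a b ha hb => rw [add_tmul, map_add, map_add, ha, hb, map_add, add_mul]
    | tmul b c => simp [f2, l, Algebra.smul_def]
  have hcomp : ∀ u, Algebra.TensorProduct.lift
      (((Algebra.TensorProduct.map (AlgHom.id M B)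
        (IsScalarTower.toAlgHom M B X)).restrictScalars k).comp i)
      (((Algebra.TensorProduct.includeRight : X →ₐ[M] B ⊗[M] X).restrictScalars k).comp j)
      (fun _ _ => Commute.all _ _) u = l.lTensor B (f2 (f1 u)) := by
    intro u
    induction u using TensorProduct.induction_on with
    | zero => simp
    | add a b ha hb => simp only [map_add, ha, hb]
    | tmul z y =>
      have h1 : f1 (z ⊗ₜ y) = i z ⊗ₜ y := rfl
      rw [h1, key]
      simp
  intro u v huv
  rw [hcomp, hcomp] at huv
  exact hf1 (f2.injective (hf3 huv))

/-- An algebra map factors through an injective one that has the same values. -/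
lemma AlgHom.exists_lift_of_injective {k A B C : Type*} [CommRing k] [CommRing A] [CommRing B]
    [CommRing C] [Algebra k A] [Algebra k B] [Algebra k C] (f : B →ₐ[k] C)
    (hf : Function.Injective f) (g : A →ₐ[k] C) (h : ∀ a, ∃ b, f b = g a) :
    ∃ φ : A →ₐ[k] B, ∀ a, f (φ a) = g a := by
  let e := AlgEquiv.ofInjective f hf
  let g' : A →ₐ[k] f.range := g.codRestrict f.range fun a => h a
  refine ⟨e.symm.toAlgHom.comp g', fun a => ?_⟩
  have : e (e.symm (g' a)) = g' a := e.apply_symm_apply _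
  exact congrArg Subtype.val this

end TensorInjective

namespace ModuleAlgebra
open Coalgebra TensorProduct

section Hopf

variable {R D K A : Type*} [CommRing R] [Ring D] [Bialgebra R D] [IsCocomm R D]
  [CommRing K] [Algebra R K] [ModuleAlgebra R D K]
  [CommRing A] [Algebra R A] [ModuleAlgebra R D A] [Algebra K A] [IsScalarTower R K A]
  [IsEquivariant R D K A]

lemma pvMul₂_tmul (h h' : PVAlgebra R D K A) :
    pvMul₂ R D K A (h ⊗ₜ h') =
      Algebra.TensorProduct.map (AlgHom.id K A) Algebra.TensorProduct.includeLeft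
        (PVAlgebra.incl R D K A h) * (1 ⊗ₜ[K] PVAlgebra.incl R D K A h') := by
  simp [pvMul₂]

variable (R D K A) in
/-- The map `(a ⊗ a') ⊗ (b' ⊗ b) ⊗ (c' ⊗ c) ↦ a ⊗ a' b' ⊗ b c' ⊗ c` from `H ⊗ H ⊗ H` to the
fourth tensor power of `A`. -/
def pvMul₃ : PVAlgebra R D K A ⊗[constants R D K]
    (PVAlgebra R D K A ⊗[constants R D K] PVAlgebra R D K A) →ₐ[constants R D K]
    A ⊗[K] (A ⊗[K] (A ⊗[K] A)) :=
  let f : A ⊗[K] A →ₐ[K] A ⊗[K] (A ⊗[K] (A ⊗[K] A)) :=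
    Algebra.TensorProduct.map (AlgHom.id K A) Algebra.TensorProduct.includeLeft
  let g : A ⊗[K] (A ⊗[K] A) →ₐ[K] A ⊗[K] (A ⊗[K] (A ⊗[K] A)) :=
    Algebra.TensorProduct.includeRight
  Algebra.TensorProduct.lift ((f.restrictScalars (constants R D K)).comp (PVAlgebra.incl R D K A))
    ((g.restrictScalars (constants R D K)).comp (pvMul₂ R D K A))
    fun h u => mul_comm (f (PVAlgebra.incl R D K A h)) (g (pvMul₂ R D K A u))

lemma pvMul₃_tmul (h : PVAlgebra R D K A)
    (u : PVAlgebra R D K A ⊗[constants R D K] PVAlgebra R D K A) :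
    pvMul₃ R D K A (h ⊗ₜ u) =
      Algebra.TensorProduct.map (AlgHom.id K A)
        (Algebra.TensorProduct.includeLeft : A →ₐ[K] A ⊗[K] (A ⊗[K] A))
        (PVAlgebra.incl R D K A h) * (1 ⊗ₜ[K] pvMul₂ R D K A u) := rfl

variable (hA : IsSimple R D A) (hkf : IsField (constants R D K)) [Module.Flat K A]
  (hkA : ∀ b ∈ constants R D A, ∃ c : constants R D K, algebraMap _ A c = b)
  (hspan : Submodule.span A (tensorConstants R D K A : Set (A ⊗[K] A)) = ⊤)

include hA hkf hkA

lemma injective_liftBaseChange_incl :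
    Function.Injective ((PVAlgebra.incl R D K A).toLinearMap.liftBaseChange A) :=
  have := hkf.free (PVAlgebra R D K A)
  injective_liftBaseChange (R := R) (D := D) hA hkA (LinearMap.id : A ⊗[K] A →ₗ[A] A ⊗[K] A)
    (fun d t (ht : t = 0) => by rw [ht, map_zero, map_zero]) _ PVAlgebra_incl_injective
    fun h => ⟨_, PVAlgebra_incl_mem_constants h, rfl⟩

lemma injective_pvMul₂ : Function.Injective (pvMul₂ R D K A) :=
  have := hkf.free (PVAlgebra R D K A)
  Algebra.TensorProduct.injective_lift_of_flat (PVAlgebra.incl R D K A) PVAlgebra_incl_injective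
    (PVAlgebra.incl R D K A) (injective_liftBaseChange_incl hA hkf hkA)

omit hA hkf hkA in
lemma pvMul₂_mem_constants (u : PVAlgebra R D K A ⊗[constants R D K] PVAlgebra R D K A) :
    pvMul₂ R D K A u ∈ constants R D (A ⊗[K] (A ⊗[K] A)) := by
  induction u using TensorProduct.induction_on with
  | zero => rw [map_zero]; exact Subalgebra.zero_mem _
  | add x y hx hy => rw [map_add]; exact Subalgebra.add_mem _ hx hy
  | tmul h h' =>
    rw [pvMul₂_tmul]
    refine Subalgebra.mul_mem _ ?_ ?_
    · exact IsEquivariantMap.mem_constants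
        (isEquivariantMap_map (fun _ _ => rfl) isEquivariantMap_includeLeft)
        (PVAlgebra_incl_mem_constants h)
    · exact IsEquivariantMap.mem_constants isEquivariantMap_includeRight
        (PVAlgebra_incl_mem_constants h')

lemma injective_pvMul₃ : Function.Injective (pvMul₃ R D K A) :=
  have := hkf.free (PVAlgebra R D K A ⊗[constants R D K] PVAlgebra R D K A)
  Algebra.TensorProduct.injective_lift_of_flat (PVAlgebra.incl R D K A) PVAlgebra_incl_injective
    (pvMul₂ R D K A)
    (injective_liftBaseChange (R := R) (D := D) hA hkA
      (LinearMap.id : A ⊗[K] (A ⊗[K] A) →ₗ[A] A ⊗[K] (A ⊗[K] A))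
      (fun d t (ht : t = 0) => by rw [ht, map_zero, map_zero]) _
      (injective_pvMul₂ hA hkf hkA) fun u => ⟨_, pvMul₂_mem_constants u, rfl⟩)

omit hA hkf hkA in
include hspan in
/-- If `H` generates `A ⊗_K A` over `A`, then `H ⊗ H` generates `A ⊗_K A ⊗_K A` over `A`. -/
lemma surjective_liftBaseChange_pvMul₂ :
    Function.Surjective ((pvMul₂ R D K A).toLinearMap.liftBaseChange A) := by
  rw [← LinearMap.range_eq_top, LinearMap.range_liftBaseChange, eq_top_iff]
  set S := Submodule.span A (LinearMap.range (pvMul₂ R D K A).toLinearMap :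
    Set (A ⊗[K] (A ⊗[K] A))) with hS
  let f : A ⊗[K] A →ₐ[A] A ⊗[K] (A ⊗[K] A) :=
    Algebra.TensorProduct.map (AlgHom.id A A) Algebra.TensorProduct.includeLeft
  have h1 : ∀ (u : A ⊗[K] A) (h : PVAlgebra R D K A),
      f u * (1 ⊗ₜ[K] PVAlgebra.incl R D K A h) ∈ S := by
    intro u h
    have hu : u ∈ Submodule.span A (tensorConstants R D K A : Set (A ⊗[K] A)) := by
      rw [hspan]; trivial
    induction hu using Submodule.span_induction with
    | mem x hx => exact Submodule.subset_span ⟨(⟨x, hx⟩ : PVAlgebra R D K A) ⊗ₜ h, pvMul₂_tmul _ h⟩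
    | zero => simp
    | add x y _ _ hx hy => rw [map_add, add_mul]; exact S.add_mem hx hy
    | smul a x _ hx => rw [map_smul, smul_mul_assoc]; exact S.smul_mem _ hx
  have h2 : ∀ u t : A ⊗[K] A, f u * (1 ⊗ₜ[K] t) ∈ S := by
    intro u t
    have ht : t ∈ Submodule.span A (tensorConstants R D K A : Set (A ⊗[K] A)) := by
      rw [hspan]; trivial
    induction ht using Submodule.span_induction generalizing u with
    | mem x hx => exact h1 u ⟨x, hx⟩
    | zero => simp
    | add x y _ _ hx hy => rw [TensorProduct.tmul_add, mul_add]; exact S.add_mem (hx u) (hy u)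
    | smul a x _ hx =>
      have h3 : (1 : A) ⊗ₜ[K] (a • x) = f (1 ⊗ₜ a) * (1 ⊗ₜ[K] x) := by
        simp [f, Algebra.smul_def, Algebra.TensorProduct.algebraMap_apply]
      rw [h3, ← mul_assoc, ← map_mul]
      exact hx _
  intro t _
  induction t using TensorProduct.induction_on with
  | zero => simp
  | add x y hx hy => exact S.add_mem (hx trivial) (hy trivial)
  | tmul a t =>
    have := h2 (a ⊗ₜ 1) t
    simpa [f, ← Algebra.TensorProduct.one_def] using this

include hspan in
/-- All constants of `A ⊗_K A ⊗_K A` come from `H ⊗ H`. -/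
lemma exists_pvMul₂_eq {t : A ⊗[K] (A ⊗[K] A)}
    (ht : t ∈ constants R D (A ⊗[K] (A ⊗[K] A))) : ∃ u, pvMul₂ R D K A u = t :=
  have := hkf.free (PVAlgebra R D K A ⊗[constants R D K] PVAlgebra R D K A)
  exists_eq_of_mem_constants hA hkA (pvMul₂ R D K A).toLinearMap
    (injective_pvMul₂ hA hkf hkA) pvMul₂_mem_constants (surjective_liftBaseChange_pvMul₂ hspan) ht

end Hopf
end ModuleAlgebra

/-! ### The Hopf algebra of constants -/

namespace ModuleAlgebra
open Coalgebra TensorProduct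

section HopfStructure

variable {R D K A : Type*} [CommRing R] [Ring D] [Bialgebra R D] [IsCocomm R D]
  [CommRing K] [Algebra R K] [ModuleAlgebra R D K]
  [CommRing A] [Algebra R A] [ModuleAlgebra R D A] [Algebra K A] [IsScalarTower R K A]
  [IsEquivariant R D K A]

section Identities

variable {Δ : PVAlgebra R D K A →ₐ[constants R D K]
    PVAlgebra R D K A ⊗[constants R D K] PVAlgebra R D K A}
  (hΔ : ∀ h, pvMul₂ R D K A (Δ h) = coringComul K A (PVAlgebra.incl R D K A h))

include hΔ

lemma pvMul₃_map_id (u : PVAlgebra R D K A ⊗[constants R D K] PVAlgebra R D K A) :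
    pvMul₃ R D K A (Algebra.TensorProduct.map (AlgHom.id (constants R D K) _) Δ u) =
      Algebra.TensorProduct.map (AlgHom.id K A) (coringComul K A) (pvMul₂ R D K A u) := by
  induction u using TensorProduct.induction_on with
  | zero => simp only [map_zero]
  | add x y hx hy => simp only [map_add, hx, hy]
  | tmul h h' =>
    rw [Algebra.TensorProduct.map_tmul, AlgHom.id_apply, pvMul₃_tmul, hΔ, pvMul₂_tmul, map_mul,
      Algebra.TensorProduct.map_tmul, map_one]
    congr 1
    induction PVAlgebra.incl R D K A h using TensorProduct.induction_on with
    | zero => simp only [map_zero]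
    | add x y hx hy => simp only [map_add, hx, hy]
    | tmul a b => simp [coringComul, Algebra.TensorProduct.one_def]

omit hΔ in
lemma pvMul₃_assoc_tmul (v : PVAlgebra R D K A ⊗[constants R D K] PVAlgebra R D K A)
    (h : PVAlgebra R D K A) :
    pvMul₃ R D K A (Algebra.TensorProduct.assoc (constants R D K) (constants R D K)
        (constants R D K) _ _ _ (v ⊗ₜ h)) =
      Algebra.TensorProduct.map (AlgHom.id K A)
        (Algebra.TensorProduct.map (AlgHom.id K A)
          (Algebra.TensorProduct.includeLeft : A →ₐ[K] A ⊗[K] A)) (pvMul₂ R D K A v) *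
        (1 ⊗ₜ[K] (1 ⊗ₜ[K] PVAlgebra.incl R D K A h)) := by
  induction v using TensorProduct.induction_on with
  | zero => simp only [TensorProduct.zero_tmul, map_zero, zero_mul]
  | add x y hx hy => simp only [TensorProduct.add_tmul, map_add, hx, hy, add_mul]
  | tmul h₁ h₂ =>
    rw [Algebra.TensorProduct.assoc_tmul, pvMul₃_tmul, pvMul₂_tmul, pvMul₂_tmul, map_mul,
      Algebra.TensorProduct.map_tmul, map_one, mul_assoc, Algebra.TensorProduct.tmul_mul_tmul,
      one_mul]
    congr 1
    induction PVAlgebra.incl R D K A h₁ using TensorProduct.induction_on with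
    | zero => simp only [map_zero]
    | add x y hx hy => simp only [map_add, hx, hy]
    | tmul a b => simp [Algebra.TensorProduct.one_def]

lemma pvMul₃_assoc_map_id (u : PVAlgebra R D K A ⊗[constants R D K] PVAlgebra R D K A) :
    pvMul₃ R D K A (Algebra.TensorProduct.assoc (constants R D K) (constants R D K)
        (constants R D K) _ _ _
        (Algebra.TensorProduct.map Δ (AlgHom.id (constants R D K) _) u)) =
      Algebra.TensorProduct.map (AlgHom.id K A)
        (Algebra.TensorProduct.includeRight : A ⊗[K] A →ₐ[K] A ⊗[K] (A ⊗[K] A))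
        (pvMul₂ R D K A u) := by
  induction u using TensorProduct.induction_on with
  | zero => simp only [map_zero]
  | add x y hx hy => simp only [map_add, hx, hy]
  | tmul h h' =>
    rw [Algebra.TensorProduct.map_tmul, AlgHom.id_apply, pvMul₃_assoc_tmul, hΔ, pvMul₂_tmul,
      map_mul, Algebra.TensorProduct.map_tmul, map_one]
    congr 1
    induction PVAlgebra.incl R D K A h using TensorProduct.induction_on with
    | zero => simp only [map_zero]
    | add x y hx hy => simp only [map_add, hx, hy]
    | tmul a b => simp [coringComul]

omit hΔ in
lemma map_id_coringComul (t : A ⊗[K] A) :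
    Algebra.TensorProduct.map (AlgHom.id K A)
        (Algebra.TensorProduct.includeRight : A ⊗[K] A →ₐ[K] A ⊗[K] (A ⊗[K] A))
        (coringComul K A t) =
      Algebra.TensorProduct.map (AlgHom.id K A) (coringComul K A) (coringComul K A t) := by
  induction t using TensorProduct.induction_on with
  | zero => simp only [map_zero]
  | add x y hx hy => simp only [map_add, hx, hy]
  | tmul a b => simp [coringComul]

omit hΔ in
lemma incl_lid_map_counit {ε : PVAlgebra R D K A →ₐ[constants R D K] constants R D K}
    (hε : ∀ h, algebraMap K A (ε h : K) =
      Algebra.TensorProduct.lmul' K (PVAlgebra.incl R D K A h))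
    (u : PVAlgebra R D K A ⊗[constants R D K] PVAlgebra R D K A) :
    PVAlgebra.incl R D K A
        (Algebra.TensorProduct.lid (constants R D K) _
          (Algebra.TensorProduct.map ε (AlgHom.id (constants R D K) _) u)) =
      Algebra.TensorProduct.lift (Algebra.TensorProduct.includeLeft : A →ₐ[K] A ⊗[K] A)
        (AlgHom.id K (A ⊗[K] A)) (fun _ _ => Commute.all _ _) (pvMul₂ R D K A u) := by
  induction u using TensorProduct.induction_on with
  | zero => simp only [map_zero]
  | add x y hx hy => simp only [map_add, hx, hy]
  | tmul h h' =>
    rw [Algebra.TensorProduct.map_tmul, AlgHom.id_apply, pvMul₂_tmul, map_mul,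
      Algebra.TensorProduct.lift_tmul, map_one, one_mul, AlgHom.id_apply,
      Algebra.TensorProduct.lid_tmul, map_smul, Algebra.smul_def]
    congr 1
    have h1 : algebraMap (constants R D K) (A ⊗[K] A) (ε h) = algebraMap K A (ε h : K) ⊗ₜ 1 := rfl
    rw [h1, hε]
    induction PVAlgebra.incl R D K A h using TensorProduct.induction_on with
    | zero => simp only [map_zero, TensorProduct.zero_tmul]
    | add x y hx hy => simp only [map_add, TensorProduct.add_tmul, hx, hy]
    | tmul a b => simp

omit hΔ in
lemma incl_rid_map_counit {ε : PVAlgebra R D K A →ₐ[constants R D K] constants R D K}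
    (hε : ∀ h, algebraMap K A (ε h : K) =
      Algebra.TensorProduct.lmul' K (PVAlgebra.incl R D K A h))
    (u : PVAlgebra R D K A ⊗[constants R D K] PVAlgebra R D K A) :
    PVAlgebra.incl R D K A
        (Algebra.TensorProduct.rid (constants R D K) (constants R D K) _
          (Algebra.TensorProduct.map (AlgHom.id (constants R D K) _) ε u)) =
      Algebra.TensorProduct.map (AlgHom.id K A) (Algebra.TensorProduct.lmul' K)
        (pvMul₂ R D K A u) := by
  induction u using TensorProduct.induction_on with
  | zero => simp only [map_zero]
  | add x y hx hy => simp only [map_add, hx, hy]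
  | tmul h h' =>
    rw [Algebra.TensorProduct.map_tmul, AlgHom.id_apply, pvMul₂_tmul, map_mul,
      Algebra.TensorProduct.map_tmul, map_one, ← hε,
      Algebra.TensorProduct.rid_tmul, map_smul, Algebra.smul_def, mul_comm]
    have h1 : algebraMap (constants R D K) (A ⊗[K] A) (ε h') =
        algebraMap K (A ⊗[K] A) (ε h' : K) := rfl
    have h2 : (1 : A) ⊗ₜ[K] algebraMap K A (ε h' : K) = algebraMap K (A ⊗[K] A) (ε h' : K) :=
      (Algebra.TensorProduct.includeRight : A →ₐ[K] A ⊗[K] A).commutes _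
    rw [h1, h2]
    congr 1
    induction PVAlgebra.incl R D K A h using TensorProduct.induction_on with
    | zero => simp only [map_zero]
    | add x y hx hy => simp only [map_add]; rw [← hx, ← hy]
    | tmul a b => simp

omit hΔ in
lemma incl_lift_antipode_id {S : PVAlgebra R D K A →ₐ[constants R D K] PVAlgebra R D K A}
    (hS : ∀ h, PVAlgebra.incl R D K A (S h) =
      Algebra.TensorProduct.comm K A A (PVAlgebra.incl R D K A h))
    (u : PVAlgebra R D K A ⊗[constants R D K] PVAlgebra R D K A) :
    PVAlgebra.incl R D K A
        (Algebra.TensorProduct.lift S (AlgHom.id (constants R D K) _)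
          (fun _ _ => Commute.all _ _) u) =
      Algebra.TensorProduct.lift (Algebra.TensorProduct.includeRight : A →ₐ[K] A ⊗[K] A)
        (AlgHom.id K (A ⊗[K] A)) (fun _ _ => Commute.all _ _) (pvMul₂ R D K A u) := by
  induction u using TensorProduct.induction_on with
  | zero => simp only [map_zero]
  | add x y hx hy => simp only [map_add, hx, hy]
  | tmul h h' =>
    rw [Algebra.TensorProduct.lift_tmul, AlgHom.id_apply, pvMul₂_tmul, map_mul, map_mul,
      Algebra.TensorProduct.lift_tmul, map_one, one_mul, AlgHom.id_apply, hS]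
    congr 1
    induction PVAlgebra.incl R D K A h using TensorProduct.induction_on with
    | zero => simp only [map_zero]
    | add x y hx hy => simp only [map_add, hx, hy]
    | tmul a b => simp

omit hΔ in
lemma incl_lift_id_antipode {S : PVAlgebra R D K A →ₐ[constants R D K] PVAlgebra R D K A}
    (hS : ∀ h, PVAlgebra.incl R D K A (S h) =
      Algebra.TensorProduct.comm K A A (PVAlgebra.incl R D K A h))
    (u : PVAlgebra R D K A ⊗[constants R D K] PVAlgebra R D K A) :
    PVAlgebra.incl R D K A
        (Algebra.TensorProduct.lift (AlgHom.id (constants R D K) _) S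
          (fun _ _ => Commute.all _ _) u) =
      Algebra.TensorProduct.lift (Algebra.TensorProduct.includeLeft : A →ₐ[K] A ⊗[K] A)
        (Algebra.TensorProduct.comm K A A).toAlgHom (fun _ _ => Commute.all _ _)
        (pvMul₂ R D K A u) := by
  induction u using TensorProduct.induction_on with
  | zero => simp only [map_zero]
  | add x y hx hy => simp only [map_add, hx, hy]
  | tmul h h' =>
    rw [Algebra.TensorProduct.lift_tmul, AlgHom.id_apply, pvMul₂_tmul, map_mul, map_mul,
      Algebra.TensorProduct.lift_tmul, map_one, one_mul, hS]
    congr 1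
    induction PVAlgebra.incl R D K A h using TensorProduct.induction_on with
    | zero => simp only [map_zero]
    | add x y hx hy => simp only [map_add]; rw [← hx, ← hy]
    | tmul a b => simp

end Identities

lemma coringComul_mem_constants {t : A ⊗[K] A} (ht : t ∈ constants R D (A ⊗[K] A)) :
    coringComul K A t ∈ constants R D (A ⊗[K] (A ⊗[K] A)) :=
  IsEquivariantMap.mem_constants
    (isEquivariantMap_map (fun _ _ => rfl) isEquivariantMap_includeRight) ht

variable (hA : IsSimple R D A) (hkf : IsField (constants R D K)) [Module.Flat K A]
  (hkA : ∀ b ∈ constants R D A, ∃ c : constants R D K, algebraMap _ A c = b)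
  (hspan : Submodule.span A (tensorConstants R D K A : Set (A ⊗[K] A)) = ⊤)

include hA hkf hkA

omit [Module.Flat K A] in
lemma algebraMap_constants_injective :
    Function.Injective (algebraMap (constants R D K) A) := by
  have := hA.1
  let _ := hkf.toField
  exact (algebraMap (constants R D K) A).injective

include hspan in
/-- The Hopf algebra structure of `H`. The structure maps exist because the maps they are induced by
preserve constants, and `H` and `H ⊗ H` are all constants of `A ⊗_K A` and `A ⊗_K A ⊗_K A`. The
axioms are checked after the injective maps from `H` and its tensor powers to tensor powers of
`A`. -/
lemma nonempty_pvHopfStructure : Nonempty (PVHopfStructure R D K A) := by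
  have hj₂ := injective_pvMul₂ hA hkf hkA
  have hj₃ := injective_pvMul₃ hA hkf hkA
  obtain ⟨Δ, hΔ⟩ := AlgHom.exists_lift_of_injective (pvMul₂ R D K A) hj₂
    (((coringComul K A).restrictScalars (constants R D K)).comp (PVAlgebra.incl R D K A))
    fun h => exists_pvMul₂_eq hA hkf hkA hspan
      (coringComul_mem_constants (PVAlgebra_incl_mem_constants h))
  obtain ⟨ε, hε⟩ := AlgHom.exists_lift_of_injective (Algebra.ofId (constants R D K) A)
    (algebraMap_constants_injective hA hkf hkA)
    (((Algebra.TensorProduct.lmul' K : A ⊗[K] A →ₐ[K] A).restrictScalars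
      (constants R D K)).comp (PVAlgebra.incl R D K A))
    fun h => hkA _ (IsEquivariantMap.mem_constants isEquivariantMap_lmul'
      (PVAlgebra_incl_mem_constants h))
  obtain ⟨S, hS⟩ := AlgHom.exists_lift_of_injective (PVAlgebra.incl R D K A)
    PVAlgebra_incl_injective
    (((Algebra.TensorProduct.comm K A A).toAlgHom.restrictScalars
      (constants R D K)).comp (PVAlgebra.incl R D K A))
    fun h => exists_incl_eq (IsEquivariantMap.mem_constants
      (f := (Algebra.TensorProduct.comm K A A).toAlgHom) isEquivariantMap_comm
      (PVAlgebra_incl_mem_constants h))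
  replace hΔ : ∀ h, pvMul₂ R D K A (Δ h) = coringComul K A (PVAlgebra.incl R D K A h) := hΔ
  replace hε : ∀ h, algebraMap K A (ε h : K) =
    Algebra.TensorProduct.lmul' K (PVAlgebra.incl R D K A h) := hε
  replace hS : ∀ h, PVAlgebra.incl R D K A (S h) =
    Algebra.TensorProduct.comm K A A (PVAlgebra.incl R D K A h) := hS
  have hin := PVAlgebra_incl_injective (R := R) (D := D) (K := K) (A := A)
  refine ⟨⟨⟨Δ, ε, S, ?_, ?_, ?_, ?_, ?_⟩, hΔ, hε, hS⟩⟩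
  · refine AlgHom.ext fun h => hj₃ ?_
    refine (pvMul₃_assoc_map_id hΔ (Δ h)).trans ?_
    refine Eq.trans ?_ (pvMul₃_map_id hΔ (Δ h)).symm
    rw [hΔ, map_id_coringComul]
  · refine AlgHom.ext fun h => (Algebra.TensorProduct.lid _ _).injective (hin ?_)
    refine (incl_lid_map_counit hε (Δ h)).trans ?_
    rw [hΔ]
    refine Eq.trans ?_ (congrArg _ ((Algebra.TensorProduct.lid _ _).apply_symm_apply h).symm)
    induction PVAlgebra.incl R D K A h using TensorProduct.induction_on with
    | zero => simp only [map_zero]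
    | add x y hx hy => simp only [map_add, hx, hy]
    | tmul a b => simp [coringComul]
  · refine AlgHom.ext fun h =>
      (Algebra.TensorProduct.rid (constants R D K) (constants R D K) _).injective (hin ?_)
    refine (incl_rid_map_counit hε (Δ h)).trans ?_
    rw [hΔ]
    refine Eq.trans ?_ (congrArg _ ((Algebra.TensorProduct.rid _ _ _).apply_symm_apply h).symm)
    induction PVAlgebra.incl R D K A h using TensorProduct.induction_on with
    | zero => simp only [map_zero]
    | add x y hx hy => simp only [map_add, hx, hy]
    | tmul a b => simp [coringComul]
  · refine AlgHom.ext fun h => hin ?_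
    refine (incl_lift_antipode_id hS (Δ h)).trans ?_
    rw [hΔ]
    refine Eq.trans ?_ ((PVAlgebra.incl R D K A).commutes (ε h)).symm
    refine Eq.trans ?_ ((Algebra.TensorProduct.includeRight : A →ₐ[K] A ⊗[K] A).commutes (ε h : K))
    rw [hε]
    induction PVAlgebra.incl R D K A h using TensorProduct.induction_on with
    | zero => simp only [map_zero]
    | add x y hx hy => simp only [map_add, hx, hy]
    | tmul a b => simp [coringComul]
  · refine AlgHom.ext fun h => hin ?_
    refine (incl_lift_id_antipode hS (Δ h)).trans ?_
    rw [hΔ]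
    refine Eq.trans ?_ ((PVAlgebra.incl R D K A).commutes (ε h)).symm
    refine Eq.trans ?_ ((Algebra.TensorProduct.includeLeft : A →ₐ[K] A ⊗[K] A).commutes (ε h : K))
    rw [hε]
    induction PVAlgebra.incl R D K A h using TensorProduct.induction_on with
    | zero => simp only [map_zero]
    | add x y hx hy => simp only [map_add, hx, hy]
    | tmul a b => simp [coringComul]

/-- The Hopf algebra structure of `H` is determined by its relation to the coring `A ⊗_K A`. -/
lemma subsingleton_pvHopfStructure : Subsingleton (PVHopfStructure R D K A) := by
  refine ⟨fun S S' => ?_⟩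
  have h1 : S.comul = S'.comul := AlgHom.ext fun h => injective_pvMul₂ hA hkf hkA
    ((S.comul_spec h).trans (S'.comul_spec h).symm)
  have h2 : S.counit = S'.counit := AlgHom.ext fun h =>
    algebraMap_constants_injective hA hkf hkA ((S.counit_spec h).trans (S'.counit_spec h).symm)
  have h3 : S.antipode = S'.antipode := AlgHom.ext fun h =>
    PVAlgebra_incl_injective ((S.antipode_spec h).trans (S'.antipode_spec h).symm)
  obtain ⟨⟨Δ, ε, S, _, _, _, _, _⟩, _, _, _⟩ := S
  obtain ⟨⟨Δ', ε', S', _, _, _, _, _⟩, _, _, _⟩ := S'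
  obtain rfl : Δ = Δ' := h1
  obtain rfl : ε = ε' := h2
  obtain rfl : S = S' := h3
  rfl

end HopfStructure
end ModuleAlgebra

/-! ### Ideals defining equivalence relations -/

section Relation
open TensorProduct

variable {K L : Type*} [CommRing K] [CommRing L] [Algebra K L]

/-- An ideal `𝔞` of `L ⊗_K L` that defines an equivalence relation on the spectrum of `L`: it lies
in the ideal of the diagonal, is stable under the twist and is a coideal of the coring
`L ⊗_K L`. -/
structure Ideal.IsEquivalenceRelation (𝔞 : Ideal (L ⊗[K] L)) : Prop where
  le_ker_lmul' : 𝔞 ≤ RingHom.ker (Algebra.TensorProduct.lmul' K : L ⊗[K] L →ₐ[K] L)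
  comm_mem : ∀ p ∈ 𝔞, Algebra.TensorProduct.comm K L L p ∈ 𝔞
  coringComul_mem : ∀ p ∈ 𝔞, coringComul K L p ∈
    𝔞.map (Algebra.TensorProduct.map (AlgHom.id K L) Algebra.TensorProduct.includeLeft :
      L ⊗[K] L →ₐ[K] L ⊗[K] (L ⊗[K] L)) ⊔
    𝔞.map (Algebra.TensorProduct.includeRight : L ⊗[K] L →ₐ[K] L ⊗[K] (L ⊗[K] L))

variable {𝔞 : Ideal (L ⊗[K] L)}

lemma liftBaseChange_algebra_lmul (c : L) (p : L ⊗[K] L) :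
    (Algebra.lmul K L c).liftBaseChange L p = c * Algebra.TensorProduct.lmul' K p := by
  induction p using TensorProduct.induction_on with
  | zero => simp
  | add x y hx hy => simp only [map_add, hx, hy, mul_add]
  | tmul x y => simp [mul_left_comm]

namespace Ideal.IsEquivalenceRelation

/-- The left dual `{φ | ∑ x φ(y) = 0 for all ∑ x ⊗ y ∈ 𝔞}` of the coring `(L ⊗_K L) / 𝔞`; it is a
subring of `End_K(L)` because `𝔞` is a coideal. -/
def dualAlgebra (h : 𝔞.IsEquivalenceRelation) : Subalgebra K (Module.End K L) where
  carrier := {φ | ∀ p ∈ 𝔞, φ.liftBaseChange L p = 0}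
  algebraMap_mem' c p hp := by
    have h1 : algebraMap K (Module.End K L) c = Algebra.lmul K L (algebraMap K L c) := by
      ext; simp
    rw [h1, liftBaseChange_algebra_lmul, (h.le_ker_lmul' hp : Algebra.TensorProduct.lmul' K p = 0),
      mul_zero]
  add_mem' {φ ψ} hφ hψ p hp := by
    have h1 : (φ + ψ).liftBaseChange L p = φ.liftBaseChange L p + ψ.liftBaseChange L p := by
      clear hp
      induction p using TensorProduct.induction_on with
      | zero => simp
      | add x y hx hy => rw [map_add, hx, hy, map_add, map_add]; abel
      | tmul x y => simp
    rw [h1, hφ p hp, hψ p hp, add_zero]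
  mul_mem' {φ ψ} hφ hψ p hp := by
    -- `x ⊗ z ⊗ y ↦ x φ(z ψ(y))` vanishes on `𝔞 ⊗ L + L ⊗ 𝔞`
    let ψ' : L ⊗[K] L →ₗ[K] L := (ψ.liftBaseChange L).restrictScalars K
    let Θ : L ⊗[K] (L ⊗[K] L) →ₗ[K] L :=
      (φ.liftBaseChange L).restrictScalars K ∘ₗ ψ'.lTensor L
    have hΘ : ∀ x t, Θ (x ⊗ₜ t) = x * φ (ψ.liftBaseChange L t) := fun x t => by simp [Θ, ψ']
    have hspan : ∀ s : Set (L ⊗[K] (L ⊗[K] L)), (∀ x ∈ s, ∀ t, Θ (t * x) = 0) →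
        ∀ x ∈ Ideal.span s, Θ x = 0 := by
      intro s hs x hx
      have : ∀ t, Θ (t * x) = 0 := by
        induction hx using Submodule.span_induction with
        | mem x hx => exact hs x hx
        | zero => simp
        | add x y _ _ hx hy => intro t; rw [mul_add, map_add, hx, hy, add_zero]
        | smul a x _ hx => intro t; rw [smul_eq_mul, ← mul_assoc]; exact hx _
      simpa using this 1
    have h1 : Θ (coringComul K L p) = (φ * ψ).liftBaseChange L p := by
      clear hp
      induction p using TensorProduct.induction_on with
      | zero => simp
      | add x y hx hy => simp only [map_add, hx, hy]
      | tmul x y => simp [coringComul, hΘ]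
    rw [← h1]
    obtain ⟨u, hu, v, hv, huv⟩ := Submodule.mem_sup.1 (h.coringComul_mem p hp)
    rw [← huv, map_add]
    have hu0 : Θ u = 0 := by
      refine hspan _ ?_ u hu
      rintro _ ⟨q, hq, rfl⟩ t
      have h2 : ∀ a b c, Θ (a ⊗ₜ (b ⊗ₜ c) * Algebra.TensorProduct.map (AlgHom.id K L)
          (Algebra.TensorProduct.includeLeft : L →ₐ[K] L ⊗[K] L) q) =
          φ.liftBaseChange L (a ⊗ₜ (b * ψ c) * q) := by
        intro a b c
        clear hq
        induction q using TensorProduct.induction_on with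
        | zero => simp
        | add x y hx hy => simp only [map_add, mul_add, hx, hy]
        | tmul x y => simp [hΘ, mul_right_comm b]
      induction t using TensorProduct.induction_on with
      | zero => simp
      | add x y hx hy => rw [add_mul, map_add, hx, hy, add_zero]
      | tmul a t =>
        induction t using TensorProduct.induction_on with
        | zero => simp
        | add x y hx hy => rw [TensorProduct.tmul_add, add_mul, map_add, hx, hy, add_zero]
        | tmul b c => exact (h2 a b c).trans (hφ _ (𝔞.mul_mem_left _ hq))
    have hv0 : Θ v = 0 := by
      refine hspan _ ?_ v hv
      rintro _ ⟨q, hq, rfl⟩ t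
      induction t using TensorProduct.induction_on with
      | zero => simp
      | add x y hx hy => rw [add_mul, map_add, hx, hy, add_zero]
      | tmul a t =>
        have h3 : a ⊗ₜ[K] t * (1 ⊗ₜ[K] q) = a ⊗ₜ (t * q) := by simp
        refine (congrArg Θ h3).trans ?_
        rw [hΘ, hψ _ (𝔞.mul_mem_left _ hq), map_zero, mul_zero]
    rw [hu0, hv0, add_zero]

variable (h : 𝔞.IsEquivalenceRelation)

lemma lmul_mem_dualAlgebra (c : L) : Algebra.lmul K L c ∈ h.dualAlgebra := fun p hp => by
  rw [liftBaseChange_algebra_lmul, (h.le_ker_lmul' hp : Algebra.TensorProduct.lmul' K p = 0),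
    mul_zero]

lemma mul_mem_of_submodule (N : Submodule h.dualAlgebra L) (c : L) {x : L} (hx : x ∈ N) :
    c * x ∈ N :=
  N.smul_mem ⟨_, h.lmul_mem_dualAlgebra c⟩ hx

variable [IsSemisimpleRing L]

include h

/-- The ideal `𝔞` is recovered from its dual ring, as `(L ⊗_K L) / 𝔞` is a projective
`L`-module. -/
lemma mem_of_forall_dualAlgebra {p : L ⊗[K] L}
    (hp : ∀ φ ∈ h.dualAlgebra, φ.liftBaseChange L p = 0) : p ∈ 𝔞 := by
  have := Module.projective_of_isSemisimpleRing L ((L ⊗[K] L) ⧸ 𝔞.restrictScalars L)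
  rw [← Submodule.restrictScalars_mem L, ← Submodule.Quotient.mk_eq_zero,
    ← Module.forall_dual_apply_eq_zero_iff L]
  intro l
  let m : L ⊗[K] L →ₗ[L] L := l ∘ₗ (𝔞.restrictScalars L).mkQ
  let φ : Module.End K L := m.restrictScalars K ∘ₗ
    (Algebra.TensorProduct.includeRight : L →ₐ[K] L ⊗[K] L).toLinearMap
  have hφ : ∀ q, φ.liftBaseChange L q = m q := by
    intro q
    induction q using TensorProduct.induction_on with
    | zero => simp
    | add x y hx hy => simp only [map_add, hx, hy]
    | tmul x y =>
      rw [LinearMap.liftBaseChange_tmul]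
      change x • m (1 ⊗ₜ y) = _
      rw [← map_smul, TensorProduct.smul_tmul', smul_eq_mul, mul_one]
  rw [← hp φ fun q hq => by
    rw [hφ]
    change l ((𝔞.restrictScalars L).mkQ q) = 0
    have hq0 : (𝔞.restrictScalars L).mkQ q = 0 := (Submodule.Quotient.mk_eq_zero _).2 hq
    rw [hq0, map_zero]]
  exact (hφ p).symm

/-- Since `𝔞` is stable under the twist, orthogonal complements of stable ideals are stable, so `L`
is a semisimple module over the dual ring. -/
lemma isSemisimpleModule_dualAlgebra : IsSemisimpleModule h.dualAlgebra L := by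
  refine { exists_isCompl := fun N => ?_ }
  let I : Ideal L :=
    { N.toAddSubmonoid with smul_mem' := fun c _ hx => h.mul_mem_of_submodule N c hx }
  have hI : ∀ x, x ∈ I ↔ x ∈ N := fun _ => Iff.rfl
  -- `N = e L` for an idempotent `e`. As `N` is stable, `(1 - e) φ(e) = 0` for all `φ`, which means
  -- that `(1 - e) ⊗ e ∈ 𝔞`; the twist gives `e ⊗ (1 - e) ∈ 𝔞`, so that `(1 - e) L` is stable.
  obtain ⟨I', hI'⟩ := exists_isCompl I
  obtain ⟨e, he, e', he', hee'⟩ : ∃ e ∈ I, ∃ e' ∈ I', e + e' = 1 :=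
    Submodule.mem_sup.1 (by rw [hI'.sup_eq_top]; trivial)
  have hdisj : ∀ x ∈ I, x ∈ I' → x = 0 := Submodule.disjoint_def.1 hI'.disjoint
  have he'I : ∀ x ∈ I, e' * x = 0 := fun x hx =>
    hdisj _ (I.mul_mem_left _ hx) (I'.mul_mem_right _ he')
  have hadd : ∀ x, e * x + e' * x = x := fun x => by rw [← add_mul, hee', one_mul]
  have h1 : e' ⊗ₜ[K] e ∈ 𝔞 := h.mem_of_forall_dualAlgebra fun φ hφ => by
    rw [LinearMap.liftBaseChange_tmul, smul_eq_mul]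
    exact he'I _ (N.smul_mem (⟨φ, hφ⟩ : h.dualAlgebra) he)
  have h2 : e ⊗ₜ[K] e' ∈ 𝔞 := by simpa using h.comm_mem _ h1
  let N' : Submodule h.dualAlgebra L :=
    { carrier := {x | e * x = 0}
      add_mem' := fun {x y} (hx : e * x = 0) (hy : e * y = 0) => by
        change e * (x + y) = 0
        rw [mul_add, hx, hy, add_zero]
      zero_mem' := mul_zero e
      smul_mem' := fun φ x (hx : e * x = 0) => by
        have h3 := φ.2 _ (𝔞.mul_mem_right (1 ⊗ₜ x) h2)
        have h4 : e' * x = x := by simpa [hx] using hadd x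
        rw [Algebra.TensorProduct.tmul_mul_tmul, mul_one, h4, LinearMap.liftBaseChange_tmul] at h3
        exact h3 }
  refine ⟨N', ?_⟩
  rw [isCompl_iff, Submodule.disjoint_def, codisjoint_iff, eq_top_iff]
  refine ⟨fun x hx (hx' : e * x = 0) => ?_, fun x _ => ?_⟩
  · rw [← hadd x, hx', he'I x hx, add_zero]
  · refine Submodule.mem_sup.2 ⟨e * x, ?_, e' * x, ?_, hadd x⟩
    · rw [mul_comm]; exact h.mul_mem_of_submodule N x he
    · change e * (e' * x) = 0
      rw [mul_left_comm, he'I _ (I.mul_mem_right _ he)]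

/-- An ideal of `L ⊗_K L` that defines an equivalence relation is contained in the kernel of
`L ⊗_K L → L ⊗_M L`, where `M` consists of the elements whose two images agree modulo the ideal:
the endomorphisms of the semisimple module `L` over the dual ring are multiplications by elements of
`M`, so by Jacobson density the dual ring is dense in `End_M(L)`. -/
theorem le_ker_mapOfCompatibleSMul (M : Subalgebra K L)
    (hM : ∀ x, x ⊗ₜ[K] (1 : L) - (1 : L) ⊗ₜ[K] x ∈ 𝔞 → x ∈ M) :
    𝔞 ≤ RingHom.ker (Algebra.TensorProduct.mapOfCompatibleSMul M K K L L) := by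
  classical
  intro p hp
  have hss := h.isSemisimpleModule_dualAlgebra
  have hproj := Module.projective_of_isSemisimpleRing L (L ⊗[M] L)
  rw [RingHom.mem_ker, ← Module.forall_dual_apply_eq_zero_iff L]
  intro l
  -- `y ↦ l (1 ⊗ y)` commutes with the endomorphisms of `L` over the dual ring.
  let ψ : Module.End (Module.End h.dualAlgebra L) L :=
    { toFun := fun y => l (1 ⊗ₜ y)
      map_add' := fun x y => by rw [TensorProduct.tmul_add, map_add]
      map_smul' := fun g y => by
        have hg : ∀ x, g x = g 1 * x := fun x => by
          have := g.map_smul ⟨_, h.lmul_mem_dualAlgebra x⟩ 1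
          change g (x * 1) = x * g 1 at this
          rw [← mul_comm x, ← this, mul_one]
        have hgM : g 1 ∈ M := hM _ <| h.mem_of_forall_dualAlgebra fun φ hφ => by
          have h1 : g (φ 1) = φ (g 1) := g.map_smul ⟨φ, hφ⟩ 1
          rw [map_sub, LinearMap.liftBaseChange_tmul, LinearMap.liftBaseChange_tmul, one_smul,
            smul_eq_mul, ← hg, h1, sub_self]
        change l (1 ⊗ₜ g y) = g (l (1 ⊗ₜ y))
        have h2 : (1 : L) ⊗ₜ[M] g y = g 1 • ((1 : L) ⊗ₜ[M] y) := by
          rw [hg y, TensorProduct.smul_tmul', smul_eq_mul, mul_one]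
          exact (TensorProduct.smul_tmul (⟨g 1, hgM⟩ : M) (1 : L) y).symm.trans
            (by rw [Algebra.smul_def, mul_one]; rfl)
        rw [h2, map_smul, smul_eq_mul, ← hg] }
  obtain ⟨S, rfl⟩ := TensorProduct.exists_finset p
  obtain ⟨r, hr⟩ := jacobson_density (R := h.dualAlgebra) (M := L) ψ (S.image Prod.snd)
  have h1 := r.2 _ hp
  rw [map_sum] at h1
  rw [map_sum, map_sum, ← h1]
  refine Finset.sum_congr rfl fun i hi => ?_
  have h2 : l (1 ⊗ₜ i.2) = (r : Module.End K L) i.2 := hr i.2 (Finset.mem_image_of_mem _ hi)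
  rw [LinearMap.liftBaseChange_tmul, ← h2, ← map_smul, TensorProduct.smul_tmul', smul_eq_mul,
    mul_one]
  rfl

end Ideal.IsEquivalenceRelation

end Relation

/-! ### Artinian simple intermediate algebras -/

section Regular

/-- Reduced artinian rings are von Neumann regular. -/
lemma exists_quasiInverse {L : Type*} [CommRing L] [IsArtinianRing L] [IsReduced L] (x : L) :
    ∃ y, x * y * x = x ∧ y * x * y = y := by
  obtain ⟨n, y, hy⟩ := IsArtinian.exists_pow_succ_smul_dvd x (1 : L)
  have h1 : x ^ (n + 1) * y = x ^ n := by simpa using hy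
  have h2 : x * (1 - x * y) = 0 := by
    refine pow_eq_zero_iff (n := n + 1) (Nat.succ_ne_zero n) |>.1 ?_
    have h3 : x ^ n * (1 - x * y) = 0 := by
      rw [mul_sub, mul_one, ← mul_assoc, ← pow_succ, h1, sub_self]
    have h4 : (x * (1 - x * y)) ^ (n + 1) = x ^ n * (1 - x * y) * (x * (1 - x * y) ^ n) := by
      rw [mul_pow]; ring
    rw [h4, h3, zero_mul]
  have h4 : x * y * x = x := by linear_combination -h2
  refine ⟨y * x * y, ?_, ?_⟩
  · linear_combination (x * y + 1) * h4
  · linear_combination (y * y * (x * y + 1)) * h4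

/-- Quasi-inverses in a commutative ring are unique. -/
lemma quasiInverse_unique {P : Type*} [CommRing P] {x y z : P} (h1 : x * y * x = x)
    (h2 : y * x * y = y) (h3 : x * z * x = x) (h4 : z * x * z = z) : y = z := by
  linear_combination -h2 + h4 + (y + z) * (z * h1 - y * h3)

end Regular

namespace IntermediateModuleAlgebra
open ModuleAlgebra Coalgebra

variable {R D K L : Type*} [CommRing R] [Ring D] [Bialgebra R D]
  [CommRing K] [Algebra R K] [ModuleAlgebra R D K]
  [CommRing L] [Algebra R L] [ModuleAlgebra R D L] [Algebra K L] [IsScalarTower R K L]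

lemma eq_of_forall_mem_iff {M N : IntermediateModuleAlgebra R D K L}
    (h : ∀ x, x ∈ M.toSubalgebra ↔ x ∈ N.toSubalgebra) : M = N := by
  obtain ⟨M, _⟩ := M
  obtain ⟨N, _⟩ := N
  obtain rfl : M = N := SetLike.ext h
  rfl

/-- Ideals of a regular subring are contracted from the whole ring. -/
lemma mem_of_mem_map {M : IntermediateModuleAlgebra R D K L}
    (hM : ∀ x ∈ M.toSubalgebra, ∃ y ∈ M.toSubalgebra, x * y * x = x) (I : Ideal M.toSubalgebra)
    {x : M.toSubalgebra} (hx : (x : L) ∈ I.map (algebraMap M.toSubalgebra L)) : x ∈ I := by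
  -- every element of `I · L` is fixed by multiplication with an element of `I`
  have h1 : ∀ z ∈ I.map (algebraMap M.toSubalgebra L), ∃ e ∈ I, (e : L) * z = z := by
    intro z hz
    induction hz using Submodule.span_induction with
    | mem z hz =>
      obtain ⟨z, hz, rfl⟩ := hz
      obtain ⟨y, hy, hzy⟩ := hM z z.2
      exact ⟨z * ⟨y, hy⟩, I.mul_mem_right _ hz, hzy⟩
    | zero => exact ⟨0, I.zero_mem, by simp⟩
    | add z w _ _ hz hw =>
      obtain ⟨e, he, hez⟩ := hz
      obtain ⟨f, hf, hfw⟩ := hw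
      refine ⟨e + f - e * f, I.sub_mem (I.add_mem he hf) (I.mul_mem_left _ hf), ?_⟩
      push_cast
      linear_combination (1 - (f : L)) * hez + (1 - (e : L)) * hfw
    | smul a z _ hz =>
      obtain ⟨e, he, hez⟩ := hz
      exact ⟨e, he, by rw [smul_eq_mul, mul_left_comm, hez]⟩
  obtain ⟨e, he, hex⟩ := h1 x hx
  have : e * x = x := Subtype.ext hex
  rw [← this]
  exact I.mul_mem_right _ he

/-- A regular intermediate module algebra is artinian simple, as its ideals are contracted from
`L`. -/
lemma isAS_of_regular (hL : IsAS R D L) (M : IntermediateModuleAlgebra R D K L)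
    (hM : ∀ x ∈ M.toSubalgebra, ∃ y ∈ M.toSubalgebra, x * y * x = x) :
    IsAS R D M.toSubalgebra := by
  have := hL.1
  have := hL.2.1
  refine ⟨?_, inferInstance, fun I hI => ?_⟩
  · -- Extension of ideals to `L` is strictly monotone.
    rw [isArtinianRing_iff, isArtinian_iff]
    refine Subrelation.wf (r := InvImage (· < ·)
      fun I : Ideal M.toSubalgebra => I.map (algebraMap M.toSubalgebra L)) ?_
      (InvImage.wf _ wellFounded_lt)
    intro I J hIJ
    refine lt_of_le_not_ge (Ideal.map_mono hIJ.le) fun hle => hIJ.not_ge fun x hx => ?_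
    exact mem_of_mem_map hM I (hle (Ideal.mem_map_of_mem _ hx))
  · rcases hL.2.2 (I.map (algebraMap M.toSubalgebra L)) (fun d x hx =>
      act_mem_span (by
        rintro d _ ⟨x, hx, rfl⟩
        exact Ideal.subset_span ⟨_, hI d x hx, rfl⟩) d hx) with h | h
    · left
      rw [eq_bot_iff]
      intro x hx
      have h1 := Ideal.mem_map_of_mem (algebraMap M.toSubalgebra L) hx
      rw [h, Ideal.mem_bot] at h1
      exact Subtype.ext h1
    · right
      rw [Ideal.eq_top_iff_one]
      exact mem_of_mem_map hM I (by rw [h]; trivial)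

end IntermediateModuleAlgebra

/-! ### Ideals of the Hopf algebra and intermediate algebras -/

namespace ModuleAlgebra
open Coalgebra TensorProduct

section Correspondence

variable {R D K L : Type*} [CommRing R] [Ring D] [Bialgebra R D] [IsCocomm R D]
  [CommRing K] [Algebra R K] [ModuleAlgebra R D K]
  [CommRing L] [Algebra R L] [ModuleAlgebra R D L] [Algebra K L] [IsScalarTower R K L]
  [IsEquivariant R D K L] (A : IntermediateModuleAlgebra R D K L)

lemma pvToTensor_apply (h : PVAlgebra R D K A.toSubalgebra) : pvToTensor A h =
    Algebra.TensorProduct.map A.val A.val (PVAlgebra.incl R D K A.toSubalgebra h) := rfl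

lemma pvToTensor_eq_map_inclLeft (h : PVAlgebra R D K A.toSubalgebra) : pvToTensor A h =
    Algebra.TensorProduct.map (AlgHom.id K L) A.val (inclLeft A.toSubalgebra L A.val h) := by
  rw [pvToTensor_apply, inclLeft_apply]
  induction PVAlgebra.incl R D K A.toSubalgebra h using TensorProduct.induction_on with
  | zero => simp
  | add x y hx hy => simp only [map_add, hx, hy]
  | tmul a b => simp

lemma pvToTensor_mem_constants (h : PVAlgebra R D K A.toSubalgebra) :
    pvToTensor A h ∈ constants R D (L ⊗[K] L) :=
  IsEquivariantMap.mem_constants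
    (isEquivariantMap_map (isEquivariantMap_val A) (isEquivariantMap_val A))
    (PVAlgebra_incl_mem_constants h)

lemma act_mem_map_pvToTensor (I : Ideal (PVAlgebra R D K A.toSubalgebra)) (d : D)
    {p : L ⊗[K] L} (hp : p ∈ I.map (pvToTensor A)) :
    act (R := R) d p ∈ I.map (pvToTensor A) :=
  act_mem_span_of_constants (by rintro _ ⟨h, _, rfl⟩; exact pvToTensor_mem_constants A h) d hp

/-- The intermediate module algebra `{x | x ⊗ 1 - 1 ⊗ x ∈ I · (L ⊗_K L)}`. -/
def fixedAlgebra (I : Ideal (PVAlgebra R D K A.toSubalgebra)) :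
    IntermediateModuleAlgebra R D K L where
  __ := AlgHom.equalizer
    ((Ideal.Quotient.mkₐ K (I.map (pvToTensor A))).comp Algebra.TensorProduct.includeLeft)
    ((Ideal.Quotient.mkₐ K (I.map (pvToTensor A))).comp Algebra.TensorProduct.includeRight)
  act_mem' d x hx := by
    have hx' : x ⊗ₜ[K] (1 : L) - (1 : L) ⊗ₜ[K] x ∈ I.map (pvToTensor A) :=
      Ideal.Quotient.eq.1 hx
    refine Ideal.Quotient.eq.2 ?_
    have h1 := act_mem_map_pvToTensor A I d hx'
    rw [map_sub, act_one_tmul, act_tmul_one] at h1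
    exact h1

variable {A}

lemma mem_fixedAlgebra {I : Ideal (PVAlgebra R D K A.toSubalgebra)} {x : L} :
    x ∈ (fixedAlgebra A I).toSubalgebra ↔
      x ⊗ₜ[K] (1 : L) - (1 : L) ⊗ₜ[K] x ∈ I.map (pvToTensor A) :=
  Ideal.Quotient.eq (x := x ⊗ₜ[K] (1 : L)) (y := (1 : L) ⊗ₜ[K] x)

/-- The fixed algebra of an ideal is artinian simple: as quasi-inverses are unique, it contains the
quasi-inverses of its elements. -/
lemma isAS_fixedAlgebra [IsReduced L] (hL : IsAS R D L)
    (I : Ideal (PVAlgebra R D K A.toSubalgebra)) :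
    IsAS R D (fixedAlgebra A I).toSubalgebra := by
  have := hL.1
  refine IntermediateModuleAlgebra.isAS_of_regular hL _ fun x hx => ?_
  obtain ⟨y, h1, h2⟩ := exists_quasiInverse x
  refine ⟨y, ?_, h1⟩
  let f := (Ideal.Quotient.mkₐ K (I.map (pvToTensor A))).comp
    (Algebra.TensorProduct.includeLeft : L →ₐ[K] L ⊗[K] L)
  let g := (Ideal.Quotient.mkₐ K (I.map (pvToTensor A))).comp
    (Algebra.TensorProduct.includeRight : L →ₐ[K] L ⊗[K] L)
  have hx' : f x = g x := hx
  change f y = g y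
  refine quasiInverse_unique (x := f x) ?_ ?_ ?_ ?_
  · rw [← map_mul, ← map_mul, h1]
  · rw [← map_mul, ← map_mul, h2]
  · rw [hx', ← map_mul, ← map_mul, h1]
  · rw [hx', ← map_mul, ← map_mul, h2]

/-- Every element of `L ⊗_K L` is a fraction of an element of `L ⊗_K A` by an element of `A`. -/
lemma exists_tmul_mul_eq [IsFractionRing A.toSubalgebra L] (p : L ⊗[K] L) :
    ∃ s ∈ nonZeroDivisors A.toSubalgebra, ∃ w : L ⊗[K] A.toSubalgebra,
      ((1 : L) ⊗ₜ[K] (s : L)) * p = Algebra.TensorProduct.map (AlgHom.id K L) A.val w := by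
  induction p using TensorProduct.induction_on with
  | zero => exact ⟨1, one_mem _, 0, by simp⟩
  | add x y hx hy =>
    obtain ⟨s, hs, w, hw⟩ := hx
    obtain ⟨t, ht, v, hv⟩ := hy
    refine ⟨s * t, mul_mem hs ht, (1 ⊗ₜ t) * w + (1 ⊗ₜ s) * v, ?_⟩
    rw [map_add, map_mul, map_mul, ← hw, ← hv, Algebra.TensorProduct.map_tmul,
      Algebra.TensorProduct.map_tmul, ← mul_assoc, ← mul_assoc,
      Algebra.TensorProduct.tmul_mul_tmul, Algebra.TensorProduct.tmul_mul_tmul, mul_add]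
    simp [mul_comm (t : L)]
  | tmul l m =>
    obtain ⟨⟨a, s⟩, ha⟩ := IsLocalization.surj (nonZeroDivisors A.toSubalgebra) m
    refine ⟨s, s.2, l ⊗ₜ a, ?_⟩
    rw [Algebra.TensorProduct.tmul_mul_tmul, one_mul, mul_comm]
    have ha' : m * ((s : A.toSubalgebra) : L) = (a : L) := ha
    rw [ha']
    rfl

lemma exists_tmul_mul_eq_of_mem_map [IsFractionRing A.toSubalgebra L]
    (I : Ideal (PVAlgebra R D K A.toSubalgebra)) {p : L ⊗[K] L}
    (hp : p ∈ I.map (pvToTensor A)) :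
    ∃ s ∈ nonZeroDivisors A.toSubalgebra, ∃ w ∈ I.map (inclLeft A.toSubalgebra L A.val),
      ((1 : L) ⊗ₜ[K] (s : L)) * p = Algebra.TensorProduct.map (AlgHom.id K L) A.val w := by
  induction hp using Submodule.span_induction with
  | mem x hx =>
    obtain ⟨h, hh, rfl⟩ := hx
    refine ⟨1, one_mem _, _, Ideal.mem_map_of_mem _ hh, ?_⟩
    rw [← pvToTensor_eq_map_inclLeft]
    exact one_mul _
  | zero => exact ⟨1, one_mem _, 0, zero_mem _, by simp⟩
  | add x y _ _ hx hy =>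
    obtain ⟨s, hs, w, hw', hw⟩ := hx
    obtain ⟨t, ht, v, hv', hv⟩ := hy
    refine ⟨s * t, mul_mem hs ht, (1 ⊗ₜ t) * w + (1 ⊗ₜ s) * v,
      add_mem (Ideal.mul_mem_left _ _ hw') (Ideal.mul_mem_left _ _ hv'), ?_⟩
    rw [map_add, map_mul, map_mul, ← hw, ← hv, Algebra.TensorProduct.map_tmul,
      Algebra.TensorProduct.map_tmul, ← mul_assoc, ← mul_assoc,
      Algebra.TensorProduct.tmul_mul_tmul, Algebra.TensorProduct.tmul_mul_tmul, mul_add]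
    simp [mul_comm (t : L)]
  | smul a x _ hx =>
    obtain ⟨s, hs, w, hw', hw⟩ := hx
    obtain ⟨t, ht, v, hv⟩ := exists_tmul_mul_eq (A := A) a
    refine ⟨t * s, mul_mem ht hs, v * w, Ideal.mul_mem_left _ _ hw', ?_⟩
    rw [map_mul, ← hw, ← hv, smul_eq_mul, mul_mul_mul_comm,
      Algebra.TensorProduct.tmul_mul_tmul, one_mul]
    rfl

variable (hL : IsSimple R D L) (hkf : IsField (constants R D K))
  (hkL : ∀ b ∈ constants R D L, ∃ c : constants R D K, algebraMap _ L c = b)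
  (hspan : Submodule.span A.toSubalgebra
    (tensorConstants R D K A.toSubalgebra : Set (A.toSubalgebra ⊗[K] A.toSubalgebra)) = ⊤)
  [Module.Flat K A.toSubalgebra] [Module.Flat K L]

include hL hkf hkL hspan in
/-- `L ⊗_K A = L ⊗_k H`, so ideals of `H` are contracted from `L ⊗_K A`. -/
lemma mem_of_inclLeft_mem_map (I : Ideal (PVAlgebra R D K A.toSubalgebra))
    {h : PVAlgebra R D K A.toSubalgebra}
    (hh : inclLeft A.toSubalgebra L A.val h ∈ I.map (inclLeft A.toSubalgebra L A.val)) :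
    h ∈ I := by
  have := hkf.free (PVAlgebra R D K A.toSubalgebra)
  have := hkf.free (PVAlgebra R D K A.toSubalgebra ⧸ I)
  let j := inclLeft (R := R) (D := D) A.toSubalgebra L A.val
  have hval : IsEquivariantMap R D A.val := isEquivariantMap_val A
  have hj : Function.Injective j := by
    intro a b hab
    exact PVAlgebra_incl_injective (Module.Flat.rTensor_preserves_injective_linearMap
      (M := A.toSubalgebra) A.val.toLinearMap Subtype.val_injective hab)
  let e : L ⊗[constants R D K] PVAlgebra R D K A.toSubalgebra →ₐ[constants R D K]
      L ⊗[K] A.toSubalgebra :=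
    Algebra.TensorProduct.lift (IsScalarTower.toAlgHom (constants R D K) L (L ⊗[K] A.toSubalgebra))
      j fun _ _ => Commute.all _ _
  have he' : ∀ l h, e (l ⊗ₜ h) = l • j h := fun l h => (Algebra.smul_def l (j h)).symm
  have he : ∀ u, e u = j.toLinearMap.liftBaseChange L u := by
    intro u
    induction u using TensorProduct.induction_on with
    | zero => simp
    | add x y hx hy => simp only [map_add, hx, hy]
    | tmul l h => rw [he']; rfl
  have hinj : Function.Injective e := by
    have h1 := injective_liftBaseChange (R := R) (D := D) hL hkL
      (LinearMap.id : L ⊗[K] A.toSubalgebra →ₗ[L] L ⊗[K] A.toSubalgebra)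
      (fun d t (ht : t = 0) => by rw [ht, map_zero, map_zero]) j.toLinearMap hj
      fun h => ⟨_, inclLeft_mem_constants hval h, rfl⟩
    intro u v huv
    rw [he, he] at huv
    exact h1 huv
  have hsurj : Function.Surjective e := by
    intro t
    obtain ⟨u, hu⟩ := surjective_liftBaseChange_inclLeft (R := R) (D := D) A.val hspan t
    exact ⟨u, (he u).trans hu⟩
  have hmap : I.map j ≤ (I.map (Algebra.TensorProduct.includeRight :
      PVAlgebra R D K A.toSubalgebra →ₐ[constants R D K] L ⊗[constants R D K] _)).map e := by
    rw [Ideal.map_le_iff_le_comap]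
    intro a ha
    have h1 : e (1 ⊗ₜ a) = j a := by rw [he', one_smul]
    rw [Ideal.mem_comap, ← h1]
    exact Ideal.mem_map_of_mem _ (Ideal.mem_map_of_mem _ ha)
  replace hh := hmap hh
  rw [Ideal.mem_map_iff_of_surjective _ hsurj] at hh
  obtain ⟨u, hu, huh⟩ := hh
  have h1 : u = 1 ⊗ₜ h := hinj (by rw [huh, he', one_smul])
  rw [← ker_map_mkₐ, RingHom.mem_ker, h1, Algebra.TensorProduct.map_tmul, map_one] at hu
  have hnt := hL.1
  have h2 : Function.Injective (Algebra.TensorProduct.includeRight :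
      (PVAlgebra R D K A.toSubalgebra ⧸ I) →ₐ[constants R D K] L ⊗[constants R D K] _) := by
    let _ := hkf.toField
    exact Algebra.TensorProduct.includeRight_injective (algebraMap (constants R D K) L).injective
  exact Ideal.Quotient.eq_zero_iff_mem.1 (h2 (hu.trans (map_zero _).symm))

include hL hkf hkL hspan in
/-- Ideals of `H` are contracted from `L ⊗_K L`: the denominators of an element of `H` form a
stable ideal of the simple module algebra `A`. -/
lemma comap_map_pvToTensor (hA : IsSimple R D A.toSubalgebra) [IsFractionRing A.toSubalgebra L]
    (I : Ideal (PVAlgebra R D K A.toSubalgebra)) :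
    (I.map (pvToTensor A)).comap (pvToTensor A) = I := by
  refine le_antisymm (fun h hh => ?_) Ideal.le_comap_map
  rw [Ideal.mem_comap] at hh
  obtain ⟨s, hs, w, hw, hsw⟩ := exists_tmul_mul_eq_of_mem_map I hh
  have hinj : Function.Injective (Algebra.TensorProduct.map (AlgHom.id K L) A.val) :=
    Module.Flat.lTensor_preserves_injective_linearMap (M := L) A.val.toLinearMap
      Subtype.val_injective
  let J := I.map (inclLeft (R := R) (D := D) A.toSubalgebra L A.val)
  have hval : IsEquivariantMap R D A.val := isEquivariantMap_val A
  have hJ : ∀ (d : D), ∀ t ∈ J, act (R := R) d t ∈ J := fun d t ht =>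
    act_mem_span_of_constants (by
      rintro _ ⟨h, _, rfl⟩; exact inclLeft_mem_constants hval h) d ht
  have h1 : (1 ⊗ₜ s) * inclLeft A.toSubalgebra L A.val h ∈ J := by
    have : (1 ⊗ₜ s) * inclLeft A.toSubalgebra L A.val h = w := hinj (by
      rw [← hsw, pvToTensor_eq_map_inclLeft, map_mul, Algebra.TensorProduct.map_tmul, map_one]
      rfl)
    rw [this]
    exact hw
  -- The ideal of denominators contains the nonzerodivisor `s`, so it is the unit ideal.
  let Q : Ideal A.toSubalgebra :=
    { carrier := {b | ((1 : L) ⊗ₜ[K] b) * inclLeft A.toSubalgebra L A.val h ∈ J}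
      add_mem' := fun {a b} ha hb => by
        change (1 ⊗ₜ (a + b)) * _ ∈ J
        rw [TensorProduct.tmul_add, add_mul]
        exact J.add_mem ha hb
      zero_mem' := by simp
      smul_mem' := fun c b hb => by
        have : (1 : L) ⊗ₜ[K] (c * b) = (1 ⊗ₜ c) * (1 ⊗ₜ b) := by simp
        change (1 ⊗ₜ (c * b)) * _ ∈ J
        rw [this, mul_assoc]
        exact J.mul_mem_left _ hb }
  have hQ : ∀ (d : D), ∀ b ∈ Q, act (R := R) d b ∈ Q := by
    intro d b hb
    change (1 ⊗ₜ act (R := R) d b) * _ ∈ J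
    rw [← act_one_tmul, ← act_mul_of_mem_constants (inclLeft_mem_constants hval h)]
    exact hJ d _ hb
  have hnt := hA.1
  have hQtop : (1 : A.toSubalgebra) ∈ Q := by
    rcases hA.2 Q hQ with hbot | htop
    · have : s ∈ Q := h1
      rw [hbot, Ideal.mem_bot] at this
      exact absurd this (nonZeroDivisors.ne_zero hs)
    · rw [htop]; trivial
  have h2 : (1 ⊗ₜ 1) * inclLeft A.toSubalgebra L A.val h ∈ J := hQtop
  rw [← Algebra.TensorProduct.one_def, one_mul] at h2
  exact mem_of_inclLeft_mem_map hL hkf hkL hspan I h2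

omit [Module.Flat K A.toSubalgebra] [Module.Flat K L]

include hL hkf hkL hspan in
/-- The kernel of `L ⊗_K L → L ⊗_M L` is generated by the elements of `H` that it contains: its
restriction to `L ⊗_K A` is a stable ideal. -/
lemma ker_mapOfCompatibleSMul_le [IsFractionRing A.toSubalgebra L]
    (M : IntermediateModuleAlgebra R D K L) :
    RingHom.ker (Algebra.TensorProduct.mapOfCompatibleSMul M.toSubalgebra K K L L) ≤
      (pvIdeal A M).map (pvToTensor A) := by
  intro p hp
  obtain ⟨s, hs, w, hw⟩ := exists_tmul_mul_eq (A := A) p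
  let q : L ⊗[K] A.toSubalgebra →ₐ[K] L ⊗[K] L :=
    Algebra.TensorProduct.map (AlgHom.id K L) A.val
  let γ := Algebra.TensorProduct.mapOfCompatibleSMul M.toSubalgebra K K L L
  have hval : IsEquivariantMap R D A.val := isEquivariantMap_val A
  have hq : IsEquivariantMap R D q := isEquivariantMap_map (fun _ _ => rfl) hval
  let J : Ideal (L ⊗[K] A.toSubalgebra) := RingHom.ker (γ.comp q)
  have hJmem : ∀ t, t ∈ J ↔ γ (q t) = 0 := fun t => Iff.rfl
  have hJ : ∀ (d : D), ∀ t ∈ J, act (R := R) d t ∈ J := by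
    intro d t ht
    have h1 := isEquivariantMap_mapOfCompatibleSMul M d (q t)
    rw [hJmem] at ht ⊢
    rw [hq]
    exact h1.trans (by rw [ht, map_zero])
  have hwJ : w ∈ J := by
    rw [hJmem]
    change γ (Algebra.TensorProduct.map (AlgHom.id K L) A.val w) = 0
    rw [← hw, map_mul, (hp : γ p = 0), mul_zero]
  have h2 := mem_span_of_stable hL hkL (fun Z => hkf.free _)
    (inclLeft (R := R) (D := D) A.toSubalgebra L A.val).toLinearMap (inclLeft_mem_constants hval)
    (surjective_liftBaseChange_inclLeft A.val hspan) J hJ hwJ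
  have h3 : q w ∈ (pvIdeal A M).map (pvToTensor A) := by
    clear hw hwJ
    induction h2 using Submodule.span_induction with
    | mem x hx =>
      obtain ⟨h, rfl, hh⟩ := hx
      change q (inclLeft A.toSubalgebra L A.val h) ∈ _
      have h4 : q (inclLeft A.toSubalgebra L A.val h) = pvToTensor A h :=
        (pvToTensor_eq_map_inclLeft A h).symm
      rw [h4]
      refine Ideal.mem_map_of_mem _ ?_
      change γ (pvToTensor A h) = 0
      rw [← h4]
      exact hh
    | zero => simp
    | add x y _ _ hx hy => rw [map_add]; exact add_mem hx hy
    | smul a x _ hx =>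
      have : q (a • x) = (a ⊗ₜ 1) * q x := by
        have h5 : a • x = (a ⊗ₜ 1) * x := Algebra.smul_def a x
        rw [h5, map_mul]
        congr 1
      rw [this]
      exact Ideal.mul_mem_left _ _ hx
  obtain ⟨u, hu⟩ := IsLocalization.map_units L (⟨s, hs⟩ : nonZeroDivisors A.toSubalgebra)
  have hu' : (u : L) = (s : L) := hu
  -- The denominator `s` is a unit of `L`.
  have h4 : p = ((1 : L) ⊗ₜ[K] ((u⁻¹ : Lˣ) : L)) * q w := by
    change p = _ * Algebra.TensorProduct.map (AlgHom.id K L) A.val w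
    rw [← hw, ← mul_assoc, Algebra.TensorProduct.tmul_mul_tmul, one_mul, ← hu',
      Units.inv_mul, ← Algebra.TensorProduct.one_def, one_mul]
  rw [h4]
  exact Ideal.mul_mem_left _ _ h3

/-- `L ⊗_K L → L ⊗_M L` identifies `x ⊗ 1` and `1 ⊗ x` only for `x ∈ M`, as `M → L` splits. -/
lemma sub_mem_ker_mapOfCompatibleSMul (M : IntermediateModuleAlgebra R D K L)
    [IsSemisimpleRing M.toSubalgebra] {x : L} :
    x ⊗ₜ[K] (1 : L) - (1 : L) ⊗ₜ[K] x ∈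
      RingHom.ker (Algebra.TensorProduct.mapOfCompatibleSMul M.toSubalgebra K K L L) ↔
      x ∈ M.toSubalgebra := by
  rw [RingHom.mem_ker, map_sub, sub_eq_zero, Algebra.TensorProduct.mapOfCompatibleSMul_tmul,
    Algebra.TensorProduct.mapOfCompatibleSMul_tmul]
  constructor
  · intro hx
    obtain ⟨π, hπ⟩ := IsSemisimpleModule.extension_property
      (Algebra.linearMap M.toSubalgebra L) Subtype.val_injective LinearMap.id
    have h1 := congrArg (fun t => LinearMap.mul' M.toSubalgebra L
      (((Algebra.linearMap M.toSubalgebra L) ∘ₗ π).lTensor L t)) hx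
    have h2 : π 1 = 1 := by simpa using LinearMap.congr_fun hπ 1
    have h3 : x = algebraMap M.toSubalgebra L (π x) := by simpa [h2] using h1
    rw [h3]
    exact (π x).2
  · intro hx
    have := TensorProduct.smul_tmul (R := M.toSubalgebra) (⟨x, hx⟩ : M.toSubalgebra) (1 : L) (1 : L)
    simpa [Algebra.smul_def] using this

end Correspondence
end ModuleAlgebra

/-! ### Hopf ideals -/

section TensorPower
open TensorProduct

variable {K A L : Type*} [CommRing K] [CommRing A] [CommRing L] [Algebra K A] [Algebra K L]

/-- Additive maps out of a tensor product that agree on pure tensors are equal. -/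
lemma RingHom.eq_of_forall_tmul {k H X : Type*} [CommRing k] [CommRing H] [Algebra k H] [CommRing X]
    {f g : H ⊗[k] H →+* X} (h : ∀ a b, f (a ⊗ₜ b) = g (a ⊗ₜ b)) (u : H ⊗[k] H) : f u = g u := by
  induction u using TensorProduct.induction_on with
  | zero => rw [map_zero, map_zero]
  | add x y hx hy => rw [map_add, map_add, hx, hy]
  | tmul a b => exact h a b

section Map₃

variable (K L) in
/-- The map `a ⊗ b ⊗ c ↦ f(a) ⊗ f(b) ⊗ f(c)` from `A ⊗_K A ⊗_K A` to `L ⊗_K L ⊗_K L`. -/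
abbrev map₃ (f : A →ₐ[K] L) : A ⊗[K] (A ⊗[K] A) →ₐ[K] L ⊗[K] (L ⊗[K] L) :=
  Algebra.TensorProduct.map f (Algebra.TensorProduct.map f f)

lemma map₃_map_includeLeft (f : A →ₐ[K] L) (t : A ⊗[K] A) :
    map₃ K L f (Algebra.TensorProduct.map (AlgHom.id K A) Algebra.TensorProduct.includeLeft t) =
      Algebra.TensorProduct.map (AlgHom.id K L) Algebra.TensorProduct.includeLeft
        (Algebra.TensorProduct.map f f t) := by
  induction t using TensorProduct.induction_on with
  | zero => simp only [map_zero]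
  | add x y hx hy => simp only [map_add, hx, hy]
  | tmul a b => simp

lemma map₃_coringComul (f : A →ₐ[K] L) (t : A ⊗[K] A) :
    map₃ K L f (coringComul K A t) = coringComul K L (Algebra.TensorProduct.map f f t) := by
  induction t using TensorProduct.induction_on with
  | zero => simp only [map_zero]
  | add x y hx hy => simp only [map_add, hx, hy]
  | tmul a b => simp [coringComul]

end Map₃

variable (M : Type*) [CommRing M] [Algebra K M] [Algebra M L] [IsScalarTower K M L]

/-- The map `a ⊗ b ↦ f(a) ⊗ f(b)` from `A ⊗_K A` to `L ⊗_M L`. -/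
def tensorPowerMap₂ (f : A →ₐ[K] L) : A ⊗[K] A →ₐ[K] L ⊗[M] L :=
  (Algebra.TensorProduct.mapOfCompatibleSMul M K K L L).comp (Algebra.TensorProduct.map f f)

/-- The map `a ⊗ b ⊗ c ↦ f(a) ⊗ f(b) ⊗ f(c)` from `A ⊗_K A ⊗_K A` to `L ⊗_M L ⊗_M L`. -/
def tensorPowerMap₃ (f : A →ₐ[K] L) : A ⊗[K] (A ⊗[K] A) →ₐ[K] L ⊗[M] (L ⊗[M] L) :=
  (Algebra.TensorProduct.mapOfCompatibleSMul M K K L (L ⊗[M] L)).comp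
    (Algebra.TensorProduct.map f (tensorPowerMap₂ M f))

lemma tensorPowerMap₂_tmul (f : A →ₐ[K] L) (a b : A) :
    tensorPowerMap₂ M f (a ⊗ₜ b) = f a ⊗ₜ f b := rfl

lemma tensorPowerMap₃_tmul (f : A →ₐ[K] L) (a : A) (t : A ⊗[K] A) :
    tensorPowerMap₃ M f (a ⊗ₜ t) = f a ⊗ₜ tensorPowerMap₂ M f t := rfl

lemma tensorPowerMap₃_map_includeLeft (f : A →ₐ[K] L) (t : A ⊗[K] A) :
    tensorPowerMap₃ M f (Algebra.TensorProduct.map (AlgHom.id K A)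
      Algebra.TensorProduct.includeLeft t) =
      Algebra.TensorProduct.map (AlgHom.id M L) (IsScalarTower.toAlgHom M L (L ⊗[M] L))
        (tensorPowerMap₂ M f t) := by
  induction t using TensorProduct.induction_on with
  | zero => simp only [map_zero]
  | add x y hx hy => simp only [map_add, hx, hy]
  | tmul a b =>
    rw [Algebra.TensorProduct.map_tmul, tensorPowerMap₂_tmul, Algebra.TensorProduct.map_tmul,
      tensorPowerMap₃_tmul, Algebra.TensorProduct.includeLeft_apply, tensorPowerMap₂_tmul, map_one]
    rfl

lemma tensorPowerMap₃_coringComul (f : A →ₐ[K] L) (t : A ⊗[K] A) :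
    tensorPowerMap₃ M f (coringComul K A t) = coringComul M L (tensorPowerMap₂ M f t) := by
  induction t using TensorProduct.induction_on with
  | zero => simp only [map_zero]
  | add x y hx hy => simp only [map_add, hx, hy]
  | tmul a b =>
    rw [tensorPowerMap₂_tmul]
    change tensorPowerMap₃ M f (a ⊗ₜ (1 ⊗ₜ b)) = f a ⊗ₜ (1 ⊗ₜ f b)
    rw [tensorPowerMap₃_tmul, tensorPowerMap₂_tmul, map_one]

end TensorPower

namespace ModuleAlgebra
open Coalgebra TensorProduct

section Coideal

variable {R D K A L M : Type*} [CommRing R] [Ring D] [Bialgebra R D] [IsCocomm R D]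
  [CommRing K] [Algebra R K] [ModuleAlgebra R D K]
  [CommRing A] [Algebra R A] [ModuleAlgebra R D A] [Algebra K A] [IsScalarTower R K A]
  [IsEquivariant R D K A]
  [CommRing L] [Algebra R L] [ModuleAlgebra R D L] [Algebra K L] [IsScalarTower R K L]
  [IsEquivariant R D K L]
  [CommRing M] [Algebra R M] [ModuleAlgebra R D M] [Algebra K M]
  [Algebra M L] [IsScalarTower K M L] [IsScalarTower R M L] [IsEquivariant R D M L]

/-- If `I` is a coideal of `H`, then the ideal it generates in `L ⊗_K L` is a coideal. -/
lemma coringComul_map_mem (S : PVHopfStructure R D K A) (f : A →ₐ[K] L)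
    (I : Ideal (PVAlgebra R D K A)) {J : Ideal (L ⊗[K] L)}
    (hJ : ∀ h ∈ I, Algebra.TensorProduct.map f f (PVAlgebra.incl R D K A h) ∈ J)
    {h : PVAlgebra R D K A}
    (hh : Algebra.TensorProduct.map (Ideal.Quotient.mkₐ (constants R D K) I)
      (Ideal.Quotient.mkₐ (constants R D K) I) (S.comul h) = 0) :
    coringComul K L (Algebra.TensorProduct.map f f (PVAlgebra.incl R D K A h)) ∈
      J.map (Algebra.TensorProduct.map (AlgHom.id K L) Algebra.TensorProduct.includeLeft :
        L ⊗[K] L →ₐ[K] L ⊗[K] (L ⊗[K] L)) ⊔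
      J.map (Algebra.TensorProduct.includeRight : L ⊗[K] L →ₐ[K] L ⊗[K] (L ⊗[K] L)) := by
  set 𝔟 := J.map (Algebra.TensorProduct.map (AlgHom.id K L)
      Algebra.TensorProduct.includeLeft : L ⊗[K] L →ₐ[K] L ⊗[K] (L ⊗[K] L)) ⊔
    J.map (Algebra.TensorProduct.includeRight : L ⊗[K] L →ₐ[K] L ⊗[K] (L ⊗[K] L))
  have hker : RingHom.ker (Ideal.Quotient.mkₐ (constants R D K) I) = I :=
    Ideal.Quotient.mkₐ_ker (constants R D K) I
  have hle : RingHom.ker (Algebra.TensorProduct.map (Ideal.Quotient.mkₐ (constants R D K) I)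
      (Ideal.Quotient.mkₐ (constants R D K) I)) ≤
      𝔟.comap ((map₃ K L f).toRingHom.comp (pvMul₂ R D K A).toRingHom) := by
    rw [Algebra.TensorProduct.map_ker _ _ (Ideal.Quotient.mkₐ_surjective _ _)
      (Ideal.Quotient.mkₐ_surjective _ _), hker, sup_le_iff,
      Ideal.map_le_iff_le_comap, Ideal.map_le_iff_le_comap]
    constructor
    · intro h hh
      change map₃ K L f (pvMul₂ R D K A (h ⊗ₜ 1)) ∈ 𝔟
      rw [pvMul₂_tmul, map_mul, map₃_map_includeLeft]
      exact 𝔟.mul_mem_right _ (Ideal.mem_sup_left (Ideal.mem_map_of_mem _ (hJ h hh)))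
    · intro h hh
      change map₃ K L f (pvMul₂ R D K A (1 ⊗ₜ h)) ∈ 𝔟
      rw [pvMul₂_tmul, map_mul, Algebra.TensorProduct.map_tmul, map_one f]
      exact 𝔟.mul_mem_left _ (Ideal.mem_sup_right (Ideal.mem_map_of_mem
        (Algebra.TensorProduct.includeRight : L ⊗[K] L →ₐ[K] L ⊗[K] (L ⊗[K] L)) (hJ h hh)))
  have h4 : map₃ K L f (pvMul₂ R D K A (S.comul h)) ∈ 𝔟 := hle hh
  rwa [S.comul_spec, map₃_coringComul] at h4

/-- With `Y` the image of `H` in `L ⊗_M L`, the map `Y ⊗ Y → L ⊗_M L ⊗_M L` is injective, so the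
elements of `H` that vanish in `L ⊗_M L` form a coideal. -/
lemma map_mkₐ_comul_eq_zero (hL : IsSimple R D L) (hkf : IsField (constants R D K))
    (hkL : ∀ b ∈ constants R D L, ∃ c : constants R D K, algebraMap _ L c = b)
    (S : PVHopfStructure R D K A) (f : A →ₐ[K] L) [Module.Flat M L] (I : Ideal (PVAlgebra R D K A))
    (hI : ∀ h, h ∈ I ↔ tensorPowerMap₂ M f (PVAlgebra.incl R D K A h) = 0)
    (hc : ∀ h, tensorPowerMap₂ M f (PVAlgebra.incl R D K A h) ∈ constants R D (L ⊗[M] L))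
    {h : PVAlgebra R D K A} (hh : h ∈ I) :
    Algebra.TensorProduct.map (Ideal.Quotient.mkₐ (constants R D K) I)
        (Ideal.Quotient.mkₐ (constants R D K) I) (S.comul h) = 0 := by
  let k := constants R D K
  let Y := PVAlgebra R D K A ⧸ I
  let mk : PVAlgebra R D K A →ₐ[k] Y := Ideal.Quotient.mkₐ k I
  let g : PVAlgebra R D K A →ₐ[k] L ⊗[M] L :=
    ((tensorPowerMap₂ M f).restrictScalars k).comp (PVAlgebra.incl R D K A)
  let i : Y →ₐ[k] L ⊗[M] L := Ideal.Quotient.liftₐ I g fun h hh => (hI h).1 hh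
  have himk : ∀ h, i (mk h) = tensorPowerMap₂ M f (PVAlgebra.incl R D K A h) := fun h => rfl
  have hi : Function.Injective i := by
    rw [injective_iff_map_eq_zero]
    intro y hy
    obtain ⟨h, rfl⟩ := Ideal.Quotient.mkₐ_surjective k I y
    exact Ideal.Quotient.eq_zero_iff_mem.2 ((hI h).2 hy)
  have hic : ∀ y, i y ∈ constants R D (L ⊗[M] L) := by
    intro y
    obtain ⟨h, rfl⟩ := Ideal.Quotient.mkₐ_surjective k I y
    exact hc h
  have := hkf.free Y
  have hj : Function.Injective (i.toLinearMap.liftBaseChange L) :=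
    injective_liftBaseChange (R := R) (D := D) hL hkL
      (LinearMap.id : L ⊗[M] L →ₗ[L] L ⊗[M] L)
      (fun d t (ht : t = 0) => by rw [ht, map_zero, map_zero]) _ hi
      fun y => ⟨_, hic y, rfl⟩
  obtain ⟨Λ, hΛ, hΛt⟩ : ∃ Λ : Y ⊗[k] Y →ₐ[k] L ⊗[M] (L ⊗[M] L),
      Function.Injective Λ ∧ ∀ y z, Λ (y ⊗ₜ z) =
        Algebra.TensorProduct.map (AlgHom.id M L) (IsScalarTower.toAlgHom M L (L ⊗[M] L)) (i y) *
          (1 ⊗ₜ i z) :=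
    ⟨_, Algebra.TensorProduct.injective_lift_of_flat i hi i hj, fun _ _ => rfl⟩
  have key : ∀ u, Λ (Algebra.TensorProduct.map mk mk u) =
      tensorPowerMap₃ M f (pvMul₂ R D K A u) :=
    RingHom.eq_of_forall_tmul (f := Λ.toRingHom.comp (Algebra.TensorProduct.map mk mk).toRingHom)
      (g := (tensorPowerMap₃ M f).toRingHom.comp (pvMul₂ R D K A).toRingHom) fun h h' => by
      change Λ (Algebra.TensorProduct.map mk mk (h ⊗ₜ h')) =
        tensorPowerMap₃ M f (pvMul₂ R D K A (h ⊗ₜ h'))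
      rw [Algebra.TensorProduct.map_tmul, hΛt, pvMul₂_tmul, map_mul, himk, himk,
        tensorPowerMap₃_map_includeLeft, tensorPowerMap₃_tmul, map_one]
  refine hΛ ((key _).trans ?_)
  rw [map_zero, S.comul_spec, tensorPowerMap₃_coringComul, (hI h).1 hh, map_zero]

end Coideal

section Flat

lemma _root_.Module.flat_of_isSemisimpleRing (B V : Type*) [CommRing B] [IsSemisimpleRing B]
    [AddCommGroup V] [Module B V] : Module.Flat B V :=
  have := Module.projective_of_isSemisimpleRing B V
  inferInstance

lemma IsAS.isSemisimpleRing {R D B : Type*} [Field R] [Ring D] [HopfAlgebra R D] [IsCocomm R D]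
    [CommRing B] [Algebra R B] [ModuleAlgebra R D B] (hB : IsAS R D B)
    (hp : IsPointedCoalgebra R D) (hBW : IsBirkhoffWittType R D) : IsSemisimpleRing B :=
  have := hB.1
  have := hB.2.isReduced hp hBW
  IsArtinianRing.isSemisimpleRing_of_isReduced B

end Flat

section HopfIdeal

variable {R D K L : Type*} [CommRing R] [Ring D] [Bialgebra R D] [IsCocomm R D]
  [CommRing K] [Algebra R K] [ModuleAlgebra R D K]
  [CommRing L] [Algebra R L] [ModuleAlgebra R D L] [Algebra K L] [IsScalarTower R K L]
  [IsEquivariant R D K L] {A : IntermediateModuleAlgebra R D K L}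

/-- Hopf ideals of `H` in terms of the structure maps. -/
lemma isHopfIdeal_iff (S : PVHopfStructure R D K A.toSubalgebra)
    (I : Ideal (PVAlgebra R D K A.toSubalgebra)) :
    letI := S.hopfAlgebra
    I.IsHopfIdeal (constants R D K) ↔ (∀ h ∈ I, S.counit h = 0) ∧
      (∀ h ∈ I, Algebra.TensorProduct.map (Ideal.Quotient.mkₐ (constants R D K) I)
        (Ideal.Quotient.mkₐ (constants R D K) I) (S.comul h) = 0) ∧
      ∀ h ∈ I, S.antipode h ∈ I := by
  let _ := S.hopfAlgebra
  constructor
  · intro hI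
    exact ⟨fun h hh => hI.counit_eq_zero hh, fun h hh => hI.map_mkQ_comul_eq_zero hh,
      fun h hh => hI.antipode_mem hh⟩
  · rintro ⟨h1, h2, h3⟩
    exact { counit_eq_zero := h1, map_mkQ_comul_eq_zero := h2, antipode_mem := h3 }

lemma lmul'_pvToTensor (S : PVHopfStructure R D K A.toSubalgebra)
    (h : PVAlgebra R D K A.toSubalgebra) :
    Algebra.TensorProduct.lmul' K (pvToTensor A h) = algebraMap K L (S.counit h : K) := by
  refine Eq.trans ?_ (congrArg A.val (S.counit_spec h).symm)
  rw [pvToTensor_apply]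
  induction PVAlgebra.incl R D K A.toSubalgebra h using TensorProduct.induction_on with
  | zero => simp
  | add x y hx hy => simp only [map_add, hx, hy]
  | tmul a b => simp

lemma comm_pvToTensor (S : PVHopfStructure R D K A.toSubalgebra)
    (h : PVAlgebra R D K A.toSubalgebra) :
    Algebra.TensorProduct.comm K L L (pvToTensor A h) = pvToTensor A (S.antipode h) := by
  rw [pvToTensor_apply, pvToTensor_apply, S.antipode_spec]
  induction PVAlgebra.incl R D K A.toSubalgebra h using TensorProduct.induction_on with
  | zero => simp
  | add x y hx hy => simp only [map_add, hx, hy]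
  | tmul a b => simp

/-- A Hopf ideal of `H` generates an ideal of `L ⊗_K L` that defines an equivalence relation. -/
lemma isEquivalenceRelation_map (S : PVHopfStructure R D K A.toSubalgebra)
    (I : Ideal (PVAlgebra R D K A.toSubalgebra))
    (hI : letI := S.hopfAlgebra; I.IsHopfIdeal (constants R D K)) :
    (I.map (pvToTensor A)).IsEquivalenceRelation := by
  obtain ⟨h1, h2, h3⟩ := (isHopfIdeal_iff S I).1 hI
  refine ⟨?_, ?_, ?_⟩
  · rw [Ideal.map_le_iff_le_comap]
    intro h hh
    rw [Ideal.mem_comap, RingHom.mem_ker, lmul'_pvToTensor S, h1 h hh]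
    exact map_zero _
  · have : I.map (pvToTensor A) ≤ (I.map (pvToTensor A)).comap
        (Algebra.TensorProduct.comm K L L).toAlgHom := by
      rw [Ideal.map_le_iff_le_comap]
      intro h hh
      have h4 := comm_pvToTensor S h
      change Algebra.TensorProduct.comm K L L (pvToTensor A h) ∈ I.map (pvToTensor A)
      rw [h4]
      exact Ideal.mem_map_of_mem _ (h3 h hh)
    exact this
  · set 𝔟 := (I.map (pvToTensor A)).map (Algebra.TensorProduct.map (AlgHom.id K L)
        Algebra.TensorProduct.includeLeft : L ⊗[K] L →ₐ[K] L ⊗[K] (L ⊗[K] L)) ⊔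
      (I.map (pvToTensor A)).map
        (Algebra.TensorProduct.includeRight : L ⊗[K] L →ₐ[K] L ⊗[K] (L ⊗[K] L))
    have : I.map (pvToTensor A) ≤ 𝔟.comap (coringComul K L) :=
      Ideal.map_le_iff_le_comap.2 fun h hh => coringComul_map_mem S A.val I
        (fun h hh => Ideal.mem_map_of_mem (pvToTensor A) hh) (h2 h hh)
    exact this

/-- The elements of `H` that vanish in `L ⊗_M L` form a Hopf ideal. -/
lemma isHopfIdeal_pvIdeal (hL : IsSimple R D L) (hkf : IsField (constants R D K))
    (hkL : ∀ b ∈ constants R D L, ∃ c : constants R D K, algebraMap _ L c = b)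
    (S : PVHopfStructure R D K A.toSubalgebra) (M : IntermediateModuleAlgebra R D K L)
    [Module.Flat M.toSubalgebra L] :
    letI := S.hopfAlgebra
    (pvIdeal A M).IsHopfIdeal (constants R D K) := by
  rw [isHopfIdeal_iff]
  let γ := Algebra.TensorProduct.mapOfCompatibleSMul M.toSubalgebra K K L L
  have hmem : ∀ h, h ∈ pvIdeal A M ↔ γ (pvToTensor A h) = 0 := fun h => Iff.rfl
  have hγ : ∀ x y : L, γ (x ⊗ₜ y) = x ⊗ₜ y := fun _ _ => rfl
  refine ⟨fun h hh => ?_, fun h hh => map_mkₐ_comul_eq_zero (M := M.toSubalgebra) hL hkf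
    hkL S A.val (pvIdeal A M) hmem ?_ hh, fun h hh => ?_⟩
  · rw [hmem] at hh
    have h1 : ∀ p, Algebra.TensorProduct.lmul' K p =
        Algebra.TensorProduct.lmul' M.toSubalgebra (γ p) := by
      intro p
      induction p using TensorProduct.induction_on with
      | zero => simp
      | add x y hx hy => simp only [map_add, hx, hy]
      | tmul a b => simp [hγ]
    have h2 := h1 (pvToTensor A h)
    rw [hh, map_zero, lmul'_pvToTensor S] at h2
    have hnt := hL.1
    let _ := hkf.toField
    exact (algebraMap (constants R D K) L).injective (h2.trans (map_zero _).symm)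
  · intro h d
    refine (isEquivariantMap_mapOfCompatibleSMul M d (pvToTensor A h)).symm.trans ?_
    rw [act_of_mem_constants (pvToTensor_mem_constants A h)]
    exact map_smul (γ.restrictScalars R) _ _
  · rw [hmem] at hh ⊢
    have h1 : ∀ p, γ (Algebra.TensorProduct.comm K L L p) =
        Algebra.TensorProduct.comm M.toSubalgebra L L (γ p) := by
      intro p
      induction p using TensorProduct.induction_on with
      | zero => simp
      | add x y hx hy => simp only [map_add, hx, hy]
      | tmul a b => simp [hγ]
    rw [← comm_pvToTensor, h1, hh, map_zero]

/-- The kernel of `L ⊗_K L → L ⊗_M L` is generated by the `x ⊗ 1 - 1 ⊗ x` with `x ∈ M`. -/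
lemma ker_mapOfCompatibleSMul_fixedAlgebra_le {I : Ideal (PVAlgebra R D K A.toSubalgebra)} :
    RingHom.ker (Algebra.TensorProduct.mapOfCompatibleSMul (fixedAlgebra A I).toSubalgebra
      K K L L) ≤ I.map (pvToTensor A) := by
  let M := (fixedAlgebra A I).toSubalgebra
  intro p hp
  have h1 : p ∈ LinearMap.ker (TensorProduct.mapOfCompatibleSMul M K M L L) := hp
  rw [TensorProduct.AlgebraTensorModule.ker_mapOfCompatibleSMul] at h1
  clear hp
  induction h1 using Submodule.span_induction with
  | mem x hx =>
    obtain ⟨a, m, n, rfl⟩ := hx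
    have h2 : (a • m) ⊗ₜ[K] n - m ⊗ₜ[K] (a • n) =
        (m ⊗ₜ[K] n) * ((a : L) ⊗ₜ[K] (1 : L) - (1 : L) ⊗ₜ[K] (a : L)) := by
      rw [mul_sub, Algebra.TensorProduct.tmul_mul_tmul, Algebra.TensorProduct.tmul_mul_tmul,
        mul_one, mul_one, mul_comm m, mul_comm n]
      rfl
    rw [h2]
    exact Ideal.mul_mem_left _ _ (mem_fixedAlgebra.1 a.2)
  | zero => exact zero_mem _
  | add x y _ _ hx hy => exact add_mem hx hy
  | smul a x _ hx =>
    have h3 : a • x = ((a : L) ⊗ₜ[K] (1 : L)) * x := Algebra.smul_def (a : L) x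
    exact (congrArg (· ∈ I.map (pvToTensor A)) h3).mpr (Ideal.mul_mem_left _ _ hx)

end HopfIdeal
end ModuleAlgebra

end

theorem mainTheorem1 {R : Type*} [Field R]
    {D : Type*} [Ring D] [HopfAlgebra R D] [Coalgebra.IsCocomm R D]
    (hpointed : IsPointedCoalgebra R D) (hBW : IsBirkhoffWittType R D)
    {K L : Type*} [CommRing K] [Algebra R K] [ModuleAlgebra R D K]
    [CommRing L] [Algebra R L] [ModuleAlgebra R D L]
    [Algebra K L] [IsScalarTower R K L] [IsEquivariant R D K L]
    (A : IntermediateModuleAlgebra R D K L) (hPV : IsPicardVessiot A) :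
    ∃ S : PVHopfStructure R D K A.toSubalgebra,
      (∀ S' : PVHopfStructure R D K A.toSubalgebra, S' = S) ∧
      letI : HopfAlgebra (ModuleAlgebra.constants R D K) (PVAlgebra R D K A.toSubalgebra) :=
        S.hopfAlgebra
      ∃ e : {M : IntermediateModuleAlgebra R D K L // ModuleAlgebra.IsAS R D M.toSubalgebra} ≃
          {I : Ideal (PVAlgebra R D K A.toSubalgebra) //
            I.IsHopfIdeal (ModuleAlgebra.constants R D K)},
        (∀ M, (e M).1 = pvIdeal A M.1) ∧
        (∀ I, ((e.symm I).1.toSubalgebra : Set L) = pvFixed A I.1) := by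
  have hL := hPV.top_isAS.2
  have := hPV.isFractionRing
  have := ModuleAlgebra.IsAS.isSemisimpleRing hPV.base_isAS hpointed hBW
  have := ModuleAlgebra.IsAS.isSemisimpleRing hPV.top_isAS hpointed hBW
  have := hL.isReduced hpointed hBW
  have := hL.1
  have hkf : IsField (ModuleAlgebra.constants R D K) := hPV.base_isAS.2.isField_constants
  have hkL : ∀ b ∈ ModuleAlgebra.constants R D L,
      ∃ c : ModuleAlgebra.constants R D K, algebraMap _ L c = b := by
    intro b hb
    rw [← hPV.constants_eq] at hb
    obtain ⟨c, hc, rfl⟩ := hb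
    exact ⟨⟨c, hc⟩, rfl⟩
  have hkA : ∀ b ∈ ModuleAlgebra.constants R D A.toSubalgebra,
      ∃ c : ModuleAlgebra.constants R D K, algebraMap _ A.toSubalgebra c = b := by
    intro b hb
    obtain ⟨c, hc⟩ := hkL _ ((ModuleAlgebra.isEquivariantMap_val A).mem_constants hb)
    exact ⟨c, Subtype.ext hc⟩
  have hA : ModuleAlgebra.IsSimple R D A.toSubalgebra :=
    ModuleAlgebra.isSimple_of_span_eq_top (fun I => Module.flat_of_isSemisimpleRing K _) hL hkf hkL
      A.val (ModuleAlgebra.isEquivariantMap_val A) Subtype.val_injective hPV.span_eq_top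
  have := Module.flat_of_isSemisimpleRing K A.toSubalgebra
  have := Module.flat_of_isSemisimpleRing K L
  obtain ⟨S⟩ := ModuleAlgebra.nonempty_pvHopfStructure hA hkf hkA hPV.span_eq_top
  have hsub := ModuleAlgebra.subsingleton_pvHopfStructure hA hkf hkA
  refine ⟨S, fun S' => Subsingleton.elim _ _, ?_⟩
  let _ := S.hopfAlgebra
  have hcomap := ModuleAlgebra.comap_map_pvToTensor hL hkf hkL hPV.span_eq_top hA
  let e : {M : IntermediateModuleAlgebra R D K L // ModuleAlgebra.IsAS R D M.toSubalgebra} ≃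
      {I : Ideal (PVAlgebra R D K A.toSubalgebra) //
        I.IsHopfIdeal (ModuleAlgebra.constants R D K)} :=
    { toFun := fun M => ⟨pvIdeal A M.1, by
        have := ModuleAlgebra.IsAS.isSemisimpleRing M.2 hpointed hBW
        have := Module.flat_of_isSemisimpleRing M.1.toSubalgebra L
        exact ModuleAlgebra.isHopfIdeal_pvIdeal hL hkf hkL S M.1⟩
      invFun := fun I => ⟨ModuleAlgebra.fixedAlgebra A I.1,
        ModuleAlgebra.isAS_fixedAlgebra hPV.top_isAS I.1⟩
      left_inv := fun M => Subtype.ext <| IntermediateModuleAlgebra.eq_of_forall_mem_iff fun x => by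
        have := ModuleAlgebra.IsAS.isSemisimpleRing M.2 hpointed hBW
        have h1 : (pvIdeal A M.1).map (pvToTensor A) = RingHom.ker
            (Algebra.TensorProduct.mapOfCompatibleSMul M.1.toSubalgebra K K L L) :=
          -- `pvIdeal A M` is the contraction of the kernel to `H`.
          le_antisymm Ideal.map_comap_le
            (ModuleAlgebra.ker_mapOfCompatibleSMul_le hL hkf hkL hPV.span_eq_top M.1)
        rw [ModuleAlgebra.mem_fixedAlgebra, h1, ModuleAlgebra.sub_mem_ker_mapOfCompatibleSMul]
      right_inv := fun I => Subtype.ext <| by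
        change pvIdeal A (ModuleAlgebra.fixedAlgebra A I.1) = I.1
        rw [pvIdeal, le_antisymm ModuleAlgebra.ker_mapOfCompatibleSMul_fixedAlgebra_le
          ((ModuleAlgebra.isEquivalenceRelation_map S I.1 I.2).le_ker_mapOfCompatibleSMul _
            fun x => ModuleAlgebra.mem_fixedAlgebra.2), hcomap] }
  exact ⟨e, fun M => rfl, fun I => Set.ext fun x => ModuleAlgebra.mem_fixedAlgebra⟩
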